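/- Let $2\le k\le N$. Consider $N$ parties with inputs $x_i\in\{0,1\}$ and outputs $a_i\in\{0,1\}$, the parties $1,\dots,k-1$ being honest and the parties in $\mathcal D=\{k,\dots,N\}$ being dishonest. A quantum strategy consists of Hilbert spaces $H_1,\dots,H_{k-1}$ (honest parties), $H_{\mathcal D}$ (the dishonest group) and $P$ (a purifying system), all of arbitrary dimension, a unit vector $\psi\in H_1\otimes\cdots\otimes H_{k-1}\otimes H_{\mathcal D}\otimes P$, a POVM $\{\Pi^{(i)}_{a|x}\}_{a\in\{0,1\}}$ on $H_i$ for each honest party $i$ and each input $x$, and, for each input string $\vec y\in\{0,1\}^{\mathcal D}$, one joint POVM $\{\Pi_{\vec a|\vec y}\}_{\vec a\in\{0,1\}^{\mathcal D}}$ on $H_{\mathcal D}$. Let $p(\vec a|\vec x)$ be the resulting correlations, $A^{(i)}_x=\Pi^{(i)}_{0|x}-\Pi^{(i)}_{1|x}$, and $M_{\vec y}=\sum_{\vec a}(-1)^{|\vec a|}\,\Pi_{\vec a|\vec y}$, where $|\cdot|$ is the Hamming weight. For $s\in\{1,-1\}$ let $$S_N^{s}(p)=\sum_{\vec x\in\{0,1\}^N}(-1)^{|\vec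 x|(|\vec x|+s)/2}\sum_{\vec a\in\{0,1\}^N}(-1)^{|\vec a|}\,p(\vec a|\vec x)$$ be the two $N$-partite Svetlichny expressions. Correlations $p$ *self-test* a $k$-qubit state $\Phi$ and $2\times 2$ matrices $\bar A^{(i)}_x$ ($1\le i\le k-1$, $x\in\{0,1\}$), $\bar M_{\vec y}$ ($\vec y\in\{0,1\}^{\mathcal D}$) if for every quantum strategy with correlations $p$ there are Hilbert spaces $R_1,\dots,R_{k-1},R_{\mathcal D}$, isometries $\Lambda_i:H_i\to\mathbb C^2\otimes R_i$ and $\Lambda_{\mathcal D}:H_{\mathcal D}\to\mathbb C^2\otimes R_{\mathcal D}$, and a vector $\zeta\in R_1\otimes\cdots\otimes R_{k-1}\otimes R_{\mathcal D}\otimes P$ such that, with $\Lambda=\Lambda_1\otimes\cdots\otimes\Lambda_{k-1}\otimes\Lambda_{\mathcal D}\otimes 1_P$ and up to the obvious reordering of tensor factors, $$\Lambda\psi=\Phi\otimes\zeta,\qquad \Lambda\bigl(A^{(1)}_{x_1}\otimes\cdots\otimes A^{(k-1)}_{x_{k-1}}\otimes M_{\vec y}\otimes 1_P\,\psi\bigr)=\bigl(\bar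 A^{(1)}_{x_1}\otimes\cdots\otimes\bar A^{(k-1)}_{x_{k-1}}\otimes\bar M_{\vec y}\,\Phi\bigr)\otimes\zeta$$ for all inputs $x_1,\dots,x_{k-1}$, $\vec y$. **Theorem.** Let $s\in\{1,-1\}$. Every quantum strategy satisfies $|S_N^{s}(p)|\le 2^{N-1}\sqrt2$, and some quantum strategy has $S_N^{s}(p)=2^{N-1}\sqrt2$. Moreover, let $\varepsilon\in\{1,-1\}$ and let $p$ be correlations with $S_N^{s}(p)=\varepsilon\,2^{N-1}\sqrt2$. Then: 1. $p$ self-tests the GHZ state $(|0\rangle^{\otimes k}+|1\rangle^{\otimes k})/\sqrt2$ together with the observables $\bar A^{(1)}_0=\varepsilon(\sigma_x+s\sigma_y)/\sqrt2$, $\bar A^{(1)}_1=\varepsilon(\sigma_y-s\sigma_x)/\sqrt2$; $\bar A^{(i)}_0=\sigma_x$, $\bar A^{(i)}_1=\sigma_y$ for $2\le i\le k-1$; and $\bar M_{\vec y}=(-1)^{\lfloor|\vec y|/2\rfloor}\sigma_x$ if $|\vec y|$ is even, $\bar M_{\vec y}=(-1)^{\lfloor|\vec y|/2\rfloor}\sigma_y$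 if $|\vec y|$ is odd. 2. Equivalently up to local unitaries, $p$ self-tests the fully connected graph state $2^{-k/2}\sum_{\tau\in\{0,1\}^k}(-1)^{\binom{|\tau|}{2}}|\tau\rangle$ together with the observables $\bar A^{(1)}_0=\varepsilon(\sigma_x-\sigma_z)/\sqrt2$, $\bar A^{(1)}_1=-s\,\varepsilon(\sigma_x+\sigma_z)/\sqrt2$; $\bar A^{(i)}_0=\sigma_z$, $\bar A^{(i)}_1=s\,\sigma_x$ for $2\le i\le k-1$; and $\bar M_{\vec y}=s^{|\vec y|}(-1)^{\lfloor|\vec y|/2\rfloor}\sigma_z$ if $|\vec y|$ is even, $\bar M_{\vec y}=s^{|\vec y|}(-1)^{\lfloor|\vec y|/2\rfloor}\sigma_x$ if $|\vec y|$ is odd. -/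

import Mathlib

open scoped TensorProduct InnerProductSpace

universe u v u' v'

noncomputable section

/-- A complex Hilbert space, of arbitrary (finite or infinite) dimension. -/
structure CHilb where
  carrier : Type u
  [normedAddCommGroup : NormedAddCommGroup carrier]
  [innerProductSpace : InnerProductSpace ℂ carrier]
  [completeSpace : CompleteSpace carrier]

attribute [instance] CHilb.normedAddCommGroup
attribute [instance] CHilb.innerProductSpace
attribute [instance] CHilb.completeSpace

instance : CoeSort CHilb.{u} (Type u) := ⟨CHilb.carrier⟩

/-- The Hilbert space of one qubit. -/
abbrev qubit : CHilb.{0} := ⟨EuclideanSpace ℂ (Fin 2)⟩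

/-- The Hilbert space tensor product: the completion of the algebraic tensor product. -/
abbrev hilbertTensor (H : CHilb.{u}) (K : CHilb.{v}) : CHilb.{max u v} :=
  ⟨UniformSpace.Completion (H.carrier ⊗[ℂ] K.carrier)⟩

/-- The bounded operator `S ⊗ T` on the Hilbert space tensor product. -/
def opTensor {H : CHilb.{u}} {H' : CHilb.{u'}} {K : CHilb.{v}}
    {K' : CHilb.{v'}} (S : H →L[ℂ] H') (T : K →L[ℂ] K') :
    hilbertTensor H K →L[ℂ] hilbertTensor H' K' :=
  (TensorProduct.mapL S T).completion

/-- The Hilbert space `H 0 ⊗ H 1 ⊗ ⋯ ⊗ H (n - 1) ⊗ K`. -/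
def multiTensor : (n : ℕ) → (Fin n → CHilb.{u}) → CHilb.{u} → CHilb.{u}
  | 0, _, K => K
  | n + 1, H, K => hilbertTensor (H 0) (multiTensor n (fun i => H i.succ) K)

/-- The bounded operator `T 0 ⊗ T 1 ⊗ ⋯ ⊗ T (n - 1) ⊗ S`. -/
def multiOp : (n : ℕ) → {H H' : Fin n → CHilb.{u}} → {K K' : CHilb.{u}} →
    (∀ i, H i →L[ℂ] H' i) → (K →L[ℂ] K') →
    (multiTensor n H K →L[ℂ] multiTensor n H' K')
  | 0, _, _, _, _, _, S => S
  | n + 1, _, _, _, _, T, S => opTensor (T 0) (multiOp n (fun i => T i.succ) S)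

/-- A measurement (POVM) with outcomes in `O`. -/
structure POVM (H : CHilb.{u}) (O : Type) [Fintype O] where
  effect : O → H →L[ℂ] H
  effect_pos : ∀ o, (effect o).IsPositive
  sum_effect : ∑ o, effect o = 1

/-- The Hamming weight of a bit string. -/
def weight {N : ℕ} (x : Fin N → Fin 2) : ℕ := ∑ i, (x i : ℕ)

/-- A behaviour `p a x`, that is `p(a|x)`, of `N` parties with binary inputs and outputs. -/
abbrev Behaviour (N : ℕ) := (Fin N → Fin 2) → (Fin N → Fin 2) → ℝ

/-- The full correlator `⟨A_{x_1} ⋯ A_{x_N}⟩`: the probability that the outcomes have even parity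
minus the probability that they have odd parity. -/
def correlator {N : ℕ} (p : Behaviour N) (x : Fin N → Fin 2) : ℝ :=
  ∑ a, (-1 : ℝ) ^ weight a * p a x

/-- The Svetlichny expressions `S_N^+` (for `s = 1`) and `S_N^-` (for `s = -1`). The integer
division by two is exact. -/
def svetlichny {N : ℕ} (s : ℤˣ) (p : Behaviour N) : ℝ :=
  ∑ x : Fin N → Fin 2,
    (-1 : ℝ) ^ (((weight x : ℤ) * ((weight x : ℤ) + (s : ℤ))) / 2) * correlator p x

/-- A quantum realization with `n` honest parties and a group of `m` dishonest parties. The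
system of the group is a single Hilbert space, and for each string of inputs the group performs
one arbitrary joint measurement, whose outcome is the string of all its outputs. The shared
(possibly mixed) state is given by a purification, whose purifying system is not touched. -/
structure Strategy (n m : ℕ) where
  /-- the systems of the honest parties -/
  honestSpace : Fin n → CHilb.{u}
  /-- the joint system of the dishonest group -/
  groupSpace : CHilb.{u}
  /-- the purifying system -/
  purifier : CHilb.{u}
  state : multiTensor n honestSpace (hilbertTensor groupSpace purifier)
  norm_state : ‖state‖ = 1
  honest : ∀ i, Fin 2 → POVM (honestSpace i) (Fin 2)
  group : (Fin m → Fin 2) → POVM groupSpace (Fin m → Fin 2)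

namespace Strategy

variable {n m : ℕ} (S : Strategy.{u} n m)

/-- The operator `T_1 ⊗ ⋯ ⊗ T_n ⊗ M ⊗ 1` on the space that contains the purification. -/
def jointOp (T : ∀ i, S.honestSpace i →L[ℂ] S.honestSpace i)
    (M : S.groupSpace →L[ℂ] S.groupSpace) :
    multiTensor n S.honestSpace (hilbertTensor S.groupSpace S.purifier) →L[ℂ]
      multiTensor n S.honestSpace (hilbertTensor S.groupSpace S.purifier) :=
  multiOp n T (opTensor M (ContinuousLinearMap.id ℂ S.purifier))

/-- The behaviour `p(a|x)` of the strategy, by the Born rule. The honest parties are the first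
`n` of the `n + m` parties, the dishonest ones are the last `m`. -/
def behaviour : Behaviour (n + m) := fun a x =>
  (⟪S.state, S.jointOp
    (fun i => (S.honest i (x (Fin.castAdd m i))).effect (a (Fin.castAdd m i)))
    ((S.group (fun j => x (Fin.natAdd n j))).effect (fun j => a (Fin.natAdd n j)))
    S.state⟫_ℂ).re

/-- The observable `Π_{0|x} - Π_{1|x}` of honest party `i`. -/
def honestObs (i : Fin n) (x : Fin 2) : S.honestSpace i →L[ℂ] S.honestSpace i :=
  (S.honest i x).effect 0 - (S.honest i x).effect 1

/-- The joint observable of the dishonest group for the input string `x`, given by the parity of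
its outcomes. -/
def groupObs (x : Fin m → Fin 2) : S.groupSpace →L[ℂ] S.groupSpace :=
  ∑ a : Fin m → Fin 2, (-1 : ℂ) ^ weight a • (S.group x).effect a

end Strategy

/-- The amplitudes, in the computational basis, of a vector of `k` qubits. -/
abbrev QubitVec (k : ℕ) := (Fin k → Fin 2) → ℂ

/-- The vector `(C_1 ⊗ ⋯ ⊗ C_k) Φ`, for `2 × 2` matrices `C_j`. -/
def applyLocal {k : ℕ} (C : Fin k → Matrix (Fin 2) (Fin 2) ℂ) (Φ : QubitVec k) : QubitVec k :=
  fun τ => ∑ σ, (∏ j, C j (τ j) (σ j)) * Φ σ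

/-- The isometry `r ↦ |b⟩ ⊗ r`. -/
def attachKet (R : CHilb.{u}) (b : Fin 2) : R →L[ℂ] hilbertTensor qubit R :=
  UniformSpace.Completion.toComplL.comp
    (TensorProduct.mkL ℂ qubit.carrier R.carrier (EuclideanSpace.single b (1 : ℂ)))

/-- The vector `Φ ⊗ ζ`, where the `i`-th qubit of `Φ` belongs to honest party `i` for `i < n`, the
last qubit belongs to the dishonest group, and `ζ` is a vector of the remaining degrees of
freedom of the parties and of the purifying system:
`Φ ⊗ ζ = ∑ τ, Φ τ • (|τ⟩ ⊗ ζ)`. -/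
def withQubits {n : ℕ} {R : Fin n → CHilb.{u}} {RD P : CHilb.{u}}
    (Φ : QubitVec (n + 1)) (ζ : multiTensor n R (hilbertTensor RD P)) :
    multiTensor n (fun i => hilbertTensor qubit (R i))
      (hilbertTensor (hilbertTensor qubit RD) P) :=
  ∑ τ : Fin (n + 1) → Fin 2,
    Φ τ • multiOp n (fun i => attachKet (R i) (τ i.castSucc))
      (opTensor (attachKet RD (τ (Fin.last n))) (ContinuousLinearMap.id ℂ P)) ζ

/-- The behaviour `p` self-tests, in the scenario with `n` honest parties and a group of `m`
dishonest ones, the `(n + 1)`-partite state `Φ`, the observables `A i 0`, `A i 1` of honest party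
`i`, and the joint observables `B x` of the group. -/
def SelfTests {n m : ℕ} (p : Behaviour (n + m)) (Φ : QubitVec (n + 1))
    (A : Fin n → Fin 2 → Matrix (Fin 2) (Fin 2) ℂ)
    (B : (Fin m → Fin 2) → Matrix (Fin 2) (Fin 2) ℂ) : Prop :=
  ∀ S : Strategy.{u} n m, S.behaviour = p →
    ∃ (R : Fin n → CHilb.{u}) (RD : CHilb.{u})
      (Λ : ∀ i, S.honestSpace i →ₗᵢ[ℂ] hilbertTensor qubit (R i))
      (ΛD : S.groupSpace →ₗᵢ[ℂ] hilbertTensor qubit RD)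
      (ζ : multiTensor n R (hilbertTensor RD S.purifier)),
      let V := multiOp n (fun i => (Λ i).toContinuousLinearMap)
        (opTensor ΛD.toContinuousLinearMap (ContinuousLinearMap.id ℂ S.purifier))
      V S.state = withQubits Φ ζ ∧
      ∀ (x : Fin n → Fin 2) (y : Fin m → Fin 2),
        V (S.jointOp (fun i => S.honestObs i (x i)) (S.groupObs y) S.state) =
          withQubits (applyLocal (Fin.snoc (fun i => A i (x i)) (B y)) Φ) ζ

/-- The Pauli matrix `σ_x`. -/
def pauliX : Matrix (Fin 2) (Fin 2) ℂ := !![0, 1; 1, 0]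

/-- The Pauli matrix `σ_y`. -/
def pauliY : Matrix (Fin 2) (Fin 2) ℂ := !![0, -Complex.I; Complex.I, 0]

/-- The Pauli matrix `σ_z`. -/
def pauliZ : Matrix (Fin 2) (Fin 2) ℂ := !![1, 0; 0, -1]

/-- The `k`-partite GHZ state `(|0⋯0⟩ + |1⋯1⟩) / √2`. -/
def ghzState (k : ℕ) : QubitVec k := fun τ =>
  if (∀ j, τ j = 0) ∨ (∀ j, τ j = 1) then (1 / √2 : ℝ) else 0

/-- Target observables of the honest parties for the GHZ state: `σ_x`, `σ_y` for all parties but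
the first, whose observables are `± (σ_x + s σ_y) / √2` and `± (σ_y - s σ_x) / √2`, the overall
sign being `ε`. -/
def ghzHonest {n : ℕ} (s ε : ℤˣ) (i : Fin n) (x : Fin 2) : Matrix (Fin 2) (Fin 2) ℂ :=
  if (i : ℕ) = 0 then
    ((((ε : ℤ) : ℝ) / √2 : ℝ) : ℂ) •
      (if x = 0 then pauliX + ((s : ℤ) : ℂ) • pauliY else pauliY - ((s : ℤ) : ℂ) • pauliX)
  else if x = 0 then pauliX else pauliY

/-- Target joint observables of the dishonest group for the GHZ state: `± σ_x` for inputs of even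
weight, `± σ_y` for inputs of odd weight. -/
def ghzGroup {m : ℕ} (y : Fin m → Fin 2) : Matrix (Fin 2) (Fin 2) ℂ :=
  (-1 : ℂ) ^ (weight y / 2) • (if Even (weight y) then pauliX else pauliY)

/-- The `k`-partite fully connected graph state, which is local-unitarily equivalent to the GHZ
state: the amplitude of `|τ⟩` has the sign `(-1) ^ e`, where `e` is the number of edges of the
complete graph both of whose ends carry a one. -/
def graphState (k : ℕ) : QubitVec k := fun τ =>
  ((1 / √2 : ℝ) : ℂ) ^ k * (-1 : ℂ) ^ (weight τ).choose 2

/-- Target observables of the honest parties for the fully connected graph state. -/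
def graphHonest {n : ℕ} (s ε : ℤˣ) (i : Fin n) (x : Fin 2) : Matrix (Fin 2) (Fin 2) ℂ :=
  ((s : ℤ) : ℂ) ^ (x : ℕ) •
    if (i : ℕ) = 0 then
      ((((ε : ℤ) : ℝ) / √2 : ℝ) : ℂ) •
        (if x = 0 then pauliX - pauliZ else -(pauliX + pauliZ))
    else if x = 0 then pauliZ else pauliX

/-- Target joint observables of the dishonest group for the fully connected graph state: `± σ_z`
for inputs of even weight, `± σ_x` for inputs of odd weight. -/
def graphGroup {m : ℕ} (s : ℤˣ) (y : Fin m → Fin 2) : Matrix (Fin 2) (Fin 2) ℂ :=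
  (((s : ℤ) : ℂ) ^ weight y * (-1 : ℂ) ^ (weight y / 2)) •
    (if Even (weight y) then pauliZ else pauliX)

end

/-! Let A₀, A₁ be the first party's observables and, for inputs r of weight w of all the other
parties, let O_r be the product of their observables. Grouping by r, the Svetlichny expression is
Σ_r Re⟨O_r ψ, g_r A₀ψ + g'_r A₁ψ⟩, where g_r and g'_r are the Svetlichny signs at weights w and w +
1. The products g_r g'_r alternate with w, so they sum to zero. Hence Σ_r ‖εO_r ψ − (g_r A₀ψ + g'_r
A₁ψ)/√2‖² has no cross term in A₀ψ and A₁ψ, and its nonnegativity is the bound (`sum_norm_sub_sq`,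
`svetlichny_bound`).

At the maximum every square vanishes and ‖O_r ψ‖ = 1, so O_r ψ = ε(−1)^⌊w/2⌋ F_w ψ. Here F_w is E =
(A₀ − sA₁)/√2 for even w and F = −(sA₀ + A₁)/√2 for odd w. Since O_r commutes with the first party
and squares to 1 on ψ, E²ψ = F²ψ = ψ. The identities E² + F² = A₀² + A₁² and F² − E² = s(A₀A₁ +
A₁A₀) then make A₀ and A₁ anticommuting involutions on ψ (`anticommutingOn_first`). The observable
of any other party acts on ψ like an operator of the remaining parties built from E or F, which
transfers the relations to it (`anticommutingOn_rest`) and expresses every group observable on ψ by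
two of them (`site_group`).

Anticommuting involutions yield a swap isometry to a qubit. Measurements need not be projective, so
the observables are only self-adjoint contractions and all relations hold on ψ only. The swap map is
therefore a contraction, completed to an isometry by a defect operator that kills ψ
(`exists_swapMaps`). Applying the components of the swap maps to O_r ψ = ±F_w ψ shows that the
amplitudes of ψ are invariant under flipping all bits and vanish unless all bits agree, which is the
GHZ state (`localOp_rev`, `localOp_eq_zero`). The graph state version follows by a local change of
basis (`rotate`, `graphState_eq`), and the GHZ state with equatorial observables attains the maximum
(`svetlichny_ghzStrategy`).

Parties are indexed by `Option (Fin n)`, with `none` for the group, so that tensor products of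
operators form one multilinear map `localOp`. -/

noncomputable section

/-! ### Operators on the completed tensor product -/

section OpTensor

variable {H : CHilb.{u}} {H' H'' : CHilb.{u}} {K K' K'' : CHilb.{u}}

/-- The vector `v ⊗ w` of the Hilbert space tensor product. -/
def tmulVec {H : CHilb.{u}} {K : CHilb.{v}} (v : H) (w : K) : hilbertTensor H K :=
  ((v ⊗ₜ[ℂ] w : H.carrier ⊗[ℂ] K.carrier) : UniformSpace.Completion (H.carrier ⊗[ℂ] K.carrier))

theorem inner_tmulVec {H : CHilb.{u}} {K : CHilb.{v}} (v v' : H) (w w' : K) :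
    ⟪tmulVec v w, tmulVec v' w'⟫_ℂ = ⟪v, v'⟫_ℂ * ⟪w, w'⟫_ℂ := by
  simp [tmulVec]

theorem opTensor_coe (S : H →L[ℂ] H') (T : K →L[ℂ] K') (x : H.carrier ⊗[ℂ] K.carrier) :
    opTensor S T (x : UniformSpace.Completion (H.carrier ⊗[ℂ] K.carrier)) =
      ((TensorProduct.mapL S T x : H'.carrier ⊗[ℂ] K'.carrier) :
        UniformSpace.Completion (H'.carrier ⊗[ℂ] K'.carrier)) := by
  exact UniformSpace.Completion.map_coe (TensorProduct.mapL S T).uniformContinuous x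

theorem opTensor_tmulVec (S : H →L[ℂ] H') (T : K →L[ℂ] K') (v : H) (w : K) :
    opTensor S T (tmulVec v w) = tmulVec (S v) (T w) := by
  rw [tmulVec, opTensor_coe]; rfl

/-- The algebraic tensor product is dense in its completion. Algebraic identities for `opTensor`
reduce in this way to those for `TensorProduct.mapL`. -/
theorem hilbertTensor_ext {F : Type*} [NormedAddCommGroup F] [NormedSpace ℂ F]
    {A B : hilbertTensor H K →L[ℂ] F}
    (h : ∀ x : H.carrier ⊗[ℂ] K.carrier,
      A (x : UniformSpace.Completion (H.carrier ⊗[ℂ] K.carrier)) =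
        B (x : UniformSpace.Completion (H.carrier ⊗[ℂ] K.carrier))) : A = B := by
  ext x
  induction x using UniformSpace.Completion.induction_on with
  | hp => exact isClosed_eq A.continuous B.continuous
  | ih x => exact h x

theorem opTensor_comp (S : H' →L[ℂ] H'') (S' : H →L[ℂ] H') (T : K' →L[ℂ] K'')
    (T' : K →L[ℂ] K') :
    opTensor (S ∘L S') (T ∘L T') = opTensor S T ∘L opTensor S' T' := by
  refine hilbertTensor_ext fun x => ?_
  rw [ContinuousLinearMap.comp_apply, opTensor_coe, opTensor_coe, opTensor_coe,
    TensorProduct.mapL_comp]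
  rfl

theorem opTensor_id :
    opTensor (ContinuousLinearMap.id ℂ H) (ContinuousLinearMap.id ℂ K) =
      ContinuousLinearMap.id ℂ (hilbertTensor H K) := by
  refine hilbertTensor_ext fun x => ?_
  rw [opTensor_coe, TensorProduct.mapL_id_id]
  rfl

theorem opTensor_add_left (S S' : H →L[ℂ] H') (T : K →L[ℂ] K') :
    opTensor (S + S') T = opTensor S T + opTensor S' T := by
  refine hilbertTensor_ext fun x => ?_
  rw [add_apply, opTensor_coe, opTensor_coe, opTensor_coe,
    TensorProduct.mapL_add_left, add_apply, UniformSpace.Completion.coe_add]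

theorem opTensor_add_right (S : H →L[ℂ] H') (T T' : K →L[ℂ] K') :
    opTensor S (T + T') = opTensor S T + opTensor S T' := by
  refine hilbertTensor_ext fun x => ?_
  rw [add_apply, opTensor_coe, opTensor_coe, opTensor_coe,
    TensorProduct.mapL_add_right, add_apply, UniformSpace.Completion.coe_add]

theorem opTensor_smul_left (c : ℂ) (S : H →L[ℂ] H') (T : K →L[ℂ] K') :
    opTensor (c • S) T = c • opTensor S T := by
  refine hilbertTensor_ext fun x => ?_
  rw [smul_apply, opTensor_coe, opTensor_coe,
    TensorProduct.mapL_smul_left, smul_apply, UniformSpace.Completion.coe_smul]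

theorem opTensor_smul_right (c : ℂ) (S : H →L[ℂ] H') (T : K →L[ℂ] K') :
    opTensor S (c • T) = c • opTensor S T := by
  refine hilbertTensor_ext fun x => ?_
  rw [smul_apply, opTensor_coe, opTensor_coe,
    TensorProduct.mapL_smul_right, smul_apply,
    UniformSpace.Completion.coe_smul]

theorem norm_opTensor_le (S : H →L[ℂ] H') (T : K →L[ℂ] K') :
    ‖opTensor S T‖ ≤ ‖S‖ * ‖T‖ := by
  refine ContinuousLinearMap.opNorm_le_bound _ (by positivity) fun x => ?_
  induction x using UniformSpace.Completion.induction_on with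
  | hp => exact isClosed_le (opTensor S T).continuous.norm (continuous_const.mul continuous_norm)
  | ih x =>
    rw [opTensor_coe, UniformSpace.Completion.norm_coe, UniformSpace.Completion.norm_coe]
    exact (ContinuousLinearMap.le_opNorm _ _).trans
      (mul_le_mul_of_nonneg_right (TensorProduct.norm_mapL_le S T) (norm_nonneg _))

theorem inner_mapL_left (S : H →L[ℂ] H') (T : K →L[ℂ] K') (x : H.carrier ⊗[ℂ] K.carrier)
    (y : H'.carrier ⊗[ℂ] K'.carrier) :
    ⟪TensorProduct.mapL S T x, y⟫_ℂ =
      ⟪x, TensorProduct.mapL (ContinuousLinearMap.adjoint S) (ContinuousLinearMap.adjoint T) y⟫_ℂ := by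
  induction x with
  | zero => simp
  | add x x' hx hx' => rw [map_add, inner_add_left, inner_add_left, hx, hx']
  | tmul v w =>
    induction y with
    | zero => simp
    | add y y' hy hy' => rw [map_add, inner_add_right, inner_add_right, hy, hy']
    | tmul v' w' =>
      rw [TensorProduct.mapL_tmul, TensorProduct.mapL_tmul, TensorProduct.inner_tmul,
        TensorProduct.inner_tmul, ContinuousLinearMap.adjoint_inner_right,
        ContinuousLinearMap.adjoint_inner_right]

theorem adjoint_opTensor (S : H →L[ℂ] H') (T : K →L[ℂ] K') :
    ContinuousLinearMap.adjoint (opTensor S T) =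
      opTensor (ContinuousLinearMap.adjoint S) (ContinuousLinearMap.adjoint T) := by
  symm
  rw [ContinuousLinearMap.eq_adjoint_iff]
  intro y x
  induction x using UniformSpace.Completion.induction_on with
  | hp => exact isClosed_eq (by fun_prop) (by fun_prop)
  | ih x =>
    induction y using UniformSpace.Completion.induction_on with
    | hp => exact isClosed_eq (by fun_prop) (by fun_prop)
    | ih y =>
      rw [opTensor_coe, opTensor_coe, UniformSpace.Completion.inner_coe,
        UniformSpace.Completion.inner_coe]
      have := inner_mapL_left S T x y
      rw [← inner_conj_symm, ← this, inner_conj_symm]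

end OpTensor

/-! ### Iterated tensor products -/

section MultiOp

theorem multiOp_comp : ∀ (n : ℕ) {H H' H'' : Fin n → CHilb.{u}} {K K' K'' : CHilb.{u}}
    (T : ∀ i, H' i →L[ℂ] H'' i) (T' : ∀ i, H i →L[ℂ] H' i) (S : K' →L[ℂ] K'') (S' : K →L[ℂ] K'),
    multiOp n (fun i => T i ∘L T' i) (S ∘L S') = multiOp n T S ∘L multiOp n T' S'
  | 0, _, _, _, _, _, _, _, _, _, _ => rfl
  | n + 1, _, _, _, _, _, _, T, T', S, S' => by
    rw [multiOp, multiOp_comp n, opTensor_comp]; rfl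

theorem multiOp_id : ∀ (n : ℕ) {H : Fin n → CHilb.{u}} {K : CHilb.{u}},
    multiOp n (fun i => ContinuousLinearMap.id ℂ (H i)) (ContinuousLinearMap.id ℂ K) =
      ContinuousLinearMap.id ℂ (multiTensor n H K)
  | 0, _, _ => rfl
  | n + 1, H, K => by
    rw [multiOp, multiOp_id n, opTensor_id]; rfl

theorem multiOp_last_add : ∀ (n : ℕ) {H H' : Fin n → CHilb.{u}} {K K' : CHilb.{u}}
    (T : ∀ i, H i →L[ℂ] H' i) (S S' : K →L[ℂ] K'),
    multiOp n T (S + S') = multiOp n T S + multiOp n T S'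
  | 0, _, _, _, _, _, _, _ => rfl
  | n + 1, _, _, _, _, T, S, S' => by
    rw [multiOp, multiOp_last_add n, opTensor_add_right]; rfl

theorem multiOp_last_smul : ∀ (n : ℕ) {H H' : Fin n → CHilb.{u}} {K K' : CHilb.{u}}
    (T : ∀ i, H i →L[ℂ] H' i) (c : ℂ) (S : K →L[ℂ] K'),
    multiOp n T (c • S) = c • multiOp n T S
  | 0, _, _, _, _, _, _, _ => rfl
  | n + 1, _, _, _, _, T, S, S' => by
    rw [multiOp, multiOp_last_smul n, opTensor_smul_right]; rfl

theorem update_succ_tail {n : ℕ} {α : Fin (n + 1) → Type*} (T : ∀ i, α i) (i : Fin n)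
    (a : α i.succ) :
    (fun j : Fin n => Function.update T i.succ a j.succ) =
      Function.update (fun j : Fin n => T j.succ) i a := by
  ext j
  by_cases h : j = i
  · subst h; simp
  · rw [Function.update_of_ne h, Function.update_of_ne (by simpa using h)]

theorem update_zero_tail {n : ℕ} {α : Fin (n + 1) → Type*} (T : ∀ i, α i) (a : α 0) :
    (fun j : Fin n => Function.update T 0 a j.succ) = fun j : Fin n => T j.succ := by
  ext j
  rw [Function.update_of_ne (Fin.succ_ne_zero j)]

theorem multiOp_update_add : ∀ (n : ℕ) {H H' : Fin n → CHilb.{u}} {K K' : CHilb.{u}}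
    (T : ∀ i, H i →L[ℂ] H' i) (S : K →L[ℂ] K') (i : Fin n) (a b : H i →L[ℂ] H' i),
    multiOp n (Function.update T i (a + b)) S =
      multiOp n (Function.update T i a) S + multiOp n (Function.update T i b) S
  | n + 1, H, H', K, K', T, S, i, a, b => by
    cases i using Fin.cases with
    | zero =>
      simp only [multiOp, update_zero_tail, Function.update_self]
      exact opTensor_add_left _ _ _
    | succ i =>
      simp only [multiOp, update_succ_tail,
        Function.update_of_ne (Fin.succ_ne_zero i).symm]
      rw [multiOp_update_add n]
      exact opTensor_add_right _ _ _

theorem multiOp_update_smul : ∀ (n : ℕ) {H H' : Fin n → CHilb.{u}} {K K' : CHilb.{u}}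
    (T : ∀ i, H i →L[ℂ] H' i) (S : K →L[ℂ] K') (i : Fin n) (c : ℂ) (a : H i →L[ℂ] H' i),
    multiOp n (Function.update T i (c • a)) S = c • multiOp n (Function.update T i a) S
  | n + 1, H, H', K, K', T, S, i, c, a => by
    cases i using Fin.cases with
    | zero =>
      simp only [multiOp, update_zero_tail, Function.update_self]
      exact opTensor_smul_left _ _ _
    | succ i =>
      simp only [multiOp, update_succ_tail,
        Function.update_of_ne (Fin.succ_ne_zero i).symm]
      rw [multiOp_update_smul n]
      exact opTensor_smul_right _ _ _

theorem norm_multiOp_le_one : ∀ (n : ℕ) {H H' : Fin n → CHilb.{u}} {K K' : CHilb.{u}}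
    (T : ∀ i, H i →L[ℂ] H' i) (S : K →L[ℂ] K'), (∀ i, ‖T i‖ ≤ 1) → ‖S‖ ≤ 1 →
    ‖multiOp n T S‖ ≤ 1
  | 0, _, _, _, _, _, _, _, h => by exact h
  | n + 1, _, _, _, _, T, S, hT, hS =>
    (norm_opTensor_le _ _).trans (mul_le_one₀ (hT 0) (norm_nonneg _)
      (norm_multiOp_le_one n _ S (fun i => hT i.succ) hS))

theorem adjoint_multiOp : ∀ (n : ℕ) {H H' : Fin n → CHilb.{u}} {K K' : CHilb.{u}}
    (T : ∀ i, H i →L[ℂ] H' i) (S : K →L[ℂ] K'),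
    ContinuousLinearMap.adjoint (multiOp n T S) =
      multiOp n (fun i => ContinuousLinearMap.adjoint (T i)) (ContinuousLinearMap.adjoint S)
  | 0, _, _, _, _, _, _ => rfl
  | n + 1, _, _, _, _, T, S => by
    rw [multiOp, multiOp, ← adjoint_multiOp n]
    exact adjoint_opTensor _ _

/-- The vector `v 0 ⊗ v 1 ⊗ ⋯ ⊗ v (n - 1) ⊗ w`. -/
def multiVec : (n : ℕ) → {H : Fin n → CHilb.{u}} → {K : CHilb.{u}} → (∀ i, H i) → K →
    multiTensor n H K
  | 0, _, _, _, w => w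
  | n + 1, _, _, v, w => tmulVec (v 0) (multiVec n (fun i => v i.succ) w)

theorem multiOp_multiVec : ∀ (n : ℕ) {H H' : Fin n → CHilb.{u}} {K K' : CHilb.{u}}
    (T : ∀ i, H i →L[ℂ] H' i) (S : K →L[ℂ] K') (v : ∀ i, H i) (w : K),
    multiOp n T S (multiVec n v w) = multiVec n (fun i => T i (v i)) (S w)
  | 0, _, _, _, _, _, _, _, _ => rfl
  | n + 1, _, _, _, _, T, S, v, w => by
    rw [multiVec, multiVec, ← multiOp_multiVec n]
    exact opTensor_tmulVec _ _ _ _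

theorem inner_multiVec : ∀ (n : ℕ) {H : Fin n → CHilb.{u}} {K : CHilb.{u}}
    (v v' : ∀ i, H i) (w w' : K),
    ⟪multiVec n v w, multiVec n v' w'⟫_ℂ = (∏ i, ⟪v i, v' i⟫_ℂ) * ⟪w, w'⟫_ℂ
  | 0, _, _, _, _, _, _ => by simp [multiVec]; rfl
  | n + 1, _, _, v, v', w, w' => by
    rw [Fin.prod_univ_succ, mul_assoc, ← inner_multiVec n]
    exact inner_tmulVec _ _ _ _

end MultiOp

/-! ### Operators of single parties, and operators that are null for a state -/

section LocalOperators

variable {n : ℕ} {H H' H'' : Option (Fin n) → CHilb.{u}} {P : CHilb.{u}}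

/-- The space of the parties `some 0, …, some (n - 1), none` and of a purifying system `P`. -/
abbrev totalSpace (H : Option (Fin n) → CHilb.{u}) (P : CHilb.{u}) : CHilb.{u} :=
  multiTensor n (fun i => H (some i)) (hilbertTensor (H none) P)

/-- The tensor product of one operator per party and the identity of the purifying system. -/
def localOp (P : CHilb.{u}) :
    MultilinearMap ℂ (fun o => H o →L[ℂ] H' o) (totalSpace H P →L[ℂ] totalSpace H' P) where
  toFun T := multiOp n (fun i => T (some i)) (opTensor (T none) (ContinuousLinearMap.id ℂ P))
  map_update_add' {_} T o a b := by
    cases o with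
    | none =>
      have h (c) : (fun i => Function.update T none c (some i)) = fun i => T (some i) := by
        ext i; simp
      simp only [h, Function.update_self, opTensor_add_left]
      exact multiOp_last_add _ _ _ _
    | some i =>
      have h (c) : (fun j => Function.update T (some i) c (some j)) =
          Function.update (fun j => T (some j)) i c := by
        ext j
        by_cases hj : j = i
        · subst hj; simp
        · rw [Function.update_of_ne hj, Function.update_of_ne (by simpa using hj)]
      simp only [h, Function.update_of_ne (Option.some_ne_none i).symm]
      exact multiOp_update_add _ _ _ _ _ _
  map_update_smul' {_} T o c a := by
    cases o with
    | none =>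
      have h (c) : (fun i => Function.update T none c (some i)) = fun i => T (some i) := by
        ext i; simp
      simp only [h, Function.update_self, opTensor_smul_left]
      exact multiOp_last_smul _ _ _ _
    | some i =>
      have h (c) : (fun j => Function.update T (some i) c (some j)) =
          Function.update (fun j => T (some j)) i c := by
        ext j
        by_cases hj : j = i
        · subst hj; simp
        · rw [Function.update_of_ne hj, Function.update_of_ne (by simpa using hj)]
      simp only [h, Function.update_of_ne (Option.some_ne_none i).symm]
      exact multiOp_update_smul _ _ _ _ _ _

theorem localOp_apply (T : ∀ o, H o →L[ℂ] H' o) :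
    localOp P T =
      multiOp n (fun i => T (some i)) (opTensor (T none) (ContinuousLinearMap.id ℂ P)) := rfl

theorem localOp_comp (T : ∀ o, H' o →L[ℂ] H'' o) (T' : ∀ o, H o →L[ℂ] H' o) :
    localOp P (fun o => T o ∘L T' o) = localOp P T ∘L localOp P T' := by
  rw [localOp_apply, localOp_apply, localOp_apply, ← multiOp_comp, ← opTensor_comp]
  rfl

theorem localOp_id :
    localOp P (fun o => ContinuousLinearMap.id ℂ (H o)) =
      ContinuousLinearMap.id ℂ (totalSpace H P) := by
  rw [localOp_apply, opTensor_id, multiOp_id]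

theorem adjoint_localOp (T : ∀ o, H o →L[ℂ] H' o) :
    ContinuousLinearMap.adjoint (localOp P T) =
      localOp P (fun o => ContinuousLinearMap.adjoint (T o)) := by
  rw [localOp_apply, localOp_apply, adjoint_multiOp, adjoint_opTensor]
  have : ContinuousLinearMap.adjoint (ContinuousLinearMap.id ℂ P) = ContinuousLinearMap.id ℂ P :=
    star_one (P →L[ℂ] P)
  rw [this]

theorem norm_localOp_le_one (T : ∀ o, H o →L[ℂ] H' o) (hT : ∀ o, ‖T o‖ ≤ 1) :
    ‖localOp P T‖ ≤ 1 :=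
  norm_multiOp_le_one _ _ _ (fun _ => hT _)
    ((norm_opTensor_le _ _).trans (mul_le_one₀ (hT none) (norm_nonneg _)
      ContinuousLinearMap.norm_id_le))

theorem localOp_update_comp (W : ∀ o, H o →L[ℂ] H' o) (o : Option (Fin n))
    (G : H o →L[ℂ] H' o) (k : H o →L[ℂ] H o) :
    localOp P (Function.update W o (G ∘L k)) =
      localOp P (Function.update W o G) ∘L
        localOp P (Function.update (fun o => ContinuousLinearMap.id ℂ (H o)) o k) := by
  rw [← localOp_comp]
  congr 1
  ext1 o'
  by_cases h : o' = o
  · subst h; simp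
  · simp [Function.update_of_ne h]

/-- The operator of the total space that acts on the system of the party `o` only. -/
def site (P : CHilb.{u}) (o : Option (Fin n)) :
    (H o →L[ℂ] H o) →⋆ₐ[ℂ] (totalSpace H P →L[ℂ] totalSpace H P) :=
  { AlgHom.ofLinearMap ((localOp P).toLinearMap (fun o => ContinuousLinearMap.id ℂ (H o)) o)
      (by
        change localOp P (Function.update _ o (ContinuousLinearMap.id ℂ (H o))) =
          ContinuousLinearMap.id ℂ _
        rw [Function.update_eq_self, localOp_id])
      (fun a b => localOp_update_comp _ o a b) with
    map_star' := fun a => by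
      change localOp P (Function.update _ o (ContinuousLinearMap.adjoint a)) =
        ContinuousLinearMap.adjoint (localOp P (Function.update _ o a))
      rw [adjoint_localOp]
      congr 1
      ext1 o'
      by_cases h : o' = o
      · subst h; simp
      · simp only [Function.update_of_ne h]
        exact (star_one (H o' →L[ℂ] H o')).symm }

theorem site_apply (o : Option (Fin n)) (a : H o →L[ℂ] H o) :
    site P o a = localOp P (Function.update (fun o => ContinuousLinearMap.id ℂ (H o)) o a) := rfl

theorem norm_site_le_one (o : Option (Fin n)) {a : H o →L[ℂ] H o} (ha : ‖a‖ ≤ 1) :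
    ‖site P o a‖ ≤ 1 := by
  refine norm_localOp_le_one _ fun o' => ?_
  by_cases h : o' = o
  · subst h; simpa using ha
  · simpa [Function.update_of_ne h] using ContinuousLinearMap.norm_id_le

theorem localOp_update_comp_site (W : ∀ o, H o →L[ℂ] H' o) (o : Option (Fin n))
    (G : H o →L[ℂ] H' o) (k : H o →L[ℂ] H o) :
    localOp P (Function.update W o (G ∘L k)) =
      localOp P (Function.update W o G) ∘L site P o k :=
  localOp_update_comp W o G k

theorem localOp_eq_mul_site (T : ∀ o, H o →L[ℂ] H o) (o : Option (Fin n)) :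
    localOp P T =
      localOp P (Function.update T o (ContinuousLinearMap.id ℂ (H o))) * site P o (T o) := by
  have := localOp_update_comp_site (P := P) T o (ContinuousLinearMap.id ℂ (H o)) (T o)
  rwa [ContinuousLinearMap.id_comp, Function.update_eq_self] at this

theorem commute_localOp_site (T : ∀ o, H o →L[ℂ] H o) (o : Option (Fin n))
    (hT : T o = ContinuousLinearMap.id ℂ (H o)) (a : H o →L[ℂ] H o) :
    Commute (localOp P T) (site P o a) := by
  change localOp P T ∘L localOp P _ = localOp P _ ∘L localOp P T
  rw [← localOp_comp, ← localOp_comp]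
  congr 1
  ext1 o'
  by_cases h : o' = o
  · subst h; simp [hT]
  · simp [Function.update_of_ne h]

theorem commute_site {o o' : Option (Fin n)} (h : o ≠ o') (a : H o →L[ℂ] H o)
    (b : H o' →L[ℂ] H o') : Commute (site P o a) (site P o' b) :=
  commute_localOp_site _ o' (Function.update_of_ne h.symm _ _) b

theorem isSelfAdjoint_localOp {T : ∀ o, H o →L[ℂ] H o} (hT : ∀ o, IsSelfAdjoint (T o)) :
    IsSelfAdjoint (localOp P T) := by
  rw [ContinuousLinearMap.isSelfAdjoint_iff', adjoint_localOp]
  exact congrArg _ (funext fun o => hT o)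

/-- An operator on the system of party `o` is null for `ψ` if each tensor product of operators
that contains it kills `ψ`. -/
def NullFor (ψ : totalSpace H P) (o : Option (Fin n)) (K : H o →L[ℂ] H' o) : Prop :=
  ∀ W : ∀ o, H o →L[ℂ] H' o, localOp P (Function.update W o K) ψ = 0

variable {ψ : totalSpace H P} {o : Option (Fin n)}

theorem NullFor.add {K K' : H o →L[ℂ] H' o} (h : NullFor ψ o K) (h' : NullFor ψ o K') :
    NullFor ψ o (K + K') := fun W => by
  rw [MultilinearMap.map_update_add, add_apply, h, h', add_zero]

theorem NullFor.smul {K : H o →L[ℂ] H' o} (h : NullFor ψ o K) (c : ℂ) :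
    NullFor ψ o (c • K) := fun W => by
  rw [MultilinearMap.map_update_smul, smul_apply, h, smul_zero]

/-- A tensor product with `G ∘L k` in slot `o` factors through `site P o k`, so it is enough that
this one operator kills the state. Relations on the state enter tensor products of local maps
through this lemma. -/
theorem nullFor_comp {k : H o →L[ℂ] H o} (h : site P o k ψ = 0) (G : H o →L[ℂ] H' o) :
    NullFor ψ o (G ∘L k) := fun W => by
  rw [localOp_update_comp_site, ContinuousLinearMap.comp_apply, h, map_zero]

/-- Hybrid argument: the factors are exchanged one party at a time, and each exchange changes the
result by a tensor product that contains a null operator. -/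
theorem localOp_congr {T T' : ∀ o, H o →L[ℂ] H' o} (h : ∀ o, NullFor ψ o (T o - T' o)) :
    localOp P T ψ = localOp P T' ψ := by
  -- The parties in `s` have already been switched from `T` to `T'`.
  have key (s : Finset (Option (Fin n))) : localOp P (s.piecewise T' T) ψ = localOp P T ψ := by
    induction s using Finset.induction_on with
    | empty => simp
    | insert j s hj ih =>
      rw [← ih, Finset.piecewise_insert]
      have h1 := h j (s.piecewise T' T)
      rw [MultilinearMap.map_update_sub, sub_apply, sub_eq_zero] at h1
      rw [← h1]
      congr 2
      rw [← Finset.piecewise_eq_of_notMem s T' T hj, Function.update_eq_self]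
  rw [← key Finset.univ, Finset.piecewise_univ]

/-- Expansion of a tensor product of sums of operators. -/
theorem localOp_sum {b : Type} [Fintype b] (L : ∀ o, b → (H o →L[ℂ] H' o))
    (U : Option (Fin n) → b → ℂ) :
    localOp P (fun o => ∑ σ, U o σ • L o σ) =
      ∑ σ : Option (Fin n) → b, (∏ o, U o (σ o)) • localOp P (fun o => L o (σ o)) := by
  classical
  rw [MultilinearMap.map_sum]
  refine Finset.sum_congr rfl fun σ _ => ?_
  rw [MultilinearMap.map_smul_univ]

end LocalOperators

/-! ### Isometries into a qubit and a remainder -/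

section Isometry

variable {H R : CHilb.{u}}

theorem attachKet_apply (b : Fin 2) (r : R) :
    attachKet R b r = tmulVec (H := qubit) (EuclideanSpace.single b (1 : ℂ)) r := rfl

theorem inner_attachKet (b c : Fin 2) (r r' : R) :
    ⟪attachKet R b r, attachKet R c r'⟫_ℂ = if b = c then ⟪r, r'⟫_ℂ else 0 := by
  rw [attachKet_apply, attachKet_apply, inner_tmulVec]
  by_cases h : b = c
  · subst h; simp
  · have h0 : ⟪(EuclideanSpace.single b (1 : ℂ) : EuclideanSpace ℂ (Fin 2)),
        EuclideanSpace.single c (1 : ℂ)⟫_ℂ = 0 := by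
      simp [EuclideanSpace.inner_single_left, h]
    rw [if_neg h]
    exact mul_eq_zero_of_left h0 _

theorem norm_sq_add_attachKet (r r' : R) :
    ‖attachKet R 0 r + attachKet R 1 r'‖ ^ 2 = ‖r‖ ^ 2 + ‖r'‖ ^ 2 := by
  have h (b : Fin 2) (r : R) : ‖attachKet R b r‖ ^ 2 = ‖r‖ ^ 2 := by
    rw [@norm_sq_eq_re_inner ℂ, inner_attachKet, if_pos rfl, ← @norm_sq_eq_re_inner ℂ]
  rw [@norm_add_sq ℂ, inner_attachKet, h, h]
  simp

/-- The isometry `φ ↦ |0⟩ ⊗ L 0 φ + |1⟩ ⊗ L 1 φ`. -/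
def qubitIsometry (L : Fin 2 → (H →L[ℂ] R)) (hL : ∀ φ, ‖L 0 φ‖ ^ 2 + ‖L 1 φ‖ ^ 2 = ‖φ‖ ^ 2) :
    H →ₗᵢ[ℂ] hilbertTensor qubit R where
  toLinearMap := (∑ b, attachKet R b ∘L L b : H →L[ℂ] hilbertTensor qubit R)
  norm_map' φ := by
    rw [← sq_eq_sq₀ (norm_nonneg _) (norm_nonneg _), ← hL, ← norm_sq_add_attachKet]
    simp [Fin.sum_univ_two]

theorem qubitIsometry_toContinuousLinearMap (L : Fin 2 → (H →L[ℂ] R))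
    (hL : ∀ φ, ‖L 0 φ‖ ^ 2 + ‖L 1 φ‖ ^ 2 = ‖φ‖ ^ 2) :
    (qubitIsometry L hL).toContinuousLinearMap = ∑ b, attachKet R b ∘L L b := by
  ext φ; rfl

end Isometry

/-! ### Positions of the parties -/

section Slots

/-- The position of a party: the honest parties come first, the group `none` last. -/
def slotFun (n : ℕ) : Option (Fin n) → Fin (n + 1)
  | none => Fin.last n
  | some i => i.castSucc

/-- The position of a party, as an equivalence. -/
def slot (n : ℕ) : Option (Fin n) ≃ Fin (n + 1) where
  toFun := slotFun n
  invFun := finSuccEquivLast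
  left_inv o := by cases o <;> simp [slotFun]
  right_inv j := by
    refine Fin.lastCases ?_ (fun i => ?_) j <;> simp [slotFun]

@[simp] theorem slot_none (n : ℕ) : slot n none = Fin.last n := rfl

@[simp] theorem slot_some {n : ℕ} (i : Fin n) : slot n (some i) = i.castSucc := rfl

theorem sum_slot {n : ℕ} {E : Type*} [AddCommMonoid E] (f : (Option (Fin n) → Fin 2) → E) :
    ∑ σ, f σ = ∑ τ : Fin (n + 1) → Fin 2, f (fun o => τ (slot n o)) :=
  (Equiv.sum_comp ((slot n).symm.arrowCongr (Equiv.refl (Fin 2))) f).symm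

end Slots

/-! ### Self-tests in terms of local maps, and changes of local bases -/

namespace Strategy

variable {n m : ℕ} (S : Strategy.{u} n m)

/-- The systems of the honest parties and, at `none`, of the group. -/
@[reducible] def space : Option (Fin n) → CHilb.{u}
  | none => S.groupSpace
  | some i => S.honestSpace i

/-- The state, as a vector of the total space of the family `S.space`. -/
abbrev vec : totalSpace S.space S.purifier := S.state

/-- The observables of the honest parties and of the group for given inputs. -/
def obs (x : Fin n → Fin 2) (y : Fin m → Fin 2) : ∀ o, S.space o →L[ℂ] S.space o
  | none => S.groupObs y
  | some i => S.honestObs i (x i)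

theorem jointOp_obs (x : Fin n → Fin 2) (y : Fin m → Fin 2) :
    S.jointOp (fun i => S.honestObs i (x i)) (S.groupObs y) =
      localOp S.purifier (S.obs x y) := rfl

/-- The target matrices of the parties for given inputs. -/
def target (A : Fin n → Fin 2 → Matrix (Fin 2) (Fin 2) ℂ)
    (B : (Fin m → Fin 2) → Matrix (Fin 2) (Fin 2) ℂ) (x : Fin n → Fin 2) (y : Fin m → Fin 2) :
    Option (Fin n) → Matrix (Fin 2) (Fin 2) ℂ
  | none => B y
  | some i => A i (x i)

/-- The local maps `L o b = (⟨b| ⊗ 1) Λ_o` of a family of isometries `Λ_o` under which the state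
becomes `Φ ⊗ ζ`, and the observables act on the state like the given matrices. -/
def HasLocalSelfTest (Φ : QubitVec (n + 1)) (A : Fin n → Fin 2 → Matrix (Fin 2) (Fin 2) ℂ)
    (B : (Fin m → Fin 2) → Matrix (Fin 2) (Fin 2) ℂ) : Prop :=
  ∃ (R : Option (Fin n) → CHilb.{u}) (L : ∀ o, Fin 2 → (S.space o →L[ℂ] R o))
    (ζ : totalSpace R S.purifier),
    (∀ o φ, ‖L o 0 φ‖ ^ 2 + ‖L o 1 φ‖ ^ 2 = ‖φ‖ ^ 2) ∧
    (∀ τ, localOp S.purifier (fun o => L o (τ (slot n o))) S.vec = Φ τ • ζ) ∧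
    ∀ x y o b, NullFor S.vec o (L o b ∘L S.obs x y o - ∑ c, target A B x y o b c • L o c)

variable {S} {Φ : QubitVec (n + 1)} {A : Fin n → Fin 2 → Matrix (Fin 2) (Fin 2) ℂ}
  {B : (Fin m → Fin 2) → Matrix (Fin 2) (Fin 2) ℂ}

theorem applyLocal_target (x : Fin n → Fin 2) (y : Fin m → Fin 2) (τ : Fin (n + 1) → Fin 2) :
    applyLocal (Fin.snoc (fun i => A i (x i)) (B y)) Φ τ =
      ∑ σ : Fin (n + 1) → Fin 2,
        (∏ o, target A B x y o (τ (slot n o)) (σ (slot n o))) * Φ σ := by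
  refine Finset.sum_congr rfl fun σ _ => ?_
  rw [Fin.prod_univ_castSucc, Fintype.prod_option, mul_comm (∏ _, _)]
  simp [target]

/-- The product isometry expands as the sum over τ of |τ⟩ ⊗ (the tensor product of the maps `L o (τ
o)`). Both required identities can thus be checked amplitude by amplitude. -/
theorem HasLocalSelfTest.exists_isometries (h : S.HasLocalSelfTest Φ A B) :
    ∃ (R : Fin n → CHilb.{u}) (RD : CHilb.{u})
      (Λ : ∀ i, S.honestSpace i →ₗᵢ[ℂ] hilbertTensor qubit (R i))
      (ΛD : S.groupSpace →ₗᵢ[ℂ] hilbertTensor qubit RD)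
      (ζ : multiTensor n R (hilbertTensor RD S.purifier)),
      let V := multiOp n (fun i => (Λ i).toContinuousLinearMap)
        (opTensor ΛD.toContinuousLinearMap (ContinuousLinearMap.id ℂ S.purifier))
      V S.state = withQubits Φ ζ ∧
      ∀ (x : Fin n → Fin 2) (y : Fin m → Fin 2),
        V (S.jointOp (fun i => S.honestObs i (x i)) (S.groupObs y) S.state) =
          withQubits (applyLocal (Fin.snoc (fun i => A i (x i)) (B y)) Φ) ζ := by
  obtain ⟨R, L, ζ, hL, hstate, hobs⟩ := h
  refine ⟨fun i => R (some i), R none, fun i => qubitIsometry (L (some i)) (hL (some i)),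
    qubitIsometry (L none) (hL none), ζ, ?_⟩
  intro V
  -- The coefficient 1 brings each isometry into the form that `localOp_sum` expands.
  have hV : V = localOp S.purifier (H := S.space) (H' := fun o => hilbertTensor qubit (R o))
      (fun o => ∑ b, (1 : ℂ) • (attachKet (R o) b ∘L L o b)) := by
    simp only [one_smul, ← qubitIsometry_toContinuousLinearMap _ (hL _)]
    rfl
  have hVφ (φ : totalSpace S.space S.purifier) (Φ' : QubitVec (n + 1))
      (hφ : ∀ τ, localOp S.purifier (fun o => L o (τ (slot n o))) φ = Φ' τ • ζ) :
      V φ = withQubits Φ' ζ := by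
    rw [hV, localOp_sum (fun o b => attachKet (R o) b ∘L L o b), sum_slot, sum_apply, withQubits]
    refine Finset.sum_congr rfl fun τ _ => ?_
    rw [Finset.prod_const_one, one_smul, localOp_comp, ContinuousLinearMap.comp_apply, hφ,
      map_smul]
    rfl
  refine ⟨hVφ _ _ hstate, fun x y => hVφ _ _ fun τ => ?_⟩
  -- Modulo null operators, each observable is moved through its local map and becomes the target
  -- matrix on the bit. Expanding the product leaves only amplitudes of the state itself.
  rw [jointOp_obs, ← ContinuousLinearMap.comp_apply, ← localOp_comp,
    localOp_congr (T' := fun o => ∑ c, target A B x y o (τ (slot n o)) c • L o c)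
      (fun o => hobs x y o _),
    localOp_sum, sum_slot, sum_apply, applyLocal_target, Finset.sum_smul]
  refine Finset.sum_congr rfl fun σ _ => ?_
  rw [smul_apply, hstate, smul_smul]

theorem sum_norm_sq_unitary {E : Type*} [NormedAddCommGroup E] [InnerProductSpace ℂ E]
    {U : Matrix (Fin 2) (Fin 2) ℂ} (hU : U.conjTranspose * U = 1) (v : Fin 2 → E) :
    ‖∑ c, U 0 c • v c‖ ^ 2 + ‖∑ c, U 1 c • v c‖ ^ 2 = ‖v 0‖ ^ 2 + ‖v 1‖ ^ 2 := by
  have h (i j) := congrFun (congrFun hU i) j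
  have h00 := h 0 0
  have h01 := h 0 1
  have h10 := h 1 0
  have h11 := h 1 1
  simp only [Matrix.mul_apply, Matrix.conjTranspose_apply, Fin.sum_univ_two, RCLike.star_def,
    Matrix.one_apply_eq, ne_eq, zero_ne_one, one_ne_zero, not_false_eq_true,
    Matrix.one_apply_ne] at h00 h01 h10 h11
  have key : ((‖∑ c, U 0 c • v c‖ ^ 2 + ‖∑ c, U 1 c • v c‖ ^ 2 : ℝ) : ℂ) =
      ((‖v 0‖ ^ 2 + ‖v 1‖ ^ 2 : ℝ) : ℂ) := by
    push_cast
    have hn (w : E) : (‖w‖ : ℂ) ^ 2 = ⟪w, w⟫_ℂ := (inner_self_eq_norm_sq_to_K (𝕜 := ℂ) w).symm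
    simp only [hn, Fin.sum_univ_two, inner_add_left, inner_add_right, inner_smul_left,
      inner_smul_right]
    linear_combination ⟪v 0, v 0⟫_ℂ * h00 + ⟪v 0, v 1⟫_ℂ * h01 + ⟪v 1, v 0⟫_ℂ * h10 +
      ⟪v 1, v 1⟫_ℂ * h11
  exact_mod_cast key

/-- A change of the local bases of the qubits. -/
theorem HasLocalSelfTest.rotate (h : S.HasLocalSelfTest Φ A B)
    (U : Option (Fin n) → Matrix (Fin 2) (Fin 2) ℂ) (hU : ∀ o, (U o).conjTranspose * U o = 1)
    {Φ' : QubitVec (n + 1)} {A' : Fin n → Fin 2 → Matrix (Fin 2) (Fin 2) ℂ}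
    {B' : (Fin m → Fin 2) → Matrix (Fin 2) (Fin 2) ℂ}
    (hΦ : ∀ τ, Φ' τ = ∑ σ : Fin (n + 1) → Fin 2,
      (∏ o, U o (τ (slot n o)) (σ (slot n o))) * Φ σ)
    (hA : ∀ i x, A' i x * U (some i) = U (some i) * A i x)
    (hB : ∀ y, B' y * U none = U none * B y) : S.HasLocalSelfTest Φ' A' B' := by
  obtain ⟨R, L, ζ, hL, hstate, hobs⟩ := h
  refine ⟨R, fun o b => ∑ c, U o b c • L o c, ζ, fun o φ => ?_, fun τ => ?_, fun x y o b => ?_⟩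
  · have := sum_norm_sq_unitary (hU o) (fun c => L o c φ)
    rw [hL] at this
    simpa using this
  · rw [localOp_sum, sum_slot, sum_apply, hΦ, Finset.sum_smul]
    refine Finset.sum_congr rfl fun σ _ => ?_
    rw [smul_apply, hstate, smul_smul]
  · have hC : target A' B' x y o * U o = U o * target A B x y o := by
      cases o with
      | none => exact hB y
      | some i => exact hA i (x i)
    -- Because the new matrices are intertwined with the old ones by `U`, the new error terms are
    -- combinations of the old ones, which are null.
    have h1 : (∑ c, U o b c • L o c) ∘L S.obs x y o -
        ∑ d, target A' B' x y o b d • ∑ c, U o d c • L o c =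
        U o b 0 • (L o 0 ∘L S.obs x y o - ∑ c, target A B x y o 0 c • L o c) +
        U o b 1 • (L o 1 ∘L S.obs x y o - ∑ c, target A B x y o 1 c • L o c) := by
      have h2 (c) := congrFun (congrFun hC b) c
      have h20 := h2 0
      have h21 := h2 1
      simp only [Matrix.mul_apply, Fin.sum_univ_two] at h20 h21
      simp only [Fin.sum_univ_two, ContinuousLinearMap.add_comp, ContinuousLinearMap.smul_comp]
      linear_combination (norm := module) (-h20) • L o 0 - h21 • L o 1
    rw [h1]
    exact ((hobs x y o 0).smul _).add ((hobs x y o 1).smul _)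

end Strategy

/-! ### Swap maps for operators that anticommute on the state -/

section PairSpace

/-- The Hilbert space `H ⊕ H`. -/
def pairSpace (H : CHilb.{u}) : CHilb.{u} := ⟨WithLp 2 (H × H)⟩

variable {H : CHilb.{u}}

/-- The operator `φ ↦ (k φ, k' φ)`. -/
def pairMap (k k' : H →L[ℂ] H) : H →L[ℂ] pairSpace H :=
  (WithLp.prodContinuousLinearEquiv 2 ℂ H H).symm.toContinuousLinearMap ∘L (k.prod k')

theorem norm_pairMap_sq (k k' : H →L[ℂ] H) (φ : H) :
    ‖pairMap k k' φ‖ ^ 2 = ‖k φ‖ ^ 2 + ‖k' φ‖ ^ 2 :=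
  WithLp.prod_norm_sq_eq_of_L2 (pairMap k k' φ : WithLp 2 (H × H))

theorem pairMap_comp (k k' l : H →L[ℂ] H) : pairMap k k' ∘L l = pairMap (k * l) (k' * l) := rfl

theorem pairMap_sub (k k' l l' : H →L[ℂ] H) :
    pairMap k k' - pairMap l l' = pairMap (k - l) (k' - l') := rfl

theorem smul_pairMap (c : ℂ) (k k' : H →L[ℂ] H) :
    c • pairMap k k' = pairMap (c • k) (c • k') := rfl

theorem pairMap_eq (k k' : H →L[ℂ] H) :
    pairMap k k' = pairMap 1 0 ∘L k + pairMap 0 1 ∘L k' := by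
  rw [pairMap_comp, pairMap_comp, one_mul, one_mul, zero_mul, zero_mul]
  change _ = pairMap (k + 0) (0 + k')
  rw [add_zero, zero_add]

end PairSpace

section Swap

/-- The map φ ↦ (Pφ, Qφ) is a contraction, and the positive square root of its defect 1 − P*P − Q*Q
is the third component that makes it isometric. -/
theorem exists_sqrt_defect {H : CHilb.{u}} (P Q : H →L[ℂ] H)
    (h : ∀ φ, ‖P φ‖ ^ 2 + ‖Q φ‖ ^ 2 ≤ ‖φ‖ ^ 2) :
    ∃ D : H →L[ℂ] H, star D = D ∧ D * D = 1 - star P * P - star Q * Q ∧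
      ∀ φ, ‖P φ‖ ^ 2 + ‖Q φ‖ ^ 2 + ‖D φ‖ ^ 2 = ‖φ‖ ^ 2 := by
  have hin (T : H →L[ℂ] H) (φ : H) : ⟪(star T * T) φ, φ⟫_ℂ = (‖T φ‖ : ℂ) ^ 2 := by
    change ⟪ContinuousLinearMap.adjoint T (T φ), φ⟫_ℂ = _
    rw [ContinuousLinearMap.adjoint_inner_left, inner_self_eq_norm_sq_to_K]
    rfl
  have hX (φ : H) : ⟪(1 - star P * P - star Q * Q) φ, φ⟫_ℂ =
      ((‖φ‖ ^ 2 - ‖P φ‖ ^ 2 - ‖Q φ‖ ^ 2 : ℝ) : ℂ) := by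
    have h1 : ⟪(1 : H →L[ℂ] H) φ, φ⟫_ℂ = (‖φ‖ : ℂ) ^ 2 := inner_self_eq_norm_sq_to_K φ
    rw [sub_apply, sub_apply, inner_sub_left, inner_sub_left, hin, hin, h1]
    push_cast
    rfl
  have hpos : 0 ≤ 1 - star P * P - star Q * Q := by
    rw [ContinuousLinearMap.nonneg_iff_isPositive, ContinuousLinearMap.isPositive_iff_complex]
    intro φ
    rw [hX]
    refine ⟨rfl, ?_⟩
    have := h φ
    simp only [RCLike.re_to_complex, Complex.ofReal_re]
    linarith
  refine ⟨CFC.sqrt (1 - star P * P - star Q * Q), (CFC.sqrt_nonneg _).isSelfAdjoint,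
    CFC.sqrt_mul_sqrt_self _ hpos, fun φ => ?_⟩
  have h1 := hin (CFC.sqrt (1 - star P * P - star Q * Q)) φ
  rw [(CFC.sqrt_nonneg _).isSelfAdjoint, CFC.sqrt_mul_sqrt_self _ hpos, hX] at h1
  have h2 : ‖φ‖ ^ 2 - ‖P φ‖ ^ 2 - ‖Q φ‖ ^ 2 =
      ‖CFC.sqrt (1 - star P * P - star Q * Q) φ‖ ^ 2 := by exact_mod_cast h1
  rw [← h2]
  ring

variable {n : ℕ} {H : Option (Fin n) → CHilb.{u}} {P : CHilb.{u}}
variable {ψ : totalSpace H P} {o : Option (Fin n)}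

theorem nullFor_pairMap {k k' : H o →L[ℂ] H o} (h : site P o k ψ = 0) (h' : site P o k' ψ = 0) :
    NullFor (H' := fun o => pairSpace (H o)) ψ o (pairMap k k') := by
  rw [pairMap_eq]
  exact (nullFor_comp (H' := fun o => pairSpace (H o)) h _).add
    (nullFor_comp (H' := fun o => pairSpace (H o)) h' _)

/-- Self-adjointness gives ‖kψ‖² = ⟨ψ, k²ψ⟩. -/
theorem site_eq_zero_of_mul_self {k : H o →L[ℂ] H o} (hk : star k = k)
    (h : site P o (k * k) ψ = 0) : site P o k ψ = 0 := by
  have h1 : ContinuousLinearMap.adjoint (site P o k) = site P o k := by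
    have := map_star (site P o) k
    rw [hk] at this
    exact this.symm
  rw [← @inner_self_eq_zero ℂ]
  nth_rw 1 [← h1]
  rw [map_mul] at h
  rw [ContinuousLinearMap.adjoint_inner_left]
  exact (congrArg (inner ℂ ψ) h).trans (inner_zero_right ψ)

/-- This is the swap isometry of self-testing, built from contractions instead of unitaries. In the
resulting basis `a` and `b` act on the state like σ_x and σ_y, rotated about the z-axis by the phase
`e`. The last hypothesis on `a` and `b` (`hN`) allows relations known on ψ to be used on aψ and bψ
too. -/
theorem exists_swapMaps {a b : H o →L[ℂ] H o} (ha : star a = a) (ha1 : ‖a‖ ≤ 1) (hb : star b = b)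
    (hb1 : ‖b‖ ≤ 1) (haa : site P o (a * a) ψ = ψ) (hbb : site P o (b * b) ψ = ψ)
    (hab : site P o (a * b + b * a) ψ = 0)
    (hN : ∀ k, site P o k ψ = 0 → site P o (k * a) ψ = 0 ∧ site P o (k * b) ψ = 0)
    {e : ℂ} (he : star e * e = 1) :
    ∃ L : Fin 2 → (H o →L[ℂ] pairSpace (H o)),
      (∀ φ, ‖L 0 φ‖ ^ 2 + ‖L 1 φ‖ ^ 2 = ‖φ‖ ^ 2) ∧
      NullFor (H' := fun o => pairSpace (H o)) ψ o (L 0 ∘L a - star e • L 1) ∧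
      NullFor (H' := fun o => pairSpace (H o)) ψ o (L 1 ∘L a - e • L 0) ∧
      NullFor (H' := fun o => pairSpace (H o)) ψ o (L 0 ∘L b - (-Complex.I * star e) • L 1) ∧
      NullFor (H' := fun o => pairSpace (H o)) ψ o (L 1 ∘L b - (Complex.I * e) • L 0) := by
  -- With exact relations, `p` projects onto the eigenspace of `a` for 1, and `q` carries the
  -- eigenspace for −1 there by means of `b`.
  set p : H o →L[ℂ] H o := (1 / 2 : ℂ) • (1 + a) with hp
  set q : H o →L[ℂ] H o := (1 / 2 : ℂ) • (b * (1 - a)) with hq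
  have hle (T : H o →L[ℂ] H o) (hT : ‖T‖ ≤ 1) (φ) : ‖T φ‖ ≤ ‖φ‖ := by
    simpa using T.le_of_opNorm_le hT φ
  -- This is the parallelogram law for φ and aφ, as ‖b‖ ≤ 1 and ‖aφ‖ ≤ ‖φ‖.
  have hpq (φ) : ‖p φ‖ ^ 2 + ‖q φ‖ ^ 2 ≤ ‖φ‖ ^ 2 := by
    have h1 : ‖p φ‖ = ‖φ + a φ‖ / 2 := by
      have h3 : p φ = (1 / 2 : ℂ) • (φ + a φ) := rfl
      rw [h3, norm_smul]
      norm_num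
      ring
    have h2 : ‖q φ‖ ≤ ‖φ - a φ‖ / 2 := by
      have := hle b hb1 (φ - a φ)
      have h3 : q φ = (1 / 2 : ℂ) • b (φ - a φ) := rfl
      rw [h3, norm_smul]
      calc ‖(1 / 2 : ℂ)‖ * ‖b (φ - a φ)‖ ≤ ‖(1 / 2 : ℂ)‖ * ‖φ - a φ‖ := by gcongr
        _ = _ := by norm_num; ring
    have h3 := parallelogram_law_with_norm ℂ φ (a φ)
    have h4 := hle a ha1 φ
    have h5 := norm_nonneg (q φ)
    have h6 := norm_nonneg (a φ)
    rw [h1]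
    nlinarith [norm_nonneg φ, norm_nonneg (φ - a φ)]
  obtain ⟨D, hD, hDD, hnorm⟩ := exists_sqrt_defect p q hpq
  have happ (k l : H o →L[ℂ] H o) (φ) : site P o (k * l) φ = site P o k (site P o l φ) := by
    rw [map_mul]; rfl
  have hone (φ : totalSpace H P) : site P o 1 φ = φ := by rw [map_one]; rfl
  rw [happ] at haa hbb
  rw [map_add, add_apply, happ, happ] at hab
  -- The relation b² = 1 is known on ψ only; `hN` applied to b² − 1 extends it to aψ.
  have hbba : site P o b (site P o b (site P o a ψ)) = site P o a ψ := by
    have := (hN (b * b - 1) (by rw [map_sub, sub_apply, happ, hbb, hone, sub_self])).1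
    rw [happ, map_sub, sub_apply, happ, hone, sub_eq_zero] at this
    exact this
  have hba : site P o b (site P o a ψ) = - site P o a (site P o b ψ) :=
    eq_neg_of_add_eq_zero_right hab
  have hbab : site P o b (site P o a (site P o b ψ)) = - site P o a ψ := by
    have := congrArg (site P o b) hba
    rw [hbba, map_neg] at this
    rw [this, neg_neg]
  -- On ψ the relations give p*p + q*q = 1, so D² kills ψ, hence so does D. The defect is thus
  -- invisible on the state.
  have hDψ : site P o D ψ = 0 := by
    refine site_eq_zero_of_mul_self hD ?_
    have hp' : star p = p := by simp [hp, ha]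
    have hq' : star q = (1 / 2 : ℂ) • ((1 - a) * b) := by simp [hq, ha, hb]
    rw [hDD, hp', hq', hp, hq]
    simp only [map_sub, map_add, map_smul, happ, hone, sub_apply, add_apply, smul_apply,
      smul_mul_assoc, mul_smul_comm, haa, hbb, hbba]
    module
  obtain ⟨hDa, hDb⟩ := hN D hDψ
  rw [happ] at hDa hDb
  set r : ℂ := ((1 / √2 : ℝ) : ℂ) with hr
  have hrn : ‖r‖ ^ 2 = 1 / 2 := by
    rw [hr, Complex.norm_real, Real.norm_eq_abs, sq_abs, div_pow, Real.sq_sqrt (by norm_num)]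
    norm_num
  have hen : ‖e‖ = 1 := by
    have h := congrArg norm he
    rw [norm_mul, norm_star, norm_one] at h
    nlinarith [norm_nonneg e]
  have hee : star e * (e * r) = r := by rw [← mul_assoc, he, one_mul]
  have hee' : -Complex.I * star e * (e * r) = -Complex.I * r := by rw [mul_assoc, hee]
  -- In the components p, q the operators a, b act like σ_z, σ_x; the combinations p ∓ iq turn these
  -- into σ_x, σ_y. The defect is shared equally between the two maps, so that the squared norms add
  -- up to ‖φ‖².
  refine ⟨![pairMap (r • (p - Complex.I • q)) (r • D),
    e • pairMap (r • (p + Complex.I • q)) (r • D)], fun φ => ?_, ?_, ?_, ?_, ?_⟩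
  · rw [← hnorm φ]
    have h3 := parallelogram_law_with_norm ℂ (p φ) (Complex.I • q φ)
    have hI : ‖Complex.I • q φ‖ = ‖q φ‖ := by simp [norm_smul]
    simp only [Matrix.cons_val_zero, Matrix.cons_val_one, smul_apply, norm_smul, hen, one_mul,
      norm_pairMap_sq, mul_pow, hrn, sub_apply, add_apply]
    rw [hI] at h3
    linarith
  all_goals
    simp only [Matrix.cons_val_zero, Matrix.cons_val_one, smul_pairMap, pairMap_comp,
      pairMap_sub, smul_smul]
    refine nullFor_pairMap ?_ ?_
    all_goals
      simp only [hp, hq, map_sub, map_add, map_smul, happ, hone, sub_apply, add_apply,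
        smul_apply, hDψ, hDa, hDb, smul_zero, sub_zero, haa, hbb, hba, hbab, hee, hee']
  all_goals
    match_scalars <;> ring_nf <;> simp only [Complex.I_sq] <;> ring
end Swap

/-! ### Self-adjoint contractions and parity observables -/

section Contractions

variable {E : Type*} [NormedAddCommGroup E] [InnerProductSpace ℂ E] [CompleteSpace E]

/-- As T = 1 − S commutes with S, the product ST is positive, and 1 − (S − T)² = 4ST. -/
theorem norm_sub_le_one_of_add_eq_one {S T : E →L[ℂ] E} (hS : 0 ≤ S) (hT : 0 ≤ T)
    (h : S + T = 1) : ‖S - T‖ ≤ 1 := by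
  have hT' : T = 1 - S := eq_sub_of_add_eq' h
  have hc : Commute S T := by rw [hT']; exact (Commute.one_right S).sub_right (Commute.refl S)
  have hST : 0 ≤ S * T := hc.mul_nonneg hS hT
  have hsa : IsSelfAdjoint (S - T) := hS.isSelfAdjoint.sub hT.isSelfAdjoint
  have hsq : (S - T) * (S - T) ≤ 1 := by
    have : 1 - (S - T) * (S - T) = (4 : ℝ) • (S * T) := by
      rw [hT']
      noncomm_ring
      module
    rw [← sub_nonneg, this]
    exact smul_nonneg (by norm_num) hST
  have h1 : ‖S - T‖ * ‖S - T‖ ≤ 1 := by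
    rw [← CStarRing.norm_star_mul_self, hsa.star_eq]
    refine CStarAlgebra.norm_le_one_iff_of_nonneg _ ?_ |>.2 hsq
    nth_rw 1 [← hsa.star_eq]
    exact star_mul_self_nonneg _
  nlinarith [norm_nonneg (S - T)]

/-- Expanding gives ‖T²φ − φ‖² = ‖T²φ‖² − 2‖Tφ‖² + ‖φ‖² ≤ ‖φ‖² − ‖Tφ‖² ≤ 0. Saturated norms thus
replace projectivity of the measurements. -/
theorem apply_apply_of_norm_eq {T : E →L[ℂ] E} (hT : IsSelfAdjoint T) (hT1 : ‖T‖ ≤ 1) {φ : E}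
    (h : ‖φ‖ ≤ ‖T φ‖) : T (T φ) = φ := by
  have hle (x : E) : ‖T x‖ ≤ ‖x‖ := by simpa using T.le_of_opNorm_le hT1 x
  rw [← sub_eq_zero, ← norm_eq_zero, ← sq_eq_zero_iff]
  have h1 := norm_sub_sq (𝕜 := ℂ) (T (T φ)) φ
  have h2 : ⟪T (T φ), φ⟫_ℂ = ⟪T φ, T φ⟫_ℂ := by
    rw [← ContinuousLinearMap.adjoint_inner_right, hT.adjoint_eq]
  rw [h2, ← norm_sq_eq_re_inner] at h1
  nlinarith [hle (T φ), hle φ, norm_nonneg (T φ), norm_nonneg (T (T φ)), norm_nonneg φ,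
    sq_nonneg ‖T (T φ) - φ‖]

end Contractions

namespace POVM

variable {H : CHilb.{u}} {O : Type} [Fintype O] (M : POVM H O)

theorem isSelfAdjoint_effect (o : O) : IsSelfAdjoint (M.effect o) := (M.effect_pos o).isSelfAdjoint

theorem isSelfAdjoint_sum_sign (k : O → ℕ) :
    IsSelfAdjoint (∑ o, (-1 : ℂ) ^ k o • M.effect o) := by
  refine isSelfAdjoint_sum _ fun o _ => IsSelfAdjoint.smul ?_ (M.isSelfAdjoint_effect o)
  exact IsSelfAdjoint.pow (by simp [isSelfAdjoint_iff]) _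

/-- Collecting the outcomes by parity leaves a difference of two positive operators with sum 1. -/
theorem norm_sum_sign_le_one (k : O → ℕ) : ‖∑ o, (-1 : ℂ) ^ k o • M.effect o‖ ≤ 1 := by
  classical
  have hsplit (f : O → H →L[ℂ] H) : ∑ o, f o =
      ∑ o with Even (k o), f o + ∑ o with ¬ Even (k o), f o :=
    (Finset.sum_filter_add_sum_filter_not _ _ _).symm
  have h : ∑ o, (-1 : ℂ) ^ k o • M.effect o =
      ∑ o with Even (k o), M.effect o - ∑ o with ¬ Even (k o), M.effect o := by
    rw [hsplit, sub_eq_add_neg, ← Finset.sum_neg_distrib]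
    congr 1
    · refine Finset.sum_congr rfl fun o ho => ?_
      rw [(Finset.mem_filter.1 ho).2.neg_one_pow, one_smul]
    · refine Finset.sum_congr rfl fun o ho => ?_
      rw [(Nat.not_even_iff_odd.1 (Finset.mem_filter.1 ho).2).neg_one_pow, neg_one_smul]
  have hpos (o : O) : 0 ≤ M.effect o :=
    (ContinuousLinearMap.nonneg_iff_isPositive _).2 (M.effect_pos o)
  rw [h]
  refine norm_sub_le_one_of_add_eq_one (Finset.sum_nonneg fun o _ => hpos o)
    (Finset.sum_nonneg fun o _ => hpos o) ?_
  rw [← hsplit, M.sum_effect]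

end POVM

/-! ### The sum of squares behind the bound -/

section SumOfSquares

variable {E : Type*} [NormedAddCommGroup E] [InnerProductSpace ℂ E] {ι : Type*} [Fintype ι]

/-- The orthogonality of `g` and `g'` removes the only term that the bound could not control, the
one in Re⟨u₀, u₁⟩. -/
theorem sum_norm_sub_sq {u₀ u₁ : E} {v : ι → E} {g g' : ι → ℝ} (hg : ∀ r, g r ^ 2 = 1)
    (hg' : ∀ r, g' r ^ 2 = 1) (hgg : ∑ r, g r * g' r = 0) :
    ∑ r, ‖v r - ((1 / √2 : ℝ) : ℂ) • ((g r : ℂ) • u₀ + (g' r : ℂ) • u₁)‖ ^ 2 =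
      ∑ r, ‖v r‖ ^ 2 + Fintype.card ι * (‖u₀‖ ^ 2 + ‖u₁‖ ^ 2) / 2 -
        √2 * ∑ r, (⟪v r, (g r : ℂ) • u₀ + (g' r : ℂ) • u₁⟫_ℂ).re := by
  have h2 : √2 * √2 = 2 := Real.mul_self_sqrt (by norm_num)
  have h2' : √2 ≠ 0 := by positivity
  have h (r) : ‖v r - ((1 / √2 : ℝ) : ℂ) • ((g r : ℂ) • u₀ + (g' r : ℂ) • u₁)‖ ^ 2 =
      ‖v r‖ ^ 2 + (‖u₀‖ ^ 2 + ‖u₁‖ ^ 2) / 2 + (g r * g' r) * (⟪u₀, u₁⟫_ℂ).re -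
        √2 * (⟪v r, (g r : ℂ) • u₀ + (g' r : ℂ) • u₁⟫_ℂ).re := by
    have hv : ‖(g r : ℂ) • u₀ + (g' r : ℂ) • u₁‖ ^ 2 =
        ‖u₀‖ ^ 2 + ‖u₁‖ ^ 2 + 2 * (g r * g' r) * (⟪u₀, u₁⟫_ℂ).re := by
      rw [norm_add_sq (𝕜 := ℂ), norm_smul, norm_smul, mul_pow, mul_pow, Complex.norm_real,
        Complex.norm_real, Real.norm_eq_abs, Real.norm_eq_abs, sq_abs, sq_abs, hg, hg',
        inner_smul_left, inner_smul_right, Complex.conj_ofReal, ← mul_assoc, ← Complex.ofReal_mul]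
      simp only [RCLike.re_to_complex, Complex.re_ofReal_mul]
      ring
    rw [norm_sub_sq (𝕜 := ℂ), norm_smul, mul_pow, hv, inner_smul_right, Complex.norm_real,
      Real.norm_eq_abs, sq_abs]
    simp only [RCLike.re_to_complex, Complex.re_ofReal_mul]
    have h3 : 1 / √2 = √2 / 2 := by field_simp; linarith
    rw [h3]
    linear_combination (1 / 4) * (‖u₀‖ ^ 2 + ‖u₁‖ ^ 2 +
      2 * (g r * g' r) * (⟪u₀, u₁⟫_ℂ).re) * h2
  simp only [h, Finset.sum_sub_distrib, Finset.sum_add_distrib, ← Finset.sum_mul, ← Finset.mul_sum,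
    hgg, Finset.sum_const, Finset.card_univ, nsmul_eq_mul]
  ring

variable {u₀ u₁ : E} {v : ι → E} {g g' : ι → ℝ}

/-- Equality is rigid: √2 times the slack in the bound dominates the sum of squares and the total
norm defect of the vectors `v r`, so both vanish term by term. -/
theorem sum_re_inner_le (hu₀ : ‖u₀‖ ≤ 1) (hu₁ : ‖u₁‖ ≤ 1) (hv : ∀ r, ‖v r‖ ≤ 1)
    (hg : ∀ r, g r ^ 2 = 1) (hg' : ∀ r, g' r ^ 2 = 1) (hgg : ∑ r, g r * g' r = 0) :
    ∑ r, (⟪v r, (g r : ℂ) • u₀ + (g' r : ℂ) • u₁⟫_ℂ).re ≤ Fintype.card ι * √2 ∧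
    (∑ r, (⟪v r, (g r : ℂ) • u₀ + (g' r : ℂ) • u₁⟫_ℂ).re = Fintype.card ι * √2 →
      ∀ r, v r = ((1 / √2 : ℝ) : ℂ) • ((g r : ℂ) • u₀ + (g' r : ℂ) • u₁) ∧ ‖v r‖ = 1) := by
  have h2 : √2 * √2 = 2 := Real.mul_self_sqrt (by norm_num)
  have h2' : 0 < √2 := by positivity
  have h := sum_norm_sub_sq (u₀ := u₀) (u₁ := u₁) (v := v) hg hg' hgg
  have hcard : (0 : ℝ) ≤ Fintype.card ι := by positivity
  have hu : (Fintype.card ι : ℝ) * (‖u₀‖ ^ 2 + ‖u₁‖ ^ 2) / 2 ≤ Fintype.card ι := by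
    have : ‖u₀‖ ^ 2 + ‖u₁‖ ^ 2 ≤ 2 := by nlinarith [norm_nonneg u₀, norm_nonneg u₁]
    nlinarith
  have hvsq (r) : ‖v r‖ ^ 2 ≤ 1 := pow_le_one₀ (norm_nonneg _) (hv r)
  have hvs : ∑ r, (1 - ‖v r‖ ^ 2) = Fintype.card ι - ∑ r, ‖v r‖ ^ 2 := by
    simp [Finset.sum_sub_distrib]
  have hvs0 : 0 ≤ ∑ r, (1 - ‖v r‖ ^ 2) := Finset.sum_nonneg fun r _ => sub_nonneg.2 (hvsq r)
  have h0 : 0 ≤ ∑ r, ‖v r - ((1 / √2 : ℝ) : ℂ) • ((g r : ℂ) • u₀ + (g' r : ℂ) • u₁)‖ ^ 2 :=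
    Finset.sum_nonneg fun r _ => sq_nonneg _
  set X := ∑ r, (⟪v r, (g r : ℂ) • u₀ + (g' r : ℂ) • u₁⟫_ℂ).re
  refine ⟨?_, fun hX r => ?_⟩
  · nlinarith
  · have h3 : √2 * X = 2 * Fintype.card ι := by rw [hX]; linear_combination Fintype.card ι * h2
    have h4 : ∑ r, ‖v r - ((1 / √2 : ℝ) : ℂ) • ((g r : ℂ) • u₀ + (g' r : ℂ) • u₁)‖ ^ 2 = 0 := by
      linarith
    have h5 : ∑ r, (1 - ‖v r‖ ^ 2) = 0 := by linarith
    have h6 := (Finset.sum_eq_zero_iff_of_nonneg fun r _ => sq_nonneg _).1 h4 r (Finset.mem_univ r)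
    have h7 := (Finset.sum_eq_zero_iff_of_nonneg fun r _ => sub_nonneg.2 (hvsq r)).1 h5 r
      (Finset.mem_univ r)
    refine ⟨sub_eq_zero.1 (norm_eq_zero.1 (pow_eq_zero_iff two_ne_zero |>.1 h6)), ?_⟩
    nlinarith [norm_nonneg (v r), hv r]

end SumOfSquares

/-! ### Signs of the Svetlichny expression -/

section Signs

/-- The sign of the Svetlichny expression at inputs of weight `w`. -/
def svetSign (s : ℤˣ) (w : ℕ) : ℝ := (-1 : ℝ) ^ (((w : ℤ) * ((w : ℤ) + (s : ℤ))) / 2)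

theorem svetSign_even (s : ℤˣ) (j : ℕ) : svetSign s (2 * j) = (-1) ^ j := by
  have h : (((2 * j : ℕ) : ℤ) * (((2 * j : ℕ) : ℤ) + (s : ℤ))) / 2 = j * (2 * j + s) := by
    push_cast
    rw [mul_assoc]
    exact Int.mul_ediv_cancel_left _ two_ne_zero
  rw [svetSign, h, zpow_mul, zpow_natCast]
  -- The exponent at weight 2j is j times this odd number, whence no dependence on `s`.
  have hodd : Odd ((2 : ℤ) * j + s) := by
    rcases Int.units_eq_one_or s with rfl | rfl
    · exact ⟨j, by simp⟩
    · exact ⟨j - 1, by simp; ring⟩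
  rcases neg_one_pow_eq_or ℝ j with h | h
  · rw [h, one_zpow]
  · rw [h, hodd.neg_one_zpow]

theorem svetSign_odd (s : ℤˣ) (j : ℕ) :
    svetSign s (2 * j + 1) = -((s : ℤ) : ℝ) * (-1) ^ j := by
  rw [svetSign]
  rcases Int.units_eq_one_or s with rfl | rfl
  · have h : (((2 * j + 1 : ℕ) : ℤ) * (((2 * j + 1 : ℕ) : ℤ) + ((1 : ℤˣ) : ℤ))) / 2 =
        (2 * j + 1) * ((j + 1 : ℕ) : ℤ) := by
      push_cast
      rw [show ((2 * j + 1 : ℤ) * (2 * j + 1 + 1)) = 2 * ((2 * j + 1) * (j + 1)) by ring]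
      exact Int.mul_ediv_cancel_left _ two_ne_zero
    rw [h, zpow_mul, (show Odd (2 * (j : ℤ) + 1) from ⟨j, rfl⟩).neg_one_zpow, zpow_natCast,
      pow_succ]
    simp
  · have h : (((2 * j + 1 : ℕ) : ℤ) * (((2 * j + 1 : ℕ) : ℤ) + ((-1 : ℤˣ) : ℤ))) / 2 =
        (2 * j + 1) * (j : ℤ) := by
      push_cast
      rw [show ((2 * j + 1 : ℤ) * (2 * j + 1 + -1)) = 2 * ((2 * j + 1) * j) by ring]
      exact Int.mul_ediv_cancel_left _ two_ne_zero
    rw [h, zpow_mul, (show Odd (2 * (j : ℤ) + 1) from ⟨j, rfl⟩).neg_one_zpow, zpow_natCast]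
    simp

theorem intUnit_sq (s : ℤˣ) : ((s : ℤ) : ℝ) ^ 2 = 1 := by
  rcases Int.units_eq_one_or s with rfl | rfl <;> norm_num

theorem svetSign_sq (s : ℤˣ) (w : ℕ) : svetSign s w ^ 2 = 1 := by
  obtain ⟨j, rfl | rfl⟩ := Nat.even_or_odd' w
  · rw [svetSign_even, ← pow_mul, mul_comm, pow_mul]; norm_num
  · rw [svetSign_odd, mul_pow, neg_sq, intUnit_sq, ← pow_mul, mul_comm j, pow_mul]; norm_num

/-- This alternation in the weight makes the coefficients of the first party's two observables
orthogonal. -/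
theorem svetSign_mul_succ (s : ℤˣ) (w : ℕ) :
    svetSign s w * svetSign s (w + 1) = -((s : ℤ) : ℝ) * (-1) ^ w := by
  obtain ⟨j, rfl | rfl⟩ := Nat.even_or_odd' w
  · rw [svetSign_even, svetSign_odd, mul_left_comm, ← mul_pow, pow_mul]; norm_num
  · rw [svetSign_odd, show 2 * j + 1 + 1 = 2 * (j + 1) by ring, svetSign_even, mul_assoc, ← pow_add]
    congr 2
    ring

theorem weight_append {n m : ℕ} (h : Fin n → Fin 2) (y : Fin m → Fin 2) :
    weight (Fin.append h y) = weight h + weight y := by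
  simp [weight, Fin.sum_univ_add]

theorem weight_cons {n : ℕ} (b : Fin 2) (h : Fin n → Fin 2) :
    weight (Fin.cons b h : Fin (n + 1) → Fin 2) = b + weight h := by
  simp [weight, Fin.sum_univ_succ]

/-- The two values of the first bit cancel, which needs at least one bit. -/
theorem sum_neg_one_pow_weight {m : ℕ} (hm : 1 ≤ m) :
    ∑ y : Fin m → Fin 2, (-1 : ℝ) ^ weight y = 0 := by
  obtain ⟨m, rfl⟩ := Nat.exists_eq_add_of_le' hm
  rw [← (Fin.consEquiv fun _ => Fin 2).sum_comp, Fintype.sum_prod_type]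
  simp [Fin.consEquiv, weight_cons, Fin.sum_univ_two, pow_add]

end Signs

/-! ### The Svetlichny expression as a sum of inner products, and its bound -/

section Expansion

variable {n : ℕ} {H H' : Option (Fin n) → CHilb.{u}} {P : CHilb.{u}}

/-- Expansion of a tensor product of sums of operators, with one index type for the honest parties
and another one for the group. -/
theorem localOp_sum_option {b c : Type} [Fintype b] [Fintype c] (T : ∀ o, H o →L[ℂ] H' o)
    (L : ∀ i : Fin n, b → (H (some i) →L[ℂ] H' (some i))) (M : c → (H none →L[ℂ] H' none))
    (hL : ∀ i, T (some i) = ∑ σ, L i σ) (hM : T none = ∑ σ, M σ) :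
    localOp P T = ∑ σ : Fin n → b, ∑ ρ : c,
      localOp P (Option.rec (M ρ) (fun i => L i (σ i)) : ∀ o, H o →L[ℂ] H' o) := by
  classical
  -- The index type depends on the party: one bit for an honest party, a whole outcome string for
  -- the group.
  let β : Option (Fin n) → Type := fun o => Option.elim o c (fun _ => b)
  let _ : ∀ o, Fintype (β o) := fun o => by cases o <;> (dsimp [β]; infer_instance)
  let K : ∀ o, β o → (H o →L[ℂ] H' o) := fun o => match o with
    | none => M
    | some i => L i
  have hT : T = fun o => ∑ σ, K o σ := by
    ext1 o
    cases o with
    | none => exact hM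
    | some i => exact hL i
  rw [hT, MultilinearMap.map_sum, ← (Equiv.piOptionEquivProd (β := β)).symm.sum_comp,
    Fintype.sum_prod_type, Finset.sum_comm]
  refine Finset.sum_congr rfl fun σ _ => Finset.sum_congr rfl fun ρ _ => ?_
  congr 1
  ext1 o
  cases o <;> rfl

end Expansion

namespace Strategy

variable {n m : ℕ} (S : Strategy.{u} n m)

theorem honestObs_eq (i : Fin n) (x : Fin 2) :
    S.honestObs i x = ∑ b : Fin 2, (-1 : ℂ) ^ (b : ℕ) • (S.honest i x).effect b := by
  simp [honestObs, Fin.sum_univ_two, sub_eq_add_neg]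

theorem isSelfAdjoint_obs (x : Fin n → Fin 2) (y : Fin m → Fin 2) (o : Option (Fin n)) :
    IsSelfAdjoint (S.obs x y o) := by
  cases o with
  | none => exact (S.group y).isSelfAdjoint_sum_sign _
  | some i =>
    have := (S.honest i (x i)).isSelfAdjoint_sum_sign (fun b => (b : ℕ))
    rwa [← honestObs_eq] at this

theorem norm_obs_le_one (x : Fin n → Fin 2) (y : Fin m → Fin 2) (o : Option (Fin n)) :
    ‖S.obs x y o‖ ≤ 1 := by
  cases o with
  | none => exact (S.group y).norm_sum_sign_le_one _
  | some i =>
    have := (S.honest i (x i)).norm_sum_sign_le_one (fun b => (b : ℕ))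
    rwa [← honestObs_eq] at this

/-- The parity sign is a product of one sign per honest party and one for the group. By
multilinearity the signed sum over outcomes is the tensor product of the observables. -/
theorem correlator_behaviour (h : Fin n → Fin 2) (y : Fin m → Fin 2) :
    correlator S.behaviour (Fin.append h y) =
      (⟪S.vec, localOp S.purifier (S.obs h y) S.vec⟫_ℂ).re := by
  rw [localOp_sum_option (S.obs h y) 
      (fun i (b : Fin 2) => (-1 : ℂ) ^ (b : ℕ) • (S.honest i (h i)).effect b)
    (fun a => (-1 : ℂ) ^ weight a • (S.group y).effect a) (fun i => S.honestObs_eq i (h i)) rfl]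
  rw [correlator, ← (Fin.appendEquiv n m).sum_comp, Fintype.sum_prod_type]
  simp only [sum_apply, inner_sum, Complex.re_sum]
  refine Finset.sum_congr rfl fun a _ => Finset.sum_congr rfl fun a' _ => ?_
  let T : ∀ o, S.space o →L[ℂ] S.space o :=
    Option.rec ((S.group y).effect a') (fun i => (S.honest i (h i)).effect (a i))
  let c : Option (Fin n) → ℂ := Option.rec ((-1) ^ weight a') (fun i => (-1) ^ (a i : ℕ))
  have hT : (Option.rec ((-1 : ℂ) ^ weight a' • (S.group y).effect a')
      (fun i => (-1 : ℂ) ^ (a i : ℕ) • (S.honest i (h i)).effect (a i)) :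
        ∀ o, S.space o →L[ℂ] S.space o) = fun o => c o • T o := by
    ext1 o
    cases o <;> rfl
  have hc : ∏ o, c o = (((-1 : ℝ) ^ (weight a + weight a') : ℝ) : ℂ) := by
    rw [Fintype.prod_option]
    simp only [c, Finset.prod_pow_eq_pow_sum]
    rw [pow_add, mul_comm]
    push_cast
    rfl
  rw [hT, MultilinearMap.map_smul_univ, hc, smul_apply, inner_smul_right, Complex.re_ofReal_mul]
  change (-1 : ℝ) ^ weight (Fin.append a a') * S.behaviour (Fin.append a a') (Fin.append h y) = _
  rw [weight_append]
  congr 1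
  simp only [behaviour, Fin.append_left, Fin.append_right]
  rfl

theorem svetlichny_eq (s : ℤˣ) (p : Behaviour (n + m)) :
    svetlichny s p = ∑ h : Fin n → Fin 2, ∑ y : Fin m → Fin 2,
      svetSign s (weight h + weight y) * correlator p (Fin.append h y) := by
  rw [svetlichny, ← (Fin.appendEquiv n m).sum_comp, Fintype.sum_prod_type]
  refine Finset.sum_congr rfl fun h _ => Finset.sum_congr rfl fun y _ => ?_
  change (-1 : ℝ) ^ (((weight (Fin.append h y) : ℤ) *
    ((weight (Fin.append h y) : ℤ) + (s : ℤ))) / 2) * correlator p (Fin.append h y) = _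
  rw [weight_append]
  rfl

end Strategy

namespace Strategy

variable {n m : ℕ} (S : Strategy.{u} (n + 1) m)

/-- The observables of all parties but the first one, for given inputs, as an operator of the
total space. -/
def restOp (r : (Fin n → Fin 2) × (Fin m → Fin 2)) :
    totalSpace S.space S.purifier →L[ℂ] totalSpace S.space S.purifier :=
  localOp S.purifier (Function.update (S.obs (Fin.cons 0 r.1) r.2) (some 0)
    (ContinuousLinearMap.id ℂ (S.space (some 0))))

theorem isSelfAdjoint_update_id {n : ℕ} {H : Option (Fin n) → CHilb.{u}}
    {T : ∀ o, H o →L[ℂ] H o} (hT : ∀ o, IsSelfAdjoint (T o)) (o o' : Option (Fin n)) :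
    IsSelfAdjoint (Function.update T o (ContinuousLinearMap.id ℂ (H o)) o') := by
  by_cases h : o' = o
  · subst h
    rw [Function.update_self]
    exact IsSelfAdjoint.one (H o' →L[ℂ] H o')
  · rw [Function.update_of_ne h]
    exact hT o'

theorem norm_update_id_le_one {n : ℕ} {H : Option (Fin n) → CHilb.{u}}
    {T : ∀ o, H o →L[ℂ] H o} (hT : ∀ o, ‖T o‖ ≤ 1) (o o' : Option (Fin n)) :
    ‖Function.update T o (ContinuousLinearMap.id ℂ (H o)) o'‖ ≤ 1 := by
  by_cases h : o' = o
  · subst h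
    rw [Function.update_self]
    exact ContinuousLinearMap.norm_id_le
  · rw [Function.update_of_ne h]
    exact hT o'

theorem isSelfAdjoint_restOp (r : (Fin n → Fin 2) × (Fin m → Fin 2)) :
    IsSelfAdjoint (S.restOp r) :=
  isSelfAdjoint_localOp fun _ => isSelfAdjoint_update_id (S.isSelfAdjoint_obs _ _) _ _

theorem norm_restOp_le_one (r : (Fin n → Fin 2) × (Fin m → Fin 2)) : ‖S.restOp r‖ ≤ 1 :=
  norm_localOp_le_one _ fun _ => norm_update_id_le_one (S.norm_obs_le_one _ _) _ _

/-- The first party's observable as an operator of the total space. -/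
def firstOp (x : Fin 2) : totalSpace S.space S.purifier →L[ℂ] totalSpace S.space S.purifier :=
  site S.purifier (some 0) (S.honestObs 0 x)

theorem commute_restOp_site (r : (Fin n → Fin 2) × (Fin m → Fin 2))
    (k : S.space (some 0) →L[ℂ] S.space (some 0)) :
    Commute (S.restOp r) (site S.purifier (some 0) k) :=
  commute_localOp_site _ _ (Function.update_self _ _ _) _

theorem localOp_obs_cons (b : Fin 2) (r : (Fin n → Fin 2) × (Fin m → Fin 2)) :
    localOp S.purifier (S.obs (Fin.cons b r.1) r.2) = S.restOp r * S.firstOp b := by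
  rw [localOp_eq_mul_site _ (some 0), restOp]
  congr 2
  ext1 o
  match o with
  | none => rfl
  | some i =>
    cases i using Fin.cases with
    | zero => rw [Function.update_self, Function.update_self]
    | succ i =>
      have : (some i.succ : Option (Fin (n + 1))) ≠ some 0 := by simp
      rw [Function.update_of_ne this, Function.update_of_ne this]
      rfl

/-- The first party's bit is split off, and the self-adjoint product of the other observables is
moved to the left of the inner product. This is the shape required by `sum_re_inner_le`. -/
theorem svetlichny_behaviour (s : ℤˣ) :
    svetlichny s S.behaviour = ∑ r : (Fin n → Fin 2) × (Fin m → Fin 2),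
      (⟪S.restOp r S.vec,
        (svetSign s (weight r.1 + weight r.2) : ℂ) • S.firstOp 0 S.vec +
        (svetSign s (weight r.1 + weight r.2 + 1) : ℂ) • S.firstOp 1 S.vec⟫_ℂ).re := by
  rw [svetlichny_eq, ← (Fin.consEquiv fun _ => Fin 2).sum_comp, Fintype.sum_prod_type,
    Fin.sum_univ_two, ← Finset.sum_add_distrib, Fintype.sum_prod_type]
  refine Finset.sum_congr rfl fun h _ => ?_
  rw [← Finset.sum_add_distrib]
  refine Finset.sum_congr rfl fun y _ => ?_
  change svetSign s (weight (Fin.cons 0 h : Fin (n + 1) → Fin 2) + weight y) *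
    correlator S.behaviour (Fin.append (Fin.cons 0 h : Fin (n + 1) → Fin 2) y) +
    svetSign s (weight (Fin.cons 1 h : Fin (n + 1) → Fin 2) + weight y) *
    correlator S.behaviour (Fin.append (Fin.cons 1 h : Fin (n + 1) → Fin 2) y) = _
  have key (b : Fin 2) :
      correlator S.behaviour (Fin.append (Fin.cons b h : Fin (n + 1) → Fin 2) y) =
        (⟪S.restOp (h, y) S.vec, S.firstOp b S.vec⟫_ℂ).re := by
    rw [correlator_behaviour, localOp_obs_cons S b (h, y)]
    nth_rw 2 [← (S.isSelfAdjoint_restOp _).adjoint_eq]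
    rw [ContinuousLinearMap.adjoint_inner_left]
    rfl
  rw [key, key, weight_cons, weight_cons, inner_add_right, inner_smul_right, inner_smul_right,
    Complex.add_re, Complex.re_ofReal_mul, Complex.re_ofReal_mul]
  simp only [Fin.val_zero, Fin.val_one, zero_add]
  rw [add_comm 1 (weight h), add_right_comm]

theorem norm_firstOp_le_one (b : Fin 2) : ‖S.firstOp b‖ ≤ 1 :=
  norm_site_le_one _ (S.norm_obs_le_one (fun _ => b) 0 (some 0))

theorem norm_apply_vec_le_one
    {T : totalSpace S.space S.purifier →L[ℂ] totalSpace S.space S.purifier} (hT : ‖T‖ ≤ 1) :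
    ‖T S.vec‖ ≤ 1 := by
  have := T.le_of_opNorm_le hT S.vec
  rwa [S.norm_state, mul_one] at this

theorem sum_svetSign {s : ℤˣ} (hm : 1 ≤ m) : ∑ r : (Fin n → Fin 2) × (Fin m → Fin 2),
    svetSign s (weight r.1 + weight r.2) * svetSign s (weight r.1 + weight r.2 + 1) = 0 := by
  simp only [svetSign_mul_succ, Fintype.sum_prod_type, pow_add, ← Finset.mul_sum,
    sum_neg_one_pow_weight hm, mul_zero, Finset.sum_const_zero]

/-- The sum of squares is applied to the vectors εO_r ψ, which treats both extremal values at once.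
-/
theorem svetlichny_bound (s ε : ℤˣ) (hm : 1 ≤ m) :
    ((ε : ℤ) : ℝ) * svetlichny s S.behaviour ≤ 2 ^ (n + m) * √2 ∧
    (((ε : ℤ) : ℝ) * svetlichny s S.behaviour = 2 ^ (n + m) * √2 → ∀ r,
      ((ε : ℤ) : ℂ) • S.restOp r S.vec = ((1 / √2 : ℝ) : ℂ) •
        ((svetSign s (weight r.1 + weight r.2) : ℂ) • S.firstOp 0 S.vec +
        (svetSign s (weight r.1 + weight r.2 + 1) : ℂ) • S.firstOp 1 S.vec) ∧
      ‖S.restOp r S.vec‖ = 1) := by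
  have hnorm (r) : ‖((ε : ℤ) : ℂ) • S.restOp r S.vec‖ = ‖S.restOp r S.vec‖ := by
    rcases Int.units_eq_one_or ε with rfl | rfl <;> simp
  have h := sum_re_inner_le (u₀ := S.firstOp 0 S.vec) (u₁ := S.firstOp 1 S.vec)
    (v := fun r => ((ε : ℤ) : ℂ) • S.restOp r S.vec)
    (g := fun r => svetSign s (weight r.1 + weight r.2))
    (g' := fun r => svetSign s (weight r.1 + weight r.2 + 1))
    (S.norm_apply_vec_le_one (S.norm_firstOp_le_one 0))
    (S.norm_apply_vec_le_one (S.norm_firstOp_le_one 1))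
    (fun r => (hnorm r).trans_le (S.norm_apply_vec_le_one (S.norm_restOp_le_one r)))
    (fun r => svetSign_sq _ _) (fun r => svetSign_sq _ _) (sum_svetSign hm)
  have hcard : (Fintype.card ((Fin n → Fin 2) × (Fin m → Fin 2)) : ℝ) = 2 ^ (n + m) := by
    simp [pow_add]
  have hsum : ∑ r : (Fin n → Fin 2) × (Fin m → Fin 2), (⟪((ε : ℤ) : ℂ) • S.restOp r S.vec,
        (svetSign s (weight r.1 + weight r.2) : ℂ) • S.firstOp 0 S.vec +
        (svetSign s (weight r.1 + weight r.2 + 1) : ℂ) • S.firstOp 1 S.vec⟫_ℂ).re =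
      ((ε : ℤ) : ℝ) * svetlichny s S.behaviour := by
    rw [svetlichny_behaviour, Finset.mul_sum]
    refine Finset.sum_congr rfl fun r _ => ?_
    have hε : (starRingEnd ℂ) ((ε : ℤ) : ℂ) = (((ε : ℤ) : ℝ) : ℂ) := by simp
    rw [inner_smul_left, hε, Complex.re_ofReal_mul]
  rw [hsum, hcard] at h
  refine ⟨h.1, fun he r => ?_⟩
  rw [← hnorm]
  exact h.2 he r

theorem abs_svetlichny_le (s : ℤˣ) (hm : 1 ≤ m) :
    |svetlichny s S.behaviour| ≤ 2 ^ (n + m) * √2 := by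
  have h1 := (S.svetlichny_bound s 1 hm).1
  have h2 := (S.svetlichny_bound s (-1) hm).1
  rw [abs_le]
  constructor <;> push_cast at h1 h2 <;> linarith

end Strategy

/-! ### Relations between the observables at the maximum -/

section AbstractRelations

variable {E : Type*} [NormedAddCommGroup E] [InnerProductSpace ℂ E]

theorem apply_comm {S T : E →L[ℂ] E} (h : Commute S T) (φ : E) : S (T φ) = T (S φ) :=
  congrArg (fun R : E →L[ℂ] E => R φ) h.eq

theorem norm_apply_le {T : E →L[ℂ] E} (hT : ‖T‖ ≤ 1) (φ : E) : ‖T φ‖ ≤ ‖φ‖ := by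
  simpa using T.le_of_opNorm_le hT φ

variable [CompleteSpace E]

/-- If a product of commuting contractions does not shrink φ, neither factor does. -/
theorem apply_apply_of_norm_comp_eq {O a : E →L[ℂ] E} (hO : IsSelfAdjoint O) (hO1 : ‖O‖ ≤ 1)
    (ha : IsSelfAdjoint a) (ha1 : ‖a‖ ≤ 1) (hOa : Commute O a) {φ : E}
    (h : ‖φ‖ ≤ ‖O (a φ)‖) : O (O φ) = φ ∧ a (a φ) = φ := by
  refine ⟨apply_apply_of_norm_eq hO hO1 ?_, apply_apply_of_norm_eq ha ha1 ?_⟩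
  · rw [apply_comm hOa] at h
    exact h.trans (norm_apply_le ha1 _)
  · exact h.trans (norm_apply_le hO1 _)

/-- Pairing with φ gives ‖Aφ‖² + ‖Bφ‖² = 2‖φ‖², while each term is at most ‖φ‖². -/
theorem norm_eq_of_sq_add_sq {A B : E →L[ℂ] E} (hA : IsSelfAdjoint A) (hA1 : ‖A‖ ≤ 1)
    (hB : IsSelfAdjoint B) (hB1 : ‖B‖ ≤ 1) {φ : E} (h : A (A φ) + B (B φ) = (2 : ℂ) • φ) :
    A (A φ) = φ ∧ B (B φ) = φ := by
  have hin {T : E →L[ℂ] E} (hT : IsSelfAdjoint T) : ⟪φ, T (T φ)⟫_ℂ = (‖T φ‖ : ℂ) ^ 2 := by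
    nth_rw 1 [← hT.adjoint_eq]
    rw [ContinuousLinearMap.adjoint_inner_right]
    exact inner_self_eq_norm_sq_to_K _
  have h1 := congrArg (fun v => ⟪φ, v⟫_ℂ) h
  simp only [inner_add_right, inner_smul_right, hin hA, hin hB] at h1
  have h2 : ⟪φ, φ⟫_ℂ = (‖φ‖ : ℂ) ^ 2 := inner_self_eq_norm_sq_to_K _
  rw [h2] at h1
  have h3 : ‖A φ‖ ^ 2 + ‖B φ‖ ^ 2 = 2 * ‖φ‖ ^ 2 := by exact_mod_cast h1
  have h4 : ‖A φ‖ ^ 2 ≤ ‖φ‖ ^ 2 := pow_le_pow_left₀ (norm_nonneg _) (norm_apply_le hA1 φ) 2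
  have h5 : ‖B φ‖ ^ 2 ≤ ‖φ‖ ^ 2 := pow_le_pow_left₀ (norm_nonneg _) (norm_apply_le hB1 φ) 2
  exact ⟨apply_apply_of_norm_eq hA hA1 (le_of_sq_le_sq (by linarith) (norm_nonneg _)),
    apply_apply_of_norm_eq hB hB1 (le_of_sq_le_sq (by linarith) (norm_nonneg _))⟩

end AbstractRelations

section Anticommuting

variable {n : ℕ} {H : Option (Fin n) → CHilb.{u}} {P : CHilb.{u}}

/-- On the vector `ψ`, the operators `a`, `b` of party `o` act like anticommuting self-adjoint
unitaries. -/
structure AnticommutingOn (ψ : totalSpace H P) (o : Option (Fin n)) (a b : H o →L[ℂ] H o) :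
    Prop where
  left_sq : site P o (a * a) ψ = ψ
  right_sq : site P o (b * b) ψ = ψ
  anticomm : site P o (a * b + b * a) ψ = 0
  stable : ∀ k, site P o k ψ = 0 → site P o (k * a) ψ = 0 ∧ site P o (k * b) ψ = 0

theorem site_mul_apply {o : Option (Fin n)} (k l : H o →L[ℂ] H o) (φ : totalSpace H P) :
    site P o (k * l) φ = site P o k (site P o l φ) := by
  rw [map_mul]; rfl

theorem isSelfAdjoint_site {o : Option (Fin n)} {k : H o →L[ℂ] H o} (hk : IsSelfAdjoint k) :
    IsSelfAdjoint (site P o k) := hk.map _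

end Anticommuting

theorem intUnit_cast_sq (s : ℤˣ) : ((s : ℤ) : ℂ) * ((s : ℤ) : ℂ) = 1 := by
  rcases Int.units_eq_one_or s with rfl | rfl <;> norm_num

theorem invSqrtTwo_mul_self : ((1 / √2 : ℝ) : ℂ) * ((1 / √2 : ℝ) : ℂ) = 1 / 2 := by
  rw [← Complex.ofReal_mul, ← pow_two, div_pow, Real.sq_sqrt (by norm_num)]
  norm_num

namespace Strategy

variable {n m : ℕ} (S : Strategy.{u} (n + 1) m)

/-- The combinations of the first party's observables that correspond to `ε σ_x` and to
`-ε σ_y`, for even and for odd weights of the inputs of the other parties. -/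
def firstPart (s : ℤˣ) (w : ℕ) : S.space (some 0) →L[ℂ] S.space (some 0) :=
  if Even w then ((1 / √2 : ℝ) : ℂ) • (S.honestObs 0 0 - ((s : ℤ) : ℂ) • S.honestObs 0 1)
  else -((1 / √2 : ℝ) : ℂ) • (((s : ℤ) : ℂ) • S.honestObs 0 0 + S.honestObs 0 1)

/-- The relations that hold if the Svetlichny expression attains `ε` times its maximum. -/
def IsOptimal (s ε : ℤˣ) : Prop :=
  ∀ r : (Fin n → Fin 2) × (Fin m → Fin 2),
    S.restOp r S.vec = (((ε : ℤ) : ℂ) * (-1) ^ ((weight r.1 + weight r.2) / 2)) •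
      site S.purifier (some 0) (S.firstPart s (weight r.1 + weight r.2)) S.vec ∧
    ‖S.restOp r S.vec‖ = 1

variable {S} {s ε : ℤˣ}

/-- Up to the factor (−1)^⌊w/2⌋, the signs at weights w and w + 1 depend only on the parity of w. So
only two combinations of the first party's observables ever occur. -/
theorem isOptimal_of_svetlichny (hm : 1 ≤ m)
    (h : svetlichny s S.behaviour = ((ε : ℤ) : ℝ) * (2 ^ (n + m) * √2)) : S.IsOptimal s ε := by
  intro r
  obtain ⟨h1, h2⟩ := (S.svetlichny_bound s ε hm).2 (by
    rw [h, ← mul_assoc, ← pow_two, intUnit_sq, one_mul]) r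
  refine ⟨?_, h2⟩
  have h3 := congrArg (fun v => ((ε : ℤ) : ℂ) • v) h1
  simp only [smul_smul, intUnit_cast_sq, one_smul] at h3
  rw [h3, mul_smul, ← smul_smul]
  congr 1
  have hs := intUnit_cast_sq s
  obtain ⟨j, hj | hj⟩ := Nat.even_or_odd' (weight r.1 + weight r.2)
  · have hd : 2 * j / 2 = j := by omega
    rw [hj, svetSign_even, svetSign_odd, hd, firstPart, if_pos (even_two_mul j)]
    simp only [map_smul, map_sub, smul_apply, sub_apply, firstOp]
    push_cast
    module
  · have hd : (2 * j + 1) / 2 = j := by omega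
    rw [hj, svetSign_odd, show 2 * j + 1 + 1 = 2 * (j + 1) by ring, svetSign_even, hd, firstPart,
      if_neg (Nat.not_even_iff_odd.2 ⟨j, rfl⟩)]
    simp only [map_smul, map_add, smul_apply, add_apply, firstOp]
    push_cast
    rw [pow_succ]
    module

variable (S) in
/-- The inputs of the parties other than the first one if only the party `o` gets a one. -/
def flipInput (hm : 1 ≤ m) : Option (Fin n) → (Fin n → Fin 2) × (Fin m → Fin 2)
  | none => (0, Pi.single ⟨0, hm⟩ 1)
  | some i => (Pi.single i 1, 0)

theorem weight_zero {n : ℕ} : weight (0 : Fin n → Fin 2) = 0 := by simp [weight]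

theorem weight_single {n : ℕ} (i : Fin n) : weight (Pi.single i 1 : Fin n → Fin 2) = 1 := by
  rw [weight, Finset.sum_eq_single i]
  · simp
  · intro j _ hj; simp [Pi.single_eq_of_ne hj]
  · simp

theorem weight_flipInput (hm : 1 ≤ m) (o : Option (Fin n)) :
    weight (flipInput hm o).1 + weight (flipInput hm o).2 = 1 := by
  cases o <;> simp [flipInput, weight_zero, weight_single]

/-- The parties other than the first one. -/
@[reducible] def restParty : Option (Fin n) → Option (Fin (n + 1))
  | none => none
  | some i => some i.succ

theorem restParty_ne (o : Option (Fin n)) : restParty o ≠ some 0 := by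
  cases o <;> simp

variable (S) in
/-- The observables of all parties but the first one and `o`, as an operator of the total
space. -/
def othersOp (o : Option (Fin n)) (r : (Fin n → Fin 2) × (Fin m → Fin 2)) :
    totalSpace S.space S.purifier →L[ℂ] totalSpace S.space S.purifier :=
  localOp S.purifier (Function.update (Function.update (S.obs (Fin.cons 0 r.1) r.2) (some 0)
    (ContinuousLinearMap.id ℂ (S.space (some 0)))) (restParty o)
    (ContinuousLinearMap.id ℂ (S.space (restParty o))))

theorem restOp_eq_othersOp_mul (o : Option (Fin n)) (r : (Fin n → Fin 2) × (Fin m → Fin 2)) :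
    S.restOp r = S.othersOp o r *
      site S.purifier (restParty o) (S.obs (Fin.cons 0 r.1) r.2 (restParty o)) := by
  rw [restOp, localOp_eq_mul_site _ (restParty o), Function.update_of_ne (restParty_ne o)]
  rfl

theorem othersOp_congr {o : Option (Fin n)} {r r' : (Fin n → Fin 2) × (Fin m → Fin 2)}
    (h : ∀ o', o' ≠ o → S.obs (Fin.cons 0 r.1) r.2 (restParty o') =
      S.obs (Fin.cons 0 r'.1) r'.2 (restParty o')) : S.othersOp o r = S.othersOp o r' := by
  rw [othersOp, othersOp]
  congr 1
  ext1 o'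
  by_cases h0 : o' = restParty o
  · subst h0; rw [Function.update_self, Function.update_self]
  rw [Function.update_of_ne h0, Function.update_of_ne h0]
  match o' with
  | none => exact h none (by rintro rfl; exact h0 rfl)
  | some i =>
    cases i using Fin.cases with
    | zero => rw [Function.update_self, Function.update_self]
    | succ i =>
      have : (some i.succ : Option (Fin (n + 1))) ≠ some 0 := by simp
      rw [Function.update_of_ne this, Function.update_of_ne this]
      exact h (some i) (by rintro rfl; exact h0 rfl)

theorem isSelfAdjoint_othersOp (o : Option (Fin n)) (r : (Fin n → Fin 2) × (Fin m → Fin 2)) :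
    IsSelfAdjoint (S.othersOp o r) :=
  isSelfAdjoint_localOp fun _ => isSelfAdjoint_update_id
    (fun _ => isSelfAdjoint_update_id (S.isSelfAdjoint_obs _ _) _ _) _ _

theorem norm_othersOp_le_one (o : Option (Fin n)) (r : (Fin n → Fin 2) × (Fin m → Fin 2)) :
    ‖S.othersOp o r‖ ≤ 1 :=
  norm_localOp_le_one _ fun _ => norm_update_id_le_one
    (fun _ => norm_update_id_le_one (S.norm_obs_le_one _ _) _ _) _ _

theorem commute_othersOp_site (o : Option (Fin n)) (r : (Fin n → Fin 2) × (Fin m → Fin 2))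
    (k : S.space (restParty o) →L[ℂ] S.space (restParty o)) :
    Commute (S.othersOp o r) (site S.purifier (restParty o) k) :=
  commute_localOp_site _ _ (Function.update_self _ _ _) _

theorem commute_othersOp_first (o : Option (Fin n)) (r : (Fin n → Fin 2) × (Fin m → Fin 2))
    (k : S.space (some 0) →L[ℂ] S.space (some 0)) :
    Commute (S.othersOp o r) (site S.purifier (some 0) k) :=
  commute_localOp_site _ _ (by
    rw [Function.update_of_ne (restParty_ne o).symm, Function.update_self]) _

variable (S) in
/-- The inputs on which only the party `o` may get another input than zero. -/
def SupportedAt (o : Option (Fin n)) (r : (Fin n → Fin 2) × (Fin m → Fin 2)) : Prop :=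
  ∀ o', o' ≠ o → S.obs (Fin.cons 0 r.1) r.2 (restParty o') =
      S.obs (Fin.cons 0 0) 0 (restParty o')

theorem supportedAt_flipInput (hm : 1 ≤ m) (o : Option (Fin n)) :
    S.SupportedAt o (flipInput hm o) := by
  intro o' ho'
  match o, o' with
  | none, none => exact absurd rfl ho'
  | none, some i => rfl
  | some i, none => rfl
  | some i, some j =>
    have hij : j ≠ i := fun hij => ho' (congrArg some hij)
    simp only [obs, flipInput, Fin.cons_succ, Pi.single_eq_of_ne hij]
    rfl

theorem supportedAt_group (y : Fin m → Fin 2) : S.SupportedAt none (0, y) := by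
  intro o' ho'
  match o' with
  | none => exact absurd rfl ho'
  | some i => rfl

theorem supportedAt_zero (o : Option (Fin n)) : S.SupportedAt o 0 := fun _ _ => rfl

namespace IsOptimal

theorem restOp_zero (h : S.IsOptimal s ε) :
    S.restOp 0 S.vec = ((ε : ℤ) : ℂ) • site S.purifier (some 0) (S.firstPart s 0) S.vec := by
  have := (h 0).1
  simpa [weight_zero] using this

theorem restOp_flip (h : S.IsOptimal s ε) (hm : 1 ≤ m) (o : Option (Fin n)) :
    S.restOp (flipInput hm o) S.vec =
      ((ε : ℤ) : ℂ) • site S.purifier (some 0) (S.firstPart s 1) S.vec := by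
  have := (h (flipInput hm o)).1
  simpa [weight_flipInput] using this

theorem restOp_restOp (h : S.IsOptimal s ε) (r : (Fin n → Fin 2) × (Fin m → Fin 2)) :
    S.restOp r (S.restOp r S.vec) = S.vec :=
  apply_apply_of_norm_eq (S.isSelfAdjoint_restOp r) (S.norm_restOp_le_one r)
    ((h r).2.symm ▸ S.norm_state.le)

/-- Since O_r commutes with `k`, O_r²ψ = ε²k²ψ, and the left side is ψ. -/
theorem first_sq_of_restOp (h : S.IsOptimal s ε) {r : (Fin n → Fin 2) × (Fin m → Fin 2)}
    {k : S.space (some 0) →L[ℂ] S.space (some 0)}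
    (hk : S.restOp r S.vec = ((ε : ℤ) : ℂ) • site S.purifier (some 0) k S.vec) :
    site S.purifier (some 0) k (site S.purifier (some 0) k S.vec) = S.vec := by
  have h1 := h.restOp_restOp r
  rw [hk, map_smul, apply_comm (S.commute_restOp_site r k), hk, map_smul, smul_smul,
    intUnit_cast_sq, one_smul] at h1
  exact h1

/-- On the state, `k` can be traded for an operator of the other parties, past which `l` commutes.
-/
theorem site_mul_eq_zero_of_restOp {r : (Fin n → Fin 2) × (Fin m → Fin 2)}
    {k l : S.space (some 0) →L[ℂ] S.space (some 0)}
    (hk : S.restOp r S.vec = ((ε : ℤ) : ℂ) • site S.purifier (some 0) k S.vec)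
    (hl : site S.purifier (some 0) l S.vec = 0) :
    site S.purifier (some 0) l (site S.purifier (some 0) k S.vec) = 0 := by
  have h1 : site S.purifier (some 0) k S.vec = ((ε : ℤ) : ℂ) • S.restOp r S.vec := by
    rw [hk, smul_smul, intUnit_cast_sq, one_smul]
  rw [h1, map_smul, ← apply_comm (S.commute_restOp_site r l), hl, map_zero, smul_zero]

theorem anticommutingOn_first (h : S.IsOptimal s ε) (hm : 1 ≤ m) :
    AnticommutingOn S.vec (some 0) (S.honestObs 0 0) (S.honestObs 0 1) := by
  have hE := h.first_sq_of_restOp h.restOp_zero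
  have hF := h.first_sq_of_restOp (h.restOp_flip hm none)
  have hr := invSqrtTwo_mul_self
  have hs := intUnit_cast_sq s
  have hEf (φ) : site S.purifier (some 0) (S.firstPart s 0) φ =
      ((1 / √2 : ℝ) : ℂ) • (S.firstOp 0 φ - ((s : ℤ) : ℂ) • S.firstOp 1 φ) := by
    rw [firstPart, if_pos Even.zero, map_smul, map_sub, map_smul]; rfl
  have hFf (φ) : site S.purifier (some 0) (S.firstPart s 1) φ =
      -((1 / √2 : ℝ) : ℂ) • (((s : ℤ) : ℂ) • S.firstOp 0 φ + S.firstOp 1 φ) := by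
    rw [firstPart, if_neg (by decide), map_smul, map_add, map_smul]; rfl
  have hsN (l : S.space (some 0) →L[ℂ] S.space (some 0))
      (hl : site S.purifier (some 0) l S.vec = 0) :
      site S.purifier (some 0) l (S.firstOp 0 S.vec) = 0 ∧
      site S.purifier (some 0) l (S.firstOp 1 S.vec) = 0 := by
    have h1 := site_mul_eq_zero_of_restOp h.restOp_zero hl
    have h2 := site_mul_eq_zero_of_restOp (h.restOp_flip hm none) hl
    rw [hEf, map_smul, map_sub, map_smul] at h1
    rw [hFf, map_smul, map_add, map_smul] at h2
    set x := site S.purifier (some 0) l (S.firstOp 0 S.vec)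
    set y := site S.purifier (some 0) l (S.firstOp 1 S.vec)
    set r := ((1 / √2 : ℝ) : ℂ)
    set t := ((s : ℤ) : ℂ)
    constructor
    -- The matrix expressing the two combinations through A₀ and A₁ is orthogonal; this is its
    -- inverse.
    · have : x = r • (r • (x - t • y)) - (t * r) • (-r • (t • x + y)) := by
        linear_combination (norm := module) (-2 * hr) • x - (r * r * hs) • x
      rw [this, h1, h2, smul_zero, smul_zero, sub_zero]
    · have : y = -(t * r) • (r • (x - t • y)) - r • (-r • (t • x + y)) := by
        linear_combination (norm := module) (-2 * hr) • y - (r * r * hs) • y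
      rw [this, h1, h2, smul_zero, smul_zero, sub_zero]
  simp only [hEf, hFf, map_smul, map_sub, map_add] at hE hF
  have hA := isSelfAdjoint_site (P := S.purifier) (S.isSelfAdjoint_obs 0 0 (some 0))
  have hB := isSelfAdjoint_site (P := S.purifier) (S.isSelfAdjoint_obs 1 0 (some 0))
  -- E² + F² = A₀² + A₁². As both observables are contractions, each must then square to 1 on ψ.
  have hsum : S.firstOp 0 (S.firstOp 0 S.vec) + S.firstOp 1 (S.firstOp 1 S.vec) =
      (2 : ℂ) • S.vec := by
    linear_combination (norm := module) hE + hF -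
      (2 * hr + ((1 / √2 : ℝ) : ℂ) * ((1 / √2 : ℝ) : ℂ) * hs) •
        (S.firstOp 0 (S.firstOp 0 S.vec) + S.firstOp 1 (S.firstOp 1 S.vec))
  -- F² − E² = s(A₀A₁ + A₁A₀), and the left side kills ψ.
  have hdiff : S.firstOp 0 (S.firstOp 1 S.vec) + S.firstOp 1 (S.firstOp 0 S.vec) = 0 := by
    linear_combination (norm := module) ((s : ℤ) : ℂ) • hF - ((s : ℤ) : ℂ) • hE -
      (2 * hr + 2 * ((1 / √2 : ℝ) : ℂ) * ((1 / √2 : ℝ) : ℂ) * hs) •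
        (S.firstOp 0 (S.firstOp 1 S.vec) + S.firstOp 1 (S.firstOp 0 S.vec)) -
      (((s : ℤ) : ℂ) * ((1 / √2 : ℝ) : ℂ) * ((1 / √2 : ℝ) : ℂ) * hs) •
        (S.firstOp 0 (S.firstOp 0 S.vec) - S.firstOp 1 (S.firstOp 1 S.vec))
  obtain ⟨hAA, hBB⟩ := norm_eq_of_sq_add_sq hA (S.norm_firstOp_le_one 0) hB
    (S.norm_firstOp_le_one 1) hsum
  refine ⟨(site_mul_apply _ _ _).trans hAA, (site_mul_apply _ _ _).trans hBB, ?_, fun k hk => ?_⟩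
  · rw [map_add, add_apply, site_mul_apply, site_mul_apply]
    exact hdiff
  · rw [site_mul_apply, site_mul_apply]
    exact hsN k hk

/-- EF + FE = −s(A₀² − A₁²), which vanishes on the state. -/
theorem first_anticomm (h : S.IsOptimal s ε) (hm : 1 ≤ m) :
    site S.purifier (some 0) (S.firstPart s 0) (site S.purifier (some 0) (S.firstPart s 1) S.vec) +
    site S.purifier (some 0) (S.firstPart s 1) (site S.purifier (some 0) (S.firstPart s 0) S.vec) =
      0 := by
  have h0 := h.anticommutingOn_first hm
  have hAA := h0.left_sq
  have hBB := h0.right_sq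
  rw [site_mul_apply] at hAA hBB
  simp only [firstPart, if_pos Even.zero, if_neg (show ¬ Even 1 by decide), map_smul, map_sub,
    map_add, map_neg, neg_apply, neg_smul, smul_apply, sub_apply, add_apply, hAA, hBB]
  linear_combination (norm := module)
    (((1 / √2 : ℝ) : ℂ) * ((1 / √2 : ℝ) : ℂ) * intUnit_cast_sq s) •
      (site S.purifier (some 0) (S.honestObs 0 1) (site S.purifier (some 0) (S.honestObs 0 0) S.vec)
      + site S.purifier (some 0) (S.honestObs 0 0)
        (site S.purifier (some 0) (S.honestObs 0 1) S.vec))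

/-- For inputs at which the parties other than the first one and `o` get zero, the observables of
these parties as one operator. -/
theorem othersOp_site (h : S.IsOptimal s ε) {o : Option (Fin n)}
    {r : (Fin n → Fin 2) × (Fin m → Fin 2)} (hr : S.SupportedAt o r) :
    S.othersOp o 0 (site S.purifier (restParty o) (S.obs (Fin.cons 0 r.1) r.2 (restParty o)) S.vec) =
      (((ε : ℤ) : ℂ) * (-1) ^ ((weight r.1 + weight r.2) / 2)) •
        site S.purifier (some 0) (S.firstPart s (weight r.1 + weight r.2)) S.vec := by
  rw [← (h r).1, restOp_eq_othersOp_mul o r, othersOp_congr (r' := 0) hr]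
  rfl

/-- O_r is the product of two commuting contractions, and ‖O_r ψ‖ = 1 forces both to square to 1 on
ψ. -/
theorem othersOp_sq (h : S.IsOptimal s ε) {o : Option (Fin n)}
    {r : (Fin n → Fin 2) × (Fin m → Fin 2)} (hr : S.SupportedAt o r) :
    S.othersOp o 0 (S.othersOp o 0 S.vec) = S.vec ∧
      site S.purifier (restParty o) (S.obs (Fin.cons 0 r.1) r.2 (restParty o))
        (site S.purifier (restParty o) (S.obs (Fin.cons 0 r.1) r.2 (restParty o)) S.vec) =
          S.vec := by
  refine apply_apply_of_norm_comp_eq (isSelfAdjoint_othersOp o 0) (norm_othersOp_le_one o 0)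
    (isSelfAdjoint_site (S.isSelfAdjoint_obs _ _ _)) (norm_site_le_one _ (S.norm_obs_le_one _ _ _))
    (commute_othersOp_site o 0 _) ?_
  have h1 := (h r).2
  rw [restOp_eq_othersOp_mul o r, othersOp_congr (r' := 0) hr] at h1
  exact S.norm_state.le.trans h1.ge

/-- On the state, the observable of a party acts like an operator of the other parties. -/
theorem site_rest (h : S.IsOptimal s ε) {o : Option (Fin n)}
    {r : (Fin n → Fin 2) × (Fin m → Fin 2)} (hr : S.SupportedAt o r) :
    site S.purifier (restParty o) (S.obs (Fin.cons 0 r.1) r.2 (restParty o)) S.vec =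
      (((ε : ℤ) : ℂ) * (-1) ^ ((weight r.1 + weight r.2) / 2)) • S.othersOp o 0
        (site S.purifier (some 0) (S.firstPart s (weight r.1 + weight r.2)) S.vec) := by
  rw [← map_smul, ← h.othersOp_site hr, apply_comm (commute_othersOp_site o 0 _),
    apply_comm (commute_othersOp_site o 0 _), (h.othersOp_sq hr).1]

/-- Each observable of party `o` becomes W F_w on ψ, where W belongs to the remaining parties and
W²ψ = ψ. Operators of different parties commute, so the first party's operators appear in reversed
order. -/
theorem site_rest_site_rest (h : S.IsOptimal s ε) {o : Option (Fin n)}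
    {r r' : (Fin n → Fin 2) × (Fin m → Fin 2)} (hr : S.SupportedAt o r)
    (hr' : S.SupportedAt o r') :
    site S.purifier (restParty o) (S.obs (Fin.cons 0 r.1) r.2 (restParty o))
      (site S.purifier (restParty o) (S.obs (Fin.cons 0 r'.1) r'.2 (restParty o)) S.vec) =
    ((-1) ^ ((weight r.1 + weight r.2) / 2) * (-1) ^ ((weight r'.1 + weight r'.2) / 2) : ℂ) •
      site S.purifier (some 0) (S.firstPart s (weight r'.1 + weight r'.2))
        (site S.purifier (some 0) (S.firstPart s (weight r.1 + weight r.2)) S.vec) := by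
  have hc (k l) := commute_site (H := S.space) (P := S.purifier) (restParty_ne o) k l
  rw [h.site_rest hr', map_smul, ← apply_comm (commute_othersOp_site o 0 _), apply_comm (hc _ _),
    h.site_rest hr, map_smul, map_smul, apply_comm (commute_othersOp_first o 0 _),
    apply_comm (commute_othersOp_first o 0 _), apply_comm (commute_othersOp_first o 0 _), (h.othersOp_sq hr).1, smul_smul]
  congr 1
  linear_combination (-1) ^ ((weight r.1 + weight r.2) / 2) *
    (-1) ^ ((weight r'.1 + weight r'.2) / 2) * intUnit_cast_sq ε

/-- The anticommutator of party `o` on ψ is that of the first party's E and F. Stability holds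
because each observable of `o` acts on ψ like an operator commuting with all operators of `o`. -/
theorem anticommutingOn_rest (h : S.IsOptimal s ε) (hm : 1 ≤ m) (o : Option (Fin n)) :
    AnticommutingOn S.vec (restParty o) (S.obs (Fin.cons 0 0) 0 (restParty o))
      (S.obs (Fin.cons 0 (flipInput hm o).1) (flipInput hm o).2 (restParty o)) := by
  have h0 := supportedAt_zero (S := S) o
  have h1 := supportedAt_flipInput (S := S) hm o
  have hst {r : (Fin n → Fin 2) × (Fin m → Fin 2)} (hr : S.SupportedAt o r)
      (k : S.space (restParty o) →L[ℂ] S.space (restParty o))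
      (hk : site S.purifier (restParty o) k S.vec = 0) :
      site S.purifier (restParty o)
        (k * S.obs (Fin.cons 0 r.1) r.2 (restParty o)) S.vec = 0 := by
    rw [site_mul_apply, h.site_rest hr, map_smul, ← apply_comm (commute_othersOp_site o 0 _),
      apply_comm (commute_site (restParty_ne o) _ _), hk, map_zero, map_zero, smul_zero]
  refine ⟨?_, ?_, ?_, fun k hk => ⟨hst h0 k hk, hst h1 k hk⟩⟩
  · exact (site_mul_apply _ _ _).trans (h.othersOp_sq h0).2
  · exact (site_mul_apply _ _ _).trans (h.othersOp_sq h1).2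
  · have e1 := h.site_rest_site_rest h0 h1
    have e2 := h.site_rest_site_rest h1 h0
    simp only [weight_flipInput, Prod.fst_zero, Prod.snd_zero, weight_zero, add_zero, pow_zero,
      mul_one, one_smul, show 1 / 2 = 0 from rfl] at e1 e2
    rw [map_add, add_apply, site_mul_apply, site_mul_apply]
    refine (congrArg₂ (· + ·) e1 e2).trans ?_
    exact (add_comm _ _).trans (h.first_anticomm hm)

/-- The observables of the group act on the state like those for inputs of weight at most one. -/
theorem site_group (h : S.IsOptimal s ε) (hm : 1 ≤ m) (y : Fin m → Fin 2) :
    site S.purifier none (S.groupObs y - (-1 : ℂ) ^ (weight y / 2) •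
      if Even (weight y) then S.groupObs 0 else S.groupObs (Pi.single ⟨0, hm⟩ 1)) S.vec = 0 := by
  -- All three group observables are expressed by the same operator of the other honest parties and
  -- by E or F. Only the parity of |y| and the sign (−1)^⌊|y|/2⌋ can distinguish them.
  have hy := h.site_rest (supportedAt_group y)
  have h0 := h.site_rest (supportedAt_zero none)
  have h1 := h.site_rest (supportedAt_flipInput hm none)
  simp only [weight_flipInput, Prod.fst_zero, Prod.snd_zero, weight_zero, add_zero, zero_add,
    pow_zero, mul_one, show 1 / 2 = 0 from rfl] at hy h0 h1
  rw [map_sub, map_smul, sub_apply, smul_apply, sub_eq_zero]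
  refine hy.trans ?_
  rw [mul_comm, mul_smul]
  congr 1
  split_ifs with he
  · refine Eq.trans ?_ h0.symm
    rw [firstPart, firstPart, if_pos he, if_pos Even.zero]
  · refine Eq.trans ?_ h1.symm
    rw [firstPart, firstPart, if_neg he, if_neg (by decide)]

end IsOptimal

end Strategy

/-! ### Extraction of the GHZ state and of the Pauli observables -/

theorem localOp_apply_localOp {n : ℕ} {H R : Option (Fin n) → CHilb.{u}} {P : CHilb.{u}}
    {ψ : totalSpace H P} {L : ∀ o, Fin 2 → (H o →L[ℂ] R o)} {T : ∀ o, H o →L[ℂ] H o}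
    {τ τ' : Option (Fin n) → Fin 2} {c : Option (Fin n) → ℂ}
    (h : ∀ o, NullFor ψ o (L o (τ o) ∘L T o - c o • L o (τ' o))) :
    localOp P (fun o => L o (τ o)) (localOp P T ψ) =
      (∏ o, c o) • localOp P (fun o => L o (τ' o)) ψ := by
  rw [← ContinuousLinearMap.comp_apply, ← localOp_comp, localOp_congr h,
    MultilinearMap.map_smul_univ, smul_apply]

theorem nullFor_zero {n : ℕ} {H R : Option (Fin n) → CHilb.{u}} {P : CHilb.{u}}
    {ψ : totalSpace H P} {o : Option (Fin n)} {K : H o →L[ℂ] R o} (hK : K = 0) :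
    NullFor ψ o K := by
  intro W
  rw [hK, MultilinearMap.map_update_zero, zero_apply]

/-- The nonzero entries of `σ_x`, rotated about the `z`-axis by the phase `e`. -/
def phaseX (e : ℂ) (b : Fin 2) : ℂ := if b = 0 then star e else e

/-- The nonzero entries of `σ_y`, rotated about the `z`-axis by the phase `e`. -/
def phaseY (e : ℂ) (b : Fin 2) : ℂ := if b = 0 then -Complex.I * star e else Complex.I * e

/-- The angle by which the first party's observables are rotated. -/
def firstPhase (s ε : ℤˣ) : ℂ :=
  ((ε : ℤ) : ℂ) * ((1 / √2 : ℝ) : ℂ) * (1 + ((s : ℤ) : ℂ) * Complex.I)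

theorem star_firstPhase (s ε : ℤˣ) : star (firstPhase s ε) =
    ((ε : ℤ) : ℂ) * ((1 / √2 : ℝ) : ℂ) * (1 - ((s : ℤ) : ℂ) * Complex.I) := by
  rw [firstPhase, RCLike.star_def, map_mul, map_mul, Complex.conj_ofReal, map_add, map_mul,
    Complex.conj_I, map_one, map_intCast, map_intCast]
  ring

theorem star_firstPhase_mul (s ε : ℤˣ) : star (firstPhase s ε) * firstPhase s ε = 1 := by
  rw [star_firstPhase, firstPhase]
  have hs := intUnit_cast_sq s
  have hε := intUnit_cast_sq ε
  have hr := invSqrtTwo_mul_self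
  set r := ((1 / √2 : ℝ) : ℂ)
  linear_combination (-(((ε : ℤ) : ℂ) * r * ((s : ℤ) : ℂ)) ^ 2) * Complex.I_sq +
    (((ε : ℤ) : ℂ) * r) ^ 2 * hs + 2 * r ^ 2 * hε + 2 * hr

/-- The phase ε(1 + si)/√2 is chosen so that E becomes εσ_x. -/
theorem firstPhase_even (s ε : ℤˣ) (b : Fin 2) :
    ((1 / √2 : ℝ) : ℂ) * (phaseX (firstPhase s ε) b - ((s : ℤ) : ℂ) * phaseY (firstPhase s ε) b) =
      ((ε : ℤ) : ℂ) := by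
  have hs := intUnit_cast_sq s
  have hr := invSqrtTwo_mul_self
  have hI := Complex.I_sq
  fin_cases b <;> simp [-one_div, -Complex.ofReal_div, phaseX, phaseY, -RCLike.star_def, firstPhase] <;>
    set r := ((1 / √2 : ℝ) : ℂ)
  · linear_combination (-(((ε : ℤ) : ℂ) * r * r * ((s : ℤ) : ℂ) * ((s : ℤ) : ℂ))) * hI +
      ((ε : ℤ) : ℂ) * r * r * hs + 2 * ((ε : ℤ) : ℂ) * hr
  · linear_combination (-(((ε : ℤ) : ℂ) * r * r * ((s : ℤ) : ℂ) * ((s : ℤ) : ℂ))) * hI +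
      ((ε : ℤ) : ℂ) * r * r * hs + 2 * ((ε : ℤ) : ℂ) * hr

/-- With the same phase, F becomes −εσ_y. -/
theorem firstPhase_odd (s ε : ℤˣ) (b : Fin 2) :
    -((1 / √2 : ℝ) : ℂ) * (((s : ℤ) : ℂ) * phaseX (firstPhase s ε) b + phaseY (firstPhase s ε) b) =
      -((ε : ℤ) : ℂ) * phaseY 1 b := by
  have hs := intUnit_cast_sq s
  have hr := invSqrtTwo_mul_self
  have hI := Complex.I_sq
  fin_cases b <;> simp [-one_div, -Complex.ofReal_div, phaseX, phaseY, -RCLike.star_def, firstPhase] <;>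
    set r := ((1 / √2 : ℝ) : ℂ)
  · linear_combination (-(((ε : ℤ) : ℂ) * r * r * ((s : ℤ) : ℂ))) * hI +
      ((ε : ℤ) : ℂ) * r * r * Complex.I * hs + 2 * ((ε : ℤ) : ℂ) * Complex.I * hr
  · linear_combination (((ε : ℤ) : ℂ) * r * r * ((s : ℤ) : ℂ)) * hI +
      ((ε : ℤ) : ℂ) * r * r * Complex.I * hs + 2 * ((ε : ℤ) : ℂ) * Complex.I * hr

section Antidiagonal

variable {E : Type*} [AddCommGroup E] [Module ℂ E] (v : Fin 2 → E)

theorem sum_smul_pauliX (c : ℂ) (b : Fin 2) :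
    ∑ d, (c • pauliX) b d • v d = (c * phaseX 1 b) • v b.rev := by
  match b with
  | 0 => simp [pauliX, phaseX, Fin.sum_univ_two, show Fin.rev (0 : Fin 2) = 1 from rfl]
  | 1 => simp [pauliX, phaseX, Fin.sum_univ_two, show Fin.rev (1 : Fin 2) = 0 from rfl]

theorem sum_smul_pauliY (c : ℂ) (b : Fin 2) :
    ∑ d, (c • pauliY) b d • v d = (c * phaseY 1 b) • v b.rev := by
  match b with
  | 0 => simp [pauliY, phaseY, Fin.sum_univ_two, show Fin.rev (0 : Fin 2) = 1 from rfl]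
  | 1 => simp [pauliY, phaseY, Fin.sum_univ_two, show Fin.rev (1 : Fin 2) = 0 from rfl]

theorem sum_smul_antidiag (A : Matrix (Fin 2) (Fin 2) ℂ) (c : ℂ) (b : Fin 2) (h0 : A b b = 0)
    (h1 : A b b.rev = c) : ∑ d, A b d • v d = c • v b.rev := by
  match b with
  | 0 =>
    have h1' : A 0 1 = c := h1
    rw [Fin.sum_univ_two, h0, h1', zero_smul, zero_add]; rfl
  | 1 =>
    have h1' : A 1 0 = c := h1
    rw [Fin.sum_univ_two, h0, h1', zero_smul, add_zero]; rfl

end Antidiagonal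

namespace Strategy

variable {n m : ℕ} (S : Strategy.{u} (n + 1) m)

/-- The operators of the parties that are mapped to `σ_x`, up to a rotation for the first party. -/
def opX : ∀ o, S.space o →L[ℂ] S.space o
  | none => S.groupObs 0
  | some i => S.honestObs i 0

/-- The operators of the parties that are mapped to `σ_y`, up to a rotation for the first party. -/
def opY (hm : 1 ≤ m) : ∀ o, S.space o →L[ℂ] S.space o
  | none => S.groupObs (Pi.single ⟨0, hm⟩ 1)
  | some i => S.honestObs i 1

/-- The phase of the rotation of the observables of a party. -/
def partyPhase (s ε : ℤˣ) (o : Option (Fin (n + 1))) : ℂ :=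
  if o = some 0 then firstPhase s ε else 1

theorem star_partyPhase_mul (s ε : ℤˣ) (o : Option (Fin (n + 1))) :
    star (partyPhase s ε o) * partyPhase s ε o = 1 := by
  rw [partyPhase]
  split_ifs
  · exact star_firstPhase_mul s ε
  · simp

theorem sum_ghzHonest_zero {E : Type*} [AddCommGroup E] [Module ℂ E] (v : Fin 2 → E) (s ε : ℤˣ)
    (i : Fin (n + 1)) (b : Fin 2) :
    ∑ d, ghzHonest s ε i 0 b d • v d = phaseX (partyPhase s ε (some i)) b • v b.rev := by
  have hi : (some i : Option (Fin (n + 1))) = some 0 ↔ (i : ℕ) = 0 := by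
    rw [Option.some_inj, Fin.ext_iff, Fin.val_zero]
  rw [partyPhase, ghzHonest]
  by_cases h : (i : ℕ) = 0
  · rw [if_pos h, if_pos (hi.2 h), if_pos rfl]
    refine sum_smul_antidiag v _ _ b ?_ ?_
    · fin_cases b <;> simp [pauliX, pauliY]
    · match b with
      | 0 =>
        rw [phaseX, if_pos rfl, star_firstPhase, show Fin.rev (0 : Fin 2) = 1 from rfl]
        simp [pauliX, pauliY, -mul_eq_mul_right_iff]; ring
      | 1 =>
        rw [phaseX, if_neg (by decide), firstPhase, show Fin.rev (1 : Fin 2) = 0 from rfl]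
        simp [pauliX, pauliY, -mul_eq_mul_right_iff]; ring
  · rw [if_neg h, if_neg (hi.not.2 h), if_pos rfl]
    simpa using sum_smul_pauliX v 1 b

theorem sum_ghzHonest_one {E : Type*} [AddCommGroup E] [Module ℂ E] (v : Fin 2 → E) (s ε : ℤˣ)
    (i : Fin (n + 1)) (b : Fin 2) :
    ∑ d, ghzHonest s ε i 1 b d • v d = phaseY (partyPhase s ε (some i)) b • v b.rev := by
  have hi : (some i : Option (Fin (n + 1))) = some 0 ↔ (i : ℕ) = 0 := by
    rw [Option.some_inj, Fin.ext_iff, Fin.val_zero]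
  rw [partyPhase, ghzHonest]
  by_cases h : (i : ℕ) = 0
  · rw [if_pos h, if_pos (hi.2 h), if_neg (by decide)]
    refine sum_smul_antidiag v _ _ b ?_ ?_
    · fin_cases b <;> simp [pauliX, pauliY]
    · match b with
      | 0 =>
        rw [phaseY, if_pos rfl, star_firstPhase, show Fin.rev (0 : Fin 2) = 1 from rfl]
        simp [pauliX, pauliY]
        linear_combination (-((ε : ℤ) : ℂ) * ((√2 : ℝ) : ℂ)⁻¹ * ((s : ℤ) : ℂ)) * Complex.I_sq
      | 1 =>
        rw [phaseY, if_neg (by decide), firstPhase, show Fin.rev (1 : Fin 2) = 0 from rfl]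
        simp [pauliX, pauliY]
        linear_combination (-((ε : ℤ) : ℂ) * ((√2 : ℝ) : ℂ)⁻¹ * ((s : ℤ) : ℂ)) * Complex.I_sq
  · rw [if_neg h, if_neg (hi.not.2 h), if_neg (by decide)]
    simpa using sum_smul_pauliY v 1 b

variable {S} {s ε : ℤˣ}

theorem exists_restParty {o : Option (Fin (n + 1))} (h : o ≠ some 0) : ∃ o', restParty o' = o := by
  match o with
  | none => exact ⟨none, rfl⟩
  | some i =>
    obtain ⟨j, rfl⟩ := Fin.exists_succ_eq.2 (fun hi => h (congrArg some hi))
    exact ⟨some j, rfl⟩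

theorem IsOptimal.anticommutingOn (h : S.IsOptimal s ε) (hm : 1 ≤ m) (o : Option (Fin (n + 1))) :
    AnticommutingOn S.vec o (S.opX o) (S.opY hm o) := by
  by_cases ho : o = some 0
  · subst ho; exact h.anticommutingOn_first hm
  · obtain ⟨o, rfl⟩ := exists_restParty ho
    have h1 := h.anticommutingOn_rest hm o
    match o with
    | none => exact h1
    | some i =>
      have h2 : S.obs (Fin.cons 0 (flipInput hm (some i)).1) (flipInput hm (some i)).2
          (restParty (some i)) = S.opY hm (restParty (some i)) := by
        simp only [obs, flipInput, Fin.cons_succ, Pi.single_eq_same]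
        rfl
      rw [h2] at h1
      exact h1

theorem isSelfAdjoint_opX (o : Option (Fin (n + 1))) : IsSelfAdjoint (S.opX o) := by
  cases o <;> exact S.isSelfAdjoint_obs 0 0 _

theorem norm_opX_le_one (o : Option (Fin (n + 1))) : ‖S.opX o‖ ≤ 1 := by
  cases o <;> exact S.norm_obs_le_one 0 0 _

theorem isSelfAdjoint_opY (hm : 1 ≤ m) (o : Option (Fin (n + 1))) :
    IsSelfAdjoint (S.opY hm o) := by
  cases o <;> exact S.isSelfAdjoint_obs 1 (Pi.single ⟨0, hm⟩ 1) _

theorem norm_opY_le_one (hm : 1 ≤ m) (o : Option (Fin (n + 1))) : ‖S.opY hm o‖ ≤ 1 := by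
  cases o <;> exact S.norm_obs_le_one 1 (Pi.single ⟨0, hm⟩ 1) _

variable (S) in
/-- Local maps under which the operators `opX` and `opY` act on the state like rotated Pauli
matrices. -/
structure IsSwap (s ε : ℤˣ) (hm : 1 ≤ m) {R : Option (Fin (n + 1)) → CHilb.{u}}
    (L : ∀ o, Fin 2 → (S.space o →L[ℂ] R o)) : Prop where
  norm_sq : ∀ o φ, ‖L o 0 φ‖ ^ 2 + ‖L o 1 φ‖ ^ 2 = ‖φ‖ ^ 2
  comp_opX : ∀ o b, NullFor S.vec o
    (L o b ∘L S.opX o - phaseX (partyPhase s ε o) b • L o b.rev)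
  comp_opY : ∀ o b, NullFor S.vec o
    (L o b ∘L S.opY hm o - phaseY (partyPhase s ε o) b • L o b.rev)

theorem IsOptimal.exists_isSwap (h : S.IsOptimal s ε) (hm : 1 ≤ m) :
    ∃ (R : Option (Fin (n + 1)) → CHilb.{u}) (L : ∀ o, Fin 2 → (S.space o →L[ℂ] R o)),
      S.IsSwap s ε hm L := by
  have key (o) := exists_swapMaps (isSelfAdjoint_opX o) (norm_opX_le_one o)
    (isSelfAdjoint_opY hm o) (norm_opY_le_one hm o) (h.anticommutingOn hm o).left_sq
    (h.anticommutingOn hm o).right_sq (h.anticommutingOn hm o).anticomm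
    (h.anticommutingOn hm o).stable (star_partyPhase_mul s ε o)
  choose L h0 h1 h2 h3 h4 using key
  refine ⟨fun o => pairSpace (S.space o), L, h0, fun o b => ?_, fun o b => ?_⟩
  · match b with
    | 0 => exact h1 o
    | 1 => exact h2 o
  · match b with
    | 0 => exact h3 o
    | 1 => exact h4 o

namespace IsSwap

variable {hm : 1 ≤ m} {R : Option (Fin (n + 1)) → CHilb.{u}}
  {L : ∀ o, Fin 2 → (S.space o →L[ℂ] R o)}

theorem comp_firstPart_even (hL : S.IsSwap s ε hm L) (b : Fin 2) :
    NullFor S.vec (some 0)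
      (L (some 0) b ∘L S.firstPart s 0 - ((ε : ℤ) : ℂ) • L (some 0) b.rev) := by
  have hx := hL.comp_opX (some 0) b
  have hy := hL.comp_opY (some 0) b
  rw [partyPhase, if_pos rfl] at hx hy
  convert (hx.add (hy.smul (-((s : ℤ) : ℂ)))).smul ((1 / √2 : ℝ) : ℂ) using 1
  rw [← firstPhase_even s ε b, firstPart, if_pos Even.zero]
  simp only [ContinuousLinearMap.comp_smul, ContinuousLinearMap.comp_sub, opX, opY]
  module

theorem comp_firstPart_odd (hL : S.IsSwap s ε hm L) (b : Fin 2) :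
    NullFor S.vec (some 0)
      (L (some 0) b ∘L S.firstPart s 1 - (-((ε : ℤ) : ℂ) * phaseY 1 b) • L (some 0) b.rev) := by
  have hx := hL.comp_opX (some 0) b
  have hy := hL.comp_opY (some 0) b
  rw [partyPhase, if_pos rfl] at hx hy
  convert ((hx.smul ((s : ℤ) : ℂ)).add hy).smul (-((1 / √2 : ℝ) : ℂ)) using 1
  rw [← firstPhase_odd s ε b, firstPart, if_neg (by decide)]
  simp only [ContinuousLinearMap.comp_smul, ContinuousLinearMap.comp_add, opX, opY]
  module

theorem localOp_site_first {k : S.space (some 0) →L[ℂ] S.space (some 0)} {c : ℂ}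
    {τ : Option (Fin (n + 1)) → Fin 2}
    (hk : NullFor S.vec (some 0)
      (L (some 0) (τ (some 0)) ∘L k - c • L (some 0) (τ (some 0)).rev)) :
    localOp S.purifier (fun o => L o (τ o)) (site S.purifier (some 0) k S.vec) =
      c • localOp S.purifier
        (fun o => L o (Function.update τ (some 0) (τ (some 0)).rev o)) S.vec := by
  rw [site_apply, localOp_apply_localOp (c := Function.update 1 (some 0) c)
    (τ' := Function.update τ (some 0) (τ (some 0)).rev)]
  · rw [Finset.prod_update_of_mem (Finset.mem_univ _)]
    simp
  · intro o
    by_cases ho : o = some 0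
    · subst ho
      simpa using hk
    · apply nullFor_zero
      simp [Function.update_of_ne ho]

/-- Flipping all bits but that of the first party. -/
def revRest (τ : Option (Fin (n + 1)) → Fin 2) : Option (Fin (n + 1)) → Fin 2 :=
  Function.update (fun o => (τ o).rev) (some 0) (τ (some 0))

theorem localOp_restOp_zero (hL : S.IsSwap s ε hm L) (τ : Option (Fin (n + 1)) → Fin 2) :
    localOp S.purifier (fun o => L o (τ o)) (S.restOp 0 S.vec) =
      localOp S.purifier (fun o => L o (revRest τ o)) S.vec := by
  rw [restOp, localOp_apply_localOp (c := 1) (τ' := revRest τ)]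
  · simp
  · intro o
    by_cases ho : o = some 0
    · subst ho
      apply nullFor_zero
      simp [revRest]
    · have h1 := hL.comp_opX o (τ o)
      rw [partyPhase, if_neg ho] at h1
      have hX : phaseX 1 (τ o) = 1 := by simp [phaseX]
      rw [hX] at h1
      rw [Function.update_of_ne ho, revRest, Function.update_of_ne ho]
      obtain ⟨o, rfl⟩ := exists_restParty ho
      cases o <;> exact h1

theorem localOp_restOp_flip (hL : S.IsSwap s ε hm L) (o : Option (Fin n))
    (τ : Option (Fin (n + 1)) → Fin 2) :
    localOp S.purifier (fun o => L o (τ o)) (S.restOp (flipInput hm o) S.vec) =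
      phaseY 1 (τ (restParty o)) • localOp S.purifier (fun o => L o (revRest τ o)) S.vec := by
  rw [restOp, localOp_apply_localOp (τ' := revRest τ)
    (c := Function.update 1 (restParty o) (phaseY 1 (τ (restParty o))))]
  · rw [Finset.prod_update_of_mem (Finset.mem_univ _)]
    simp
  · intro o'
    by_cases ho : o' = some 0
    · subst ho
      apply nullFor_zero
      simp [revRest, Function.update_of_ne (restParty_ne o).symm]
    · rw [Function.update_of_ne ho, revRest, Function.update_of_ne ho]
      by_cases ho' : o' = restParty o
      · subst ho'
        have h1 := hL.comp_opY (restParty o) (τ (restParty o))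
        rw [partyPhase, if_neg ho] at h1
        rw [Function.update_self]
        match o with
        | none => exact h1
        | some i =>
          have h2 : S.obs (Fin.cons 0 (flipInput hm (some i)).1) (flipInput hm (some i)).2
              (restParty (some i)) = S.opY hm (restParty (some i)) := by
            simp only [obs, flipInput, Fin.cons_succ, Pi.single_eq_same]
            rfl
          rw [h2]
          exact h1
      · have h1 := hL.comp_opX o' (τ o')
        rw [partyPhase, if_neg ho] at h1
        have hX : phaseX 1 (τ o') = 1 := by simp [phaseX]
        rw [hX] at h1
        obtain ⟨o', rfl⟩ := exists_restParty ho
        rw [Function.update_of_ne ho', supportedAt_flipInput hm o o' (fun h => ho' (h ▸ rfl))]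
        cases o' <;> exact h1

/-- Apply the local maps to O₀ψ = εEψ. The left side flips all bits but the first, the right side
flips the first, and the two factors ε cancel. -/
theorem localOp_rev (hL : S.IsSwap s ε hm L) (h : S.IsOptimal s ε)
    (τ : Option (Fin (n + 1)) → Fin 2) :
    localOp S.purifier (fun o => L o (τ o).rev) S.vec =
      localOp S.purifier (fun o => L o (τ o)) S.vec := by
  set τ' := Function.update τ (some 0) (τ (some 0)).rev with hτ'
  have h1 := hL.localOp_restOp_zero τ'
  rw [h.restOp_zero, map_smul, localOp_site_first (hL.comp_firstPart_even _), smul_smul,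
    intUnit_cast_sq, one_smul] at h1
  have e1 : revRest τ' = fun o => (τ o).rev := by
    ext1 o
    by_cases ho : o = some 0
    · subst ho; simp [revRest, hτ']
    · simp [revRest, hτ', Function.update_of_ne ho]
  have e2 : Function.update τ' (some 0) (τ' (some 0)).rev = τ := by
    rw [hτ', Function.update_idem, Function.update_self, Fin.rev_rev, Function.update_eq_self]
  rw [e1, e2] at h1
  exact h1.symm

/-- Give input one to party `o` alone. Both sides then carry a σ_y phase, of bit `o` on the left
and, with a minus sign, of the first bit on the right. Where these bits agree before the flip, the
amplitude equals its own negative. -/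
theorem localOp_eq_zero (hL : S.IsSwap s ε hm L) (h : S.IsOptimal s ε)
    {τ : Option (Fin (n + 1)) → Fin 2} {o : Option (Fin n)}
    (hτ : τ (restParty o) ≠ τ (some 0)) :
    localOp S.purifier (fun o => L o (τ o)) S.vec = 0 := by
  -- Flipping the first bit makes it equal to bit `o`, so the two phases are the same.
  set τ' := Function.update τ (some 0) (τ (some 0)).rev with hτ'
  have h1 := hL.localOp_restOp_flip o τ'
  rw [h.restOp_flip hm, map_smul, localOp_site_first (hL.comp_firstPart_odd _), smul_smul] at h1
  have e1 : revRest τ' = fun o => (τ o).rev := by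
    ext1 o
    by_cases ho : o = some 0
    · subst ho; simp [revRest, hτ']
    · simp [revRest, hτ', Function.update_of_ne ho]
  have e2 : Function.update τ' (some 0) (τ' (some 0)).rev = τ := by
    rw [hτ', Function.update_idem, Function.update_self, Fin.rev_rev, Function.update_eq_self]
  have e3 : τ' (restParty o) = τ' (some 0) := by
    rw [hτ', Function.update_self, Function.update_of_ne (restParty_ne o)]
    generalize τ (restParty o) = b at hτ ⊢
    generalize τ (some 0) = c at hτ ⊢
    revert hτ
    revert b c
    decide
  rw [e1, e2, e3, hL.localOp_rev h τ] at h1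
  have h2 : phaseY 1 (τ' (some 0)) ≠ 0 := by
    rw [phaseY]; split_ifs <;> simp
  have h3 : ((ε : ℤ) : ℂ) * (-((ε : ℤ) : ℂ) * phaseY 1 (τ' (some 0))) =
      - phaseY 1 (τ' (some 0)) := by
    linear_combination (-phaseY 1 (τ' (some 0))) * intUnit_cast_sq ε
  rw [h3, neg_smul, neg_eq_iff_add_eq_zero, ← two_smul ℂ, smul_smul] at h1
  exact (smul_eq_zero.1 h1).resolve_left (mul_ne_zero two_ne_zero h2)

theorem target_ghz (hL : S.IsSwap s ε hm L) (h : S.IsOptimal s ε) (x : Fin (n + 1) → Fin 2)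
    (y : Fin m → Fin 2) (o : Option (Fin (n + 1))) (b : Fin 2) :
    NullFor S.vec o (L o b ∘L S.obs x y o -
      ∑ c, target (ghzHonest s ε) ghzGroup x y o b c • L o c) := by
  have hx := hL.comp_opX o b
  have hy := hL.comp_opY o b
  match o with
  | none =>
    -- An arbitrary group observable is first replaced by one of the two used for the swap map.
    have hk := nullFor_comp (h.site_group hm y) (L none b)
    rw [partyPhase, if_neg (by simp)] at hx hy
    by_cases he : Even (weight y)
    · rw [if_pos he] at hk
      rw [show target (ghzHonest s ε) ghzGroup x y none = ghzGroup y from rfl, ghzGroup, if_pos he,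
        sum_smul_pauliX]
      convert hk.add (hx.smul ((-1) ^ (weight y / 2))) using 1
      rw [ContinuousLinearMap.comp_sub, ContinuousLinearMap.comp_smul]
      simp only [obs, opX]
      module
    · rw [if_neg he] at hk
      rw [show target (ghzHonest s ε) ghzGroup x y none = ghzGroup y from rfl, ghzGroup, if_neg he,
        sum_smul_pauliY]
      convert hk.add (hy.smul ((-1) ^ (weight y / 2))) using 1
      rw [ContinuousLinearMap.comp_sub, ContinuousLinearMap.comp_smul]
      simp only [obs, opY]
      module
  | some i =>
    rw [show target (ghzHonest s ε) (ghzGroup (m := m)) x y (some i) = ghzHonest s ε i (x i)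
      from rfl, show S.obs x y (some i) = S.honestObs i (x i) from rfl]
    generalize x i = xi
    match xi with
    | 0 =>
      rw [sum_ghzHonest_zero]
      exact hx
    | 1 =>
      rw [sum_ghzHonest_one]
      exact hy

end IsSwap

/-- A strategy that attains the maximum self-tests the GHZ state. -/
theorem IsOptimal.hasLocalSelfTest_ghz (h : S.IsOptimal s ε) (hm : 1 ≤ m) :
    S.HasLocalSelfTest (ghzState (n + 2)) (ghzHonest s ε) ghzGroup := by
  obtain ⟨R, L, hL⟩ := h.exists_isSwap hm
  -- The all-zero amplitude must be ζ/√2, which fixes ζ.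
  refine ⟨R, L, ((√2 : ℝ) : ℂ) • localOp S.purifier (fun o => L o 0) S.vec, hL.norm_sq,
    fun τ => ?_, hL.target_ghz h⟩
  have hr : ((1 / √2 : ℝ) : ℂ) * ((√2 : ℝ) : ℂ) = 1 := by
    rw [← Complex.ofReal_mul, one_div, inv_mul_cancel₀ (by positivity), Complex.ofReal_one]
  rw [ghzState]
  split_ifs with hτ
  · rw [smul_smul, hr, one_smul]
    rcases hτ with hτ | hτ
    · simp only [hτ]
    · simp only [hτ]
      exact hL.localOp_rev h fun _ => 0
  · rw [zero_smul]
    obtain ⟨o, ho⟩ : ∃ o, τ (slot (n + 1) (restParty o)) ≠ τ (slot (n + 1) (some 0)) := by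
      by_contra! hcon
      have hall (j) : τ j = τ (slot (n + 1) (some 0)) := by
        obtain ⟨o, rfl⟩ := (slot (n + 1)).surjective j
        by_cases ho : o = some 0
        · rw [ho]
        · obtain ⟨o, rfl⟩ := exists_restParty ho
          exact hcon o
      generalize τ (slot (n + 1) (some 0)) = b at hall
      match b with
      | 0 => exact hτ (Or.inl hall)
      | 1 => exact hτ (Or.inr hall)
    exact hL.localOp_eq_zero h (τ := fun o => τ (slot (n + 1) o)) ho

end Strategy

/-! ### From the GHZ state to the fully connected graph state -/

/-- Both sides change sign when w increases by 2, so the values at 0 and 1 decide. This writes the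
graph state's amplitudes as sums of two product amplitudes. -/
theorem neg_one_pow_choose_two {t : ℂ} (ht : t * t = -1) (w : ℕ) :
    (1 / 2 : ℂ) * ((1 - t) * t ^ w + (1 + t) * (-t) ^ w) = (-1) ^ w.choose 2 := by
  induction w using Nat.twoStepInduction with
  | zero => norm_num
  | one =>
    rw [Nat.choose_eq_zero_of_lt (by norm_num)]
    linear_combination -ht
  | more w ih _ =>
    have hc : (w + 2).choose 2 = w.choose 2 + 2 * w + 1 := by
      rw [Nat.choose_succ_succ (w + 1) 1, Nat.choose_succ_succ w 1, Nat.choose_one_right,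
        Nat.choose_one_right]
      ring
    have hs : ((-1 : ℂ) ^ (w.choose 2 + 2 * w + 1)) = -(-1) ^ w.choose 2 := by
      rw [pow_succ, pow_add, pow_mul]; norm_num
    rw [hc, hs, ← ih]
    linear_combination (1 / 2 : ℂ) * ((1 - t) * t ^ w + (1 + t) * (-t) ^ w) * ht

theorem sum_mul_ghzState {k : ℕ} (hk : 0 < k) (f : (Fin k → Fin 2) → ℂ) :
    ∑ σ, f σ * ghzState k σ = (f 0 + f 1) * ((1 / √2 : ℝ) : ℂ) := by
  have hne : (0 : Fin k → Fin 2) ≠ 1 := fun h => by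
    have := congrFun h ⟨0, hk⟩
    simp at this
  have h (σ) : f σ * ghzState k σ = (if σ = 0 then f 0 * ((1 / √2 : ℝ) : ℂ) else 0) +
      (if σ = 1 then f 1 * ((1 / √2 : ℝ) : ℂ) else 0) := by
    by_cases h0 : σ = 0
    · subst h0
      rw [if_pos rfl, if_neg hne, add_zero, ghzState, if_pos (Or.inl fun j => Pi.zero_apply j)]
    by_cases h1 : σ = 1
    · subst h1
      rw [if_pos rfl, if_neg h0, zero_add, ghzState, if_pos (Or.inr fun j => Pi.one_apply j)]
    rw [if_neg h0, if_neg h1, add_zero, ghzState, if_neg, mul_zero]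
    rintro (h | h)
    · exact h0 (funext h)
    · exact h1 (funext h)
  simp only [h, Finset.sum_add_distrib, Finset.sum_ite_eq', Finset.mem_univ, if_true]
  ring

/-- The change of basis that maps `σ_x`, `σ_y` to `σ_z`, `± σ_x`, for `t = ± i`, after the
rotation `diag(d, d')`. -/
def basisChange (t d d' : ℂ) : Matrix (Fin 2) (Fin 2) ℂ :=
  ((1 / √2 : ℝ) : ℂ) • !![d, d'; d * t, d' * -t]

theorem basisChange_unitary {t d d' : ℂ} (ht : star t * t = 1) (hd : star d * d = 1)
    (hd' : star d' * d' = 1) :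
    (basisChange t d d').conjTranspose * basisChange t d d' = 1 := by
  have hr := invSqrtTwo_mul_self
  simp only [RCLike.star_def] at ht hd hd'
  rw [basisChange, Matrix.conjTranspose_smul, RCLike.star_def, Complex.conj_ofReal,
    Matrix.smul_mul, Matrix.mul_smul, smul_smul, hr]
  ext i j
  fin_cases i <;> fin_cases j <;>
    simp [Matrix.mul_apply, Fin.sum_univ_two]
  · linear_combination (1 / 2 : ℂ) * (2 * hd + (starRingEnd ℂ) d * d * ht)
  · linear_combination -(starRingEnd ℂ) d * d' * ht
  · linear_combination -(starRingEnd ℂ) d' * d * ht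
  · linear_combination (1 / 2 : ℂ) * (2 * hd' + (starRingEnd ℂ) d' * d' * ht)

theorem basisChange_apply_zero (t d d' : ℂ) (b : Fin 2) :
    basisChange t d d' b 0 = d * (((1 / √2 : ℝ) : ℂ) * t ^ (b : ℕ)) := by
  fin_cases b <;> simp [basisChange] <;> ring

theorem basisChange_apply_one (t d d' : ℂ) (b : Fin 2) :
    basisChange t d d' b 1 = d' * (((1 / √2 : ℝ) : ℂ) * (-t) ^ (b : ℕ)) := by
  fin_cases b <;> simp [basisChange] <;> ring

theorem pauliZ_mul_basisChange (t : ℂ) :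
    pauliZ * basisChange t 1 1 = basisChange t 1 1 * pauliX := by
  ext i j
  fin_cases i <;> fin_cases j <;>
    simp [basisChange, pauliX, pauliZ, Matrix.mul_apply, Fin.sum_univ_two]

theorem pauliX_mul_basisChange (s : ℤˣ) :
    (((s : ℤ) : ℂ) • pauliX) * basisChange (((s : ℤ) : ℂ) * Complex.I) 1 1 =
      basisChange (((s : ℤ) : ℂ) * Complex.I) 1 1 * pauliY := by
  have hs := intUnit_cast_sq s
  have hI := Complex.I_sq
  ext i j
  fin_cases i <;> fin_cases j <;>
    simp [-one_div, -Complex.ofReal_div, basisChange, pauliX, pauliY, Matrix.mul_apply,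
      Fin.sum_univ_two] <;>
    set r := ((1 / √2 : ℝ) : ℂ)
  · linear_combination (r * Complex.I) * hs
  · linear_combination (r * Complex.I) * hs
  · linear_combination (r * ((s : ℤ) : ℂ)) * hI
  · linear_combination (r * ((s : ℤ) : ℂ)) * hI

/-- The change of basis of the first party. -/
def firstBasisChange (s : ℤˣ) : Matrix (Fin 2) (Fin 2) ℂ :=
  basisChange (((s : ℤ) : ℂ) * Complex.I) (star (firstPhase s 1)) (firstPhase s 1)

theorem graphHonest_first_zero (s ε : ℤˣ) :
    ((((ε : ℤ) : ℝ) / √2 : ℝ) : ℂ) • (pauliX - pauliZ) * firstBasisChange s =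
      firstBasisChange s * (((((ε : ℤ) : ℝ) / √2 : ℝ) : ℂ) • (pauliX + ((s : ℤ) : ℂ) • pauliY)) := by
  rw [firstBasisChange, star_firstPhase, firstPhase, Matrix.smul_mul, Matrix.mul_smul]
  congr 1
  rcases Int.units_eq_one_or s with rfl | rfl
  all_goals
    ext i j
    fin_cases i <;> fin_cases j <;>
      simp [-one_div, -Complex.ofReal_div, basisChange, pauliX, pauliY, pauliZ, Matrix.mul_apply,
        Fin.sum_univ_two] <;>
      ring_nf <;> simp only [Complex.I_sq, Complex.I_pow_three] <;> ring

theorem graphHonest_first_one (s ε : ℤˣ) :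
    ((s : ℤ) : ℂ) • ((((ε : ℤ) : ℝ) / √2 : ℝ) : ℂ) • (-(pauliX + pauliZ)) * firstBasisChange s =
      firstBasisChange s * (((((ε : ℤ) : ℝ) / √2 : ℝ) : ℂ) • (pauliY - ((s : ℤ) : ℂ) • pauliX)) := by
  rw [smul_comm, firstBasisChange, star_firstPhase, firstPhase, Matrix.smul_mul, Matrix.mul_smul]
  congr 1
  rcases Int.units_eq_one_or s with rfl | rfl
  all_goals
    ext i j
    fin_cases i <;> fin_cases j <;>
      simp [-one_div, -Complex.ofReal_div, basisChange, pauliX, pauliY, pauliZ, Matrix.mul_apply,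
        Fin.sum_univ_two] <;>
      ring_nf <;> simp only [Complex.I_sq, Complex.I_pow_three] <;> ring

namespace Strategy

variable {n m : ℕ} {S : Strategy.{u} (n + 1) m} {s ε : ℤˣ}

/-- The local unitaries that map the GHZ state to the fully connected graph state. -/
def ghzToGraph (s : ℤˣ) (o : Option (Fin (n + 1))) : Matrix (Fin 2) (Fin 2) ℂ :=
  if o = some 0 then firstBasisChange s else basisChange (((s : ℤ) : ℂ) * Complex.I) 1 1

theorem star_intUnit_mul_I (s : ℤˣ) :
    star (((s : ℤ) : ℂ) * Complex.I) * (((s : ℤ) : ℂ) * Complex.I) = 1 := by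
  rw [RCLike.star_def, map_mul, Complex.conj_I, map_intCast]
  linear_combination -(((s : ℤ) : ℂ) * ((s : ℤ) : ℂ)) * Complex.I_sq + intUnit_cast_sq s

theorem ghzToGraph_unitary (s : ℤˣ) (o : Option (Fin (n + 1))) :
    (ghzToGraph s o).conjTranspose * ghzToGraph s o = 1 := by
  rw [ghzToGraph]
  split_ifs
  · refine basisChange_unitary (star_intUnit_mul_I s) ?_ (star_firstPhase_mul s 1)
    rw [star_star, mul_comm]
    exact star_firstPhase_mul s 1
  · exact basisChange_unitary (star_intUnit_mul_I s) (by simp) (by simp)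

/-- With t = si, the images of |0…0⟩ and |1…1⟩ have amplitudes proportional to (1 − t)t^w and (1 +
t)(−t)^w. The factors 1 ∓ t come from the first party's diagonal phases. -/
theorem graphState_eq (s : ℤˣ) (τ : Fin (n + 2) → Fin 2) :
    graphState (n + 2) τ = ∑ σ : Fin (n + 2) → Fin 2,
      (∏ o, ghzToGraph s o (τ (slot (n + 1) o)) (σ (slot (n + 1) o))) * ghzState (n + 2) σ := by
  rw [sum_mul_ghzState (by omega)]
  set t := ((s : ℤ) : ℂ) * Complex.I with ht
  have htt : t * t = -1 := by
    rw [ht]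
    linear_combination (((s : ℤ) : ℂ) * ((s : ℤ) : ℂ)) * Complex.I_sq - intUnit_cast_sq s
  have hw : ∑ o, ((τ (slot (n + 1) o) : Fin 2) : ℕ) = weight τ :=
    (slot (n + 1)).sum_comp fun j => ((τ j : Fin 2) : ℕ)
  have h0 (o) : ghzToGraph s o (τ (slot (n + 1) o)) 0 =
      (if o = some 0 then star (firstPhase s 1) else 1) *
        (((1 / √2 : ℝ) : ℂ) * t ^ ((τ (slot (n + 1) o) : Fin 2) : ℕ)) := by
    rw [ghzToGraph]
    split_ifs <;> exact basisChange_apply_zero _ _ _ _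
  have h1 (o) : ghzToGraph s o (τ (slot (n + 1) o)) 1 =
      (if o = some 0 then firstPhase s 1 else 1) *
        (((1 / √2 : ℝ) : ℂ) * (-t) ^ ((τ (slot (n + 1) o) : Fin 2) : ℕ)) := by
    rw [ghzToGraph]
    split_ifs <;> exact basisChange_apply_one _ _ _ _
  simp only [Pi.zero_apply, Pi.one_apply, h0, h1, Finset.prod_mul_distrib,
    Finset.prod_pow_eq_pow_sum, hw, Finset.prod_ite_eq', Finset.mem_univ, if_true,
    Finset.prod_const, Finset.card_univ, Fintype.card_option, Fintype.card_fin]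
  rw [graphState, ← neg_one_pow_choose_two htt, star_firstPhase, firstPhase, ← ht]
  have hr := invSqrtTwo_mul_self
  generalize ((1 / √2 : ℝ) : ℂ) = r at hr ⊢
  push_cast
  linear_combination -(r ^ (n + 2)) * ((1 - t) * t ^ weight τ + (1 + t) * (-t) ^ weight τ) * hr

/-- A strategy that attains the maximum self-tests the fully connected graph state. -/
theorem IsOptimal.hasLocalSelfTest_graph (h : S.IsOptimal s ε) (hm : 1 ≤ m) :
    S.HasLocalSelfTest (graphState (n + 2)) (graphHonest s ε) (graphGroup s) := by
  refine (h.hasLocalSelfTest_ghz hm).rotate (ghzToGraph s) (ghzToGraph_unitary s)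
    (graphState_eq s) (fun i x => ?_) fun y => ?_
  · have hi : (some i : Option (Fin (n + 1))) = some 0 ↔ (i : ℕ) = 0 := by
      rw [Option.some_inj, Fin.ext_iff, Fin.val_zero]
    rw [graphHonest, ghzHonest, ghzToGraph]
    by_cases h0 : (i : ℕ) = 0
    · rw [if_pos h0, if_pos h0, if_pos (hi.2 h0)]
      match x with
      | 0 =>
        rw [if_pos rfl, if_pos rfl, Fin.val_zero, pow_zero, one_smul]
        exact graphHonest_first_zero s ε
      | 1 =>
        rw [if_neg (by decide), if_neg (by decide), Fin.val_one, pow_one]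
        exact graphHonest_first_one s ε
    · rw [if_neg h0, if_neg h0, if_neg (hi.not.2 h0)]
      match x with
      | 0 =>
        rw [if_pos rfl, if_pos rfl, Fin.val_zero, pow_zero, one_smul]
        exact pauliZ_mul_basisChange _
      | 1 =>
        rw [if_neg (by decide), if_neg (by decide), Fin.val_one, pow_one]
        exact pauliX_mul_basisChange s
  · rw [graphGroup, ghzGroup, ghzToGraph, if_neg (Option.some_ne_none 0).symm, Matrix.mul_smul]
    have hs : ((s : ℤ) : ℂ) ^ 2 = 1 := by rw [pow_two, intUnit_cast_sq]
    by_cases he : Even (weight y)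
    · obtain ⟨j, hj⟩ := he.two_dvd
      have h1 : ((s : ℤ) : ℂ) ^ weight y = 1 := by rw [hj, pow_mul, hs, one_pow]
      rw [if_pos he, if_pos he, h1, one_mul, Matrix.smul_mul, pauliZ_mul_basisChange]
    · obtain ⟨j, hj⟩ := Nat.not_even_iff_odd.1 he
      have h1 : ((s : ℤ) : ℂ) ^ weight y = ((s : ℤ) : ℂ) := by
        rw [hj, pow_succ, pow_mul, hs, one_pow, one_mul]
      rw [if_neg he, if_neg he, ← pauliX_mul_basisChange, Matrix.smul_mul, Matrix.smul_mul,
        smul_smul, h1, mul_comm]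

end Strategy

/-! ### A strategy that attains the maximum -/

section Involutions

variable {H : CHilb.{u}} {O : Type} [Fintype O] [DecidableEq O]

/-- The operator is a self-adjoint idempotent, hence of the form X*X. -/
theorem isPositive_half_one_add {T : H →L[ℂ] H} (hT : star T = T) (hTT : T * T = 1) :
    ((1 / 2 : ℂ) • (1 + T)).IsPositive := by
  have h : (1 / 2 : ℂ) • (1 + T) = star ((1 / 2 : ℂ) • (1 + T)) * ((1 / 2 : ℂ) • (1 + T)) := by
    have hs : star ((1 / 2 : ℂ) • (1 + T)) = (1 / 2 : ℂ) • (1 + T) := by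
      simp [hT]
    rw [hs, smul_mul_smul_comm, mul_add, add_mul, add_mul, hTT]
    simp only [mul_one, one_mul]
    module
  rw [← ContinuousLinearMap.nonneg_iff_isPositive, h]
  exact star_mul_self_nonneg _

/-- The projective measurement of a self-adjoint unitary, with outcomes `o` for the eigenvalue `1`
and `o'` for the eigenvalue `-1`. -/
def POVM.ofInvolution (T : H →L[ℂ] H) (hT : star T = T) (hTT : T * T = 1) {o o' : O}
    (h : o ≠ o') : POVM H O where
  effect a := if a = o then (1 / 2 : ℂ) • (1 + T) else
    if a = o' then (1 / 2 : ℂ) • (1 + -T) else 0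
  effect_pos a := by
    split_ifs
    · exact isPositive_half_one_add hT hTT
    · exact isPositive_half_one_add (by rw [star_neg, hT]) (by rw [neg_mul_neg, hTT])
    · exact ContinuousLinearMap.isPositive_zero
  sum_effect := by
    rw [Finset.sum_eq_add o o' h (fun c _ hc => by rw [if_neg hc.1, if_neg hc.2])
      (by simp) (by simp), if_pos rfl, if_neg h.symm, if_pos rfl]
    module

theorem POVM.sum_smul_ofInvolution (T : H →L[ℂ] H) (hT : star T = T) (hTT : T * T = 1) {o o' : O}
    (h : o ≠ o') (f : O → ℂ) (ho : f o = 1) (ho' : f o' = -1) :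
    ∑ a, f a • (POVM.ofInvolution T hT hTT h).effect a = T := by
  simp only [POVM.ofInvolution]
  rw [Finset.sum_eq_add o o' h (fun c _ hc => by rw [if_neg hc.1, if_neg hc.2, smul_zero])
      (by simp) (by simp), if_pos rfl, if_neg h.symm, if_pos rfl, ho, ho']
  module

end Involutions

section Qubit

/-- The Hilbert space of one qubit, in an arbitrary universe. -/
def liftedQubit : CHilb.{u} := ⟨EuclideanSpace ℂ (ULift.{u} (Fin 2))⟩

/-- The computational basis. -/
def liftedKet (b : Fin 2) : liftedQubit.{u} :=
  (EuclideanSpace.single (ULift.up b) (1 : ℂ) : EuclideanSpace ℂ (ULift.{u} (Fin 2)))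

theorem inner_liftedKet (b c : Fin 2) :
    ⟪liftedKet.{u} b, liftedKet c⟫_ℂ = if b = c then 1 else 0 := by
  change ⟪(EuclideanSpace.single (ULift.up b) (1 : ℂ) : EuclideanSpace ℂ (ULift.{u} (Fin 2))),
    EuclideanSpace.single (ULift.up c) (1 : ℂ)⟫_ℂ = _
  rw [EuclideanSpace.inner_single_left]
  simp

/-- The self-adjoint operator with `|0⟩ ↦ c |1⟩` and `|1⟩ ↦ c̄ |0⟩`. -/
def phaseFlip (c : ℂ) : liftedQubit.{u} →L[ℂ] liftedQubit.{u} :=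
  Matrix.toEuclideanCLM (𝕜 := ℂ)
    ((!![0, star c; c, 0] : Matrix (Fin 2) (Fin 2) ℂ).submatrix Equiv.ulift.{u} Equiv.ulift.{u})

theorem star_phaseFlip (c : ℂ) : star (phaseFlip.{u} c) = phaseFlip c := by
  refine ((Matrix.toEuclideanCLM (𝕜 := ℂ) (n := ULift.{u} (Fin 2))).map_star' _).symm.trans ?_
  refine congrArg (Matrix.toEuclideanCLM (𝕜 := ℂ) (n := ULift.{u} (Fin 2))) ?_
  ext ⟨i⟩ ⟨j⟩
  fin_cases i <;> fin_cases j <;> simp [Matrix.star_apply]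

theorem phaseFlip_mul_self {c : ℂ} (hc : star c * c = 1) :
    phaseFlip.{u} c * phaseFlip c = 1 := by
  refine ((Matrix.toEuclideanCLM (𝕜 := ℂ) (n := ULift.{u} (Fin 2))).map_mul' _ _).symm.trans ?_
  refine Eq.trans (congrArg (Matrix.toEuclideanCLM (𝕜 := ℂ) (n := ULift.{u} (Fin 2))) ?_)
    (map_one _)
  rw [Matrix.submatrix_mul_equiv]
  have h : (!![0, star c; c, 0] : Matrix (Fin 2) (Fin 2) ℂ) * !![0, star c; c, 0] = 1 := by
    ext i j
    fin_cases i <;> fin_cases j <;> simp [Matrix.mul_apply, Fin.sum_univ_two] <;>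
      simpa [mul_comm] using hc
  rw [h, Matrix.submatrix_one_equiv]

theorem inner_phaseFlip (c : ℂ) (b b' : Fin 2) :
    ⟪liftedKet.{u} b, phaseFlip c (liftedKet b')⟫_ℂ =
      (!![0, star c; c, 0] : Matrix (Fin 2) (Fin 2) ℂ) b b' := by
  change ⟪(EuclideanSpace.single (ULift.up b) (1 : ℂ) : EuclideanSpace ℂ (ULift.{u} (Fin 2))),
    Matrix.toEuclideanCLM (𝕜 := ℂ) ((!![0, star c; c, 0] : Matrix (Fin 2) (Fin 2) ℂ).submatrix
      Equiv.ulift.{u} Equiv.ulift.{u}) (EuclideanSpace.single (ULift.up b') (1 : ℂ))⟫_ℂ = _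
  rw [EuclideanSpace.inner_single_left]
  simp [EuclideanSpace.single]

end Qubit

section GHZ

/-- The vector `|b⟩ ⊗ ⋯ ⊗ |b⟩ ⊗ |0⟩`. -/
def constVec (n : ℕ) (b : Fin 2) : totalSpace (n := n) (fun _ => liftedQubit.{u}) liftedQubit :=
  multiVec n (fun _ => liftedKet b) (tmulVec (liftedKet b) (liftedKet 0))

theorem inner_localOp_constVec (n : ℕ) (T : Option (Fin n) → (liftedQubit.{u} →L[ℂ] liftedQubit))
    (b b' : Fin 2) : ⟪constVec n b, localOp liftedQubit T (constVec n b')⟫_ℂ =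
      ∏ o, ⟪liftedKet b, T o (liftedKet b')⟫_ℂ := by
  rw [localOp_apply, constVec, constVec, multiOp_multiVec, opTensor_tmulVec, inner_multiVec,
    inner_tmulVec, Fintype.prod_option, ContinuousLinearMap.id_apply, inner_liftedKet, if_pos rfl,
    mul_one, mul_comm]

/-- The GHZ state. -/
def ghzVec (n : ℕ) : totalSpace (n := n) (fun _ => liftedQubit.{u}) liftedQubit :=
  ((1 / √2 : ℝ) : ℂ) • (constVec n 0 + constVec n 1)

theorem inner_localOp_ghzVec (n : ℕ) (T : Option (Fin n) → (liftedQubit.{u} →L[ℂ] liftedQubit)) :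
    ⟪ghzVec n, localOp liftedQubit T (ghzVec n)⟫_ℂ =
      (1 / 2 : ℂ) * ((∏ o, ⟪liftedKet 0, T o (liftedKet 0)⟫_ℂ) +
        (∏ o, ⟪liftedKet 1, T o (liftedKet 0)⟫_ℂ) + (∏ o, ⟪liftedKet 0, T o (liftedKet 1)⟫_ℂ) +
        ∏ o, ⟪liftedKet 1, T o (liftedKet 1)⟫_ℂ) := by
  rw [ghzVec, map_smul, map_add, inner_smul_left, inner_smul_right, inner_add_left,
    inner_add_right, inner_add_right, inner_localOp_constVec, inner_localOp_constVec,
    inner_localOp_constVec, inner_localOp_constVec, Complex.conj_ofReal, ← mul_assoc,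
    invSqrtTwo_mul_self]
  ring

theorem norm_ghzVec (n : ℕ) : ‖ghzVec.{u} n‖ = 1 := by
  have h := inner_localOp_ghzVec.{u} n (fun _ => ContinuousLinearMap.id ℂ _)
  rw [localOp_id] at h
  simp only [ContinuousLinearMap.id_apply, inner_liftedKet] at h
  rw [inner_self_eq_norm_sq_to_K] at h
  have h2 : ((‖ghzVec.{u} n‖ ^ 2 : ℝ) : ℂ) = ((1 : ℝ) : ℂ) := by
    push_cast
    refine h.trans ?_
    norm_num
  have h3 : ‖ghzVec.{u} n‖ ^ 2 = 1 := Complex.ofReal_injective h2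
  nlinarith [norm_nonneg (ghzVec.{u} n)]

/-- Antidiagonal factors exchange |0…0⟩ and |1…1⟩, so only the two cross terms survive; they are
complex conjugates of each other. The group guarantees that the diagonal products are not empty. -/
theorem inner_phaseFlip_ghzVec (n : ℕ) (c : Option (Fin n) → ℂ) :
    ⟪ghzVec.{u} n, localOp liftedQubit (fun o => phaseFlip (c o)) (ghzVec n)⟫_ℂ =
      ((∏ o, c o).re : ℂ) := by
  have h0 : ∏ _o : Option (Fin n), (0 : ℂ) = 0 :=
    Finset.prod_eq_zero (Finset.mem_univ none) rfl
  rw [inner_localOp_ghzVec]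
  simp only [inner_phaseFlip, Matrix.of_apply, Matrix.cons_val', Matrix.cons_val_zero,
    Matrix.cons_val_one, Matrix.cons_val_fin_one, h0]
  rw [Complex.re_eq_add_conj, map_prod]
  simp only [RCLike.star_def]
  ring

end GHZ

section Attained

variable {n m : ℕ}

/-- The angles of the observables of the honest parties, for the strategy that attains the
maximum. -/
def honestAngle (s : ℤˣ) (i : Fin (n + 1)) (x : Fin 2) : ℂ :=
  (if i = 0 then firstPhase s 1 else 1) * Complex.I ^ (x : ℕ)

theorem star_I_pow_mul (w : ℕ) : star (Complex.I ^ w) * Complex.I ^ w = 1 := by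
  rw [star_pow, ← mul_pow, RCLike.star_def, Complex.conj_I, neg_mul, Complex.I_mul_I, neg_neg,
    one_pow]

theorem star_honestAngle_mul (s : ℤˣ) (i : Fin (n + 1)) (x : Fin 2) :
    star (honestAngle s i x) * honestAngle s i x = 1 := by
  rw [honestAngle, star_mul', mul_mul_mul_comm, star_I_pow_mul, mul_one]
  split_ifs
  · exact star_firstPhase_mul s 1
  · simp

/-- These two strings, one of each parity, serve as the outcomes of the group's two-valued
measurement. -/
theorem zero_ne_single (hm : 1 ≤ m) : (0 : Fin m → Fin 2) ≠ Pi.single ⟨0, hm⟩ 1 := fun h => by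
  have := congrArg weight h
  rw [Strategy.weight_zero, Strategy.weight_single] at this
  exact zero_ne_one this

/-- The strategy that attains the maximum: the GHZ state, with equatorial observables. -/
def ghzStrategy (n : ℕ) (hm : 1 ≤ m) (s : ℤˣ) : Strategy.{u} (n + 1) m where
  honestSpace _ := liftedQubit
  groupSpace := liftedQubit
  purifier := liftedQubit
  state := ghzVec (n + 1)
  norm_state := norm_ghzVec (n + 1)
  honest i x := POVM.ofInvolution (phaseFlip (honestAngle s i x)) (star_phaseFlip _)
    (phaseFlip_mul_self (star_honestAngle_mul s i x)) (zero_ne_one (α := Fin 2))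
  group y := POVM.ofInvolution (phaseFlip (Complex.I ^ weight y)) (star_phaseFlip _)
    (phaseFlip_mul_self (star_I_pow_mul _)) (zero_ne_single hm)

theorem ghzStrategy_honestObs (hm : 1 ≤ m) (s : ℤˣ) (i : Fin (n + 1)) (x : Fin 2) :
    (ghzStrategy.{u} n hm s).honestObs i x = phaseFlip (honestAngle s i x) := by
  rw [Strategy.honestObs_eq]
  exact POVM.sum_smul_ofInvolution (phaseFlip (honestAngle s i x)) (star_phaseFlip _)
    (phaseFlip_mul_self (star_honestAngle_mul s i x)) (zero_ne_one (α := Fin 2))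
    (fun b : Fin 2 => (-1 : ℂ) ^ (b : ℕ)) (by simp) (by simp)

theorem ghzStrategy_groupObs (hm : 1 ≤ m) (s : ℤˣ) (y : Fin m → Fin 2) :
    (ghzStrategy.{u} n hm s).groupObs y = phaseFlip (Complex.I ^ weight y) :=
  POVM.sum_smul_ofInvolution (phaseFlip (Complex.I ^ weight y)) (star_phaseFlip _)
    (phaseFlip_mul_self (star_I_pow_mul _)) (zero_ne_single hm)
    (fun a : Fin m → Fin 2 => (-1 : ℂ) ^ weight a) (by simp [Strategy.weight_zero])
    (by simp [Strategy.weight_single])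

/-- The angle is sπ/4 plus wπ/2, whose cosine is always ±1/√2. Every correlator thus contributes
equally to the Svetlichny expression. -/
theorem firstPhase_mul_I_pow_re (s : ℤˣ) (w : ℕ) :
    (firstPhase s 1 * Complex.I ^ w).re = 1 / √2 * svetSign s w := by
  have hcast : ((s : ℤ) : ℂ) = (((s : ℤ) : ℝ) : ℂ) := by simp
  obtain ⟨j, rfl | rfl⟩ := Nat.even_or_odd' w
  · have h : firstPhase s 1 * Complex.I ^ (2 * j) =
        ((1 / √2 * (-1) ^ j : ℝ) : ℂ) * (1 + (((s : ℤ) : ℝ) : ℂ) * Complex.I) := by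
      rw [firstPhase, pow_mul, Complex.I_sq, hcast]
      push_cast
      ring
    rw [h, Complex.re_ofReal_mul, svetSign_even]
    simp
  · have h : firstPhase s 1 * Complex.I ^ (2 * j + 1) =
        ((1 / √2 * (-1) ^ j : ℝ) : ℂ) * (Complex.I - (((s : ℤ) : ℝ) : ℂ)) := by
      rw [firstPhase, pow_succ, pow_mul, Complex.I_sq, hcast]
      push_cast
      linear_combination (1 / (√2 : ℂ)) * (-1) ^ j * ((s : ℤ) : ℂ) * Complex.I_sq
    rw [h, Complex.re_ofReal_mul, svetSign_odd]
    simp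
    ring

theorem ghzStrategy_localOp_obs (hm : 1 ≤ m) (s : ℤˣ) (h : Fin (n + 1) → Fin 2)
    (y : Fin m → Fin 2) :
    localOp (ghzStrategy.{u} n hm s).purifier ((ghzStrategy.{u} n hm s).obs h y) =
      localOp liftedQubit fun o : Option (Fin (n + 1)) =>
        phaseFlip (o.elim (Complex.I ^ weight y) fun i => honestAngle s i (h i)) := by
  have hA : (fun i => (ghzStrategy.{u} n hm s).honestObs i (h i)) =
      fun i => phaseFlip.{u} (honestAngle s i (h i)) :=
    funext fun i => ghzStrategy_honestObs hm s i (h i)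
  have hB := ghzStrategy_groupObs.{u} (n := n) hm s y
  rw [localOp_apply, localOp_apply]
  simp only [Option.elim]
  rw [← hA, ← hB]
  rfl

theorem correlator_ghzStrategy (hm : 1 ≤ m) (s : ℤˣ) (h : Fin (n + 1) → Fin 2)
    (y : Fin m → Fin 2) :
    correlator (ghzStrategy.{u} n hm s).behaviour (Fin.append h y) =
      1 / √2 * svetSign s (weight h + weight y) := by
  have hc : ∏ o : Option (Fin (n + 1)), o.elim (Complex.I ^ weight y)
      (fun i => honestAngle s i (h i)) = firstPhase s 1 * Complex.I ^ (weight h + weight y) := by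
    rw [Fintype.prod_option]
    simp only [Option.elim, honestAngle, Finset.prod_mul_distrib, Finset.prod_pow_eq_pow_sum,
      Finset.prod_ite_eq', Finset.mem_univ, if_true]
    rw [pow_add, weight, weight]
    ring
  rw [Strategy.correlator_behaviour, ghzStrategy_localOp_obs, ← firstPhase_mul_I_pow_re, ← hc]
  exact (congrArg Complex.re (inner_phaseFlip_ghzVec.{u} (n + 1) _)).trans (Complex.ofReal_re _)

theorem svetlichny_ghzStrategy (hm : 1 ≤ m) (s : ℤˣ) :
    svetlichny s (ghzStrategy.{u} n hm s).behaviour = 2 ^ (n + m) * √2 := by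
  rw [Strategy.svetlichny_eq]
  have hterm (h : Fin (n + 1) → Fin 2) (y : Fin m → Fin 2) :
      svetSign s (weight h + weight y) *
        correlator (ghzStrategy.{u} n hm s).behaviour (Fin.append h y) = 1 / √2 := by
    rw [correlator_ghzStrategy, mul_left_comm, ← pow_two, svetSign_sq, mul_one]
  simp only [hterm, Finset.sum_const, Finset.card_univ, nsmul_eq_mul, Fintype.card_pi_const,
    Fintype.card_fin]
  have h2 : √2 * √2 = 2 := Real.mul_self_sqrt (by norm_num)
  have h2' : √2 ≠ 0 := by positivity
  push_cast
  field_simp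
  rw [pow_two, h2]
  ring

end Attained
end

theorem theorem1 (n m : ℕ) (hn : 1 ≤ n) (hm : 1 ≤ m) (s : ℤˣ) :
    (∀ S : Strategy.{u} n m, |svetlichny s S.behaviour| ≤ 2 ^ (n + m - 1) * √2) ∧
    (∃ S : Strategy.{u} n m, svetlichny s S.behaviour = 2 ^ (n + m - 1) * √2) ∧
    ∀ (ε : ℤˣ) (p : Behaviour (n + m)),
      svetlichny s p = ((ε : ℤ) : ℝ) * (2 ^ (n + m - 1) * √2) →
        SelfTests.{u} p (ghzState (n + 1)) (ghzHonest s ε) ghzGroup ∧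
        SelfTests.{u} p (graphState (n + 1)) (graphHonest s ε) (graphGroup s) := by
  -- This singles out a first honest party; `n` now counts the other honest ones.
  obtain ⟨n, rfl⟩ := Nat.exists_eq_add_of_le' hn
  have hnm : n + 1 + m - 1 = n + m := by omega
  rw [hnm]
  refine ⟨fun S => S.abs_svetlichny_le s hm, ⟨ghzStrategy n hm s, svetlichny_ghzStrategy hm s⟩,
    fun ε p hp => ⟨fun S hS => ?_, fun S hS => ?_⟩⟩
  all_goals
    subst hS
    have hopt := Strategy.isOptimal_of_svetlichny hm hp
  · exact (hopt.hasLocalSelfTest_ghz hm).exists_isometries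
  · exact (hopt.hasLocalSelfTest_graph hm).exists_isometries
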